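/- Let $N\ge 2$ be an integer, let $\mathcal D\subset\{0,\dots,N-1\}^2$ be nonempty, and let $K=K(N,\mathcal D)\subset\mathbb R^2$ be the corresponding fractal square, i.e. the unique nonempty compact set with $K=\bigcup_{d\in\mathcal D}\frac{K+d}{N}$. Put $\mathcal D_1=\mathcal D$, $\mathcal D_{j+1}=N\mathcal D_j+\mathcal D=\{Nd_1+d_2: d_1\in\mathcal D_j,\ d_2\in\mathcal D\}$ and $K^{(j)}=\bigcup_{d\in\mathcal D_j}\frac{[0,1]^2+d}{N^j}$ for $j\ge1$. For a set $X\subset\mathbb R^2$ let $\pi_0(X)\in\mathbb N\cup\{\infty\}$ denote its number of connected components. Then one of the following holds: (1) $\pi_0(K^{(n)})=\pi_0(K^{(n+1)})=\pi_0(K)$ for some $n\ge2$; (2) $\pi_0(K^{(n)})<\pi_0(K^{(n+1)})$ for all $n\ge2$. Moreover, in case (2), either uncountably many connected components of $K$ are single points, or $K$ is the product of a Cantor set and $[0,1]$, that is, $K=C\times[0,1]$ or $K=[0,1]\times C$ for some $C\subset\mathbb R$ that is nonempty, compact, totally disconnected and without isolated points. -/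

import Mathlib

/-- The number of connected components of a planar set, as an extended natural number
(`⊤` if there are infinitely many). -/
noncomputable def numComponents (X : Set (ℝ × ℝ)) : ℕ∞ :=
  ENat.card (ConnectedComponents X)

/-- The contraction `x ↦ (x + d) / N` of the plane. -/
noncomputable def digitMap (N : ℕ) (d : ℕ × ℕ) (x : ℝ × ℝ) : ℝ × ℝ :=
  ((x.1 + d.1) / N, (x.2 + d.2) / N)

/-- `K` is the fractal square `K(N, D)`: a nonempty compact set with `K = ⋃_{d ∈ D} (K + d) / N`
(for `2 ≤ N` and nonempty `D` there is exactly one such set). -/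
structure IsFractalSquare (N : ℕ) (D : Finset (ℕ × ℕ)) (K : Set (ℝ × ℝ)) : Prop where
  nonempty : K.Nonempty
  isCompact : IsCompact K
  eq_iUnion : K = ⋃ d ∈ D, digitMap N d '' K

/-- The iterated digit sets: `D_1 = D` and `D_{j+1} = N D_j + D`
(the recursion starts from `D_0 = {0}`). -/
def iterDigits (N : ℕ) (D : Finset (ℕ × ℕ)) : ℕ → Finset (ℕ × ℕ)
  | 0 => {(0, 0)}
  | j + 1 => (iterDigits N D j ×ˢ D).image
      fun p => (N * p.1.1 + p.2.1, N * p.1.2 + p.2.2)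

/-- The `j`-th approximation `K^{(j)} = ⋃_{d ∈ D_j} ([0,1]² + d) / N^j`. -/
noncomputable def approximation (N : ℕ) (D : Finset (ℕ × ℕ)) (j : ℕ) : Set (ℝ × ℝ) :=
  ⋃ d ∈ iterDigits N D j, digitMap (N ^ j) d '' (Set.Icc 0 1 ×ˢ Set.Icc 0 1)

/-- The points `x` of `X` such that `{x}` is a connected component of `X`. -/
def pointComponents (X : Set (ℝ × ℝ)) : Set (ℝ × ℝ) :=
  {x | x ∈ X ∧ connectedComponentIn X x = {x}}

/-- A Cantor set in the line: nonempty, compact, without isolated points, totally disconnected. -/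
structure IsLinearCantorSet (C : Set ℝ) : Prop where
  nonempty : C.Nonempty
  isCompact : IsCompact C
  preperfect : Preperfect C
  isTotallyDisconnected : IsTotallyDisconnected C

/-- `X` is the product of a Cantor set and `[0,1]`, the Cantor set being on either axis. -/
def IsCantorTimesInterval (X : Set (ℝ × ℝ)) : Prop :=
  ∃ C : Set ℝ, IsLinearCantorSet C ∧ (X = C ×ˢ Set.Icc 0 1 ∨ X = Set.Icc 0 1 ×ˢ C)

/-! ### Grid cells, king adjacency and links. -/

namespace FractalSquare

/-! The squares of $K^{(n)}$ are encoded by the integer cells `level N D n`. Two squares meet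
exactly when their cells are king-adjacent, so the components of $K^{(n)}$ are the classes of
`Linked kadj`. Every class of level n+1 lies over a class of level n, and every class of level n is
covered; hence the counts never decrease, and equality means that no class splits, which is `Rigid`.

Dichotomy. For n ≥ 2 rigidity passes to the next level (`Rigid.succ`). What has to be shown is that
adjacent cells of level n+1 are joined by steps `Gd` between cells whose copies of `D` touch.
Compare first digits. If they agree, rigidity of level n applies; if they are diagonal neighbours,
`D` contains the two opposite corners that make diagonal copies touch. Side-by-side digits are the
heart (`Rigid.linked_horizontal`). In the case not settled by corners, `D` has two cells in one row
at its lateral ends, so horizontally adjacent copies always touch and `Gd`-components cannot cross.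
A discrete Jordan argument (`exists_side`) and an exit argument (`Rigid.exists_exit`) show that
either each lateral column of `D` lies in a single `Gd`-component, or every component touches both
lateral neighbours and the components are ordered by height. In the second case a missing link
yields a height threshold respected by all contacts. It bounds a `Gd`-closed set that cuts a tile,
which rigidity forbids (`Rigid.run_false`, `Rigid.equal_false`). Once all levels from n on are
rigid, the components of $K$ are decreasing intersections of compact connected regions, one for each
class of level n (`Attractor.numComponents_eq`).

Strict growth. If `D` is a union of full rows or of full columns, $K$ is a product. Otherwise some
word confines the component of its cell to bounded size, whatever precedes it
(`ManyComponents.hasCut`). Without such a word, a component avoiding the corners of the box would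
have to join two opposite sides. By planarity only boundedly many components then reach the other
two sides, so with many components one of them runs along a single row of tiles, and a digit missing
from a row of `D` cuts it. Addresses that use the confining word infinitely often give uncountably
many point components (`Attractor.not_countable_pointComponents`). -/

/-- King adjacency (or equality) of cells of the square grid. -/
def kadj (p q : ℤ × ℤ) : Prop :=
  p.1 ≤ q.1 + 1 ∧ q.1 ≤ p.1 + 1 ∧ p.2 ≤ q.2 + 1 ∧ q.2 ≤ p.2 + 1

/-- `Linked R X p q`: the cell `q` can be reached from `p` by `R`-steps inside `X`. -/
def Linked (R : ℤ × ℤ → ℤ × ℤ → Prop) (X : Set (ℤ × ℤ)) : ℤ × ℤ → ℤ × ℤ → Prop :=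
  Relation.ReflTransGen fun p q => p ∈ X ∧ q ∈ X ∧ R p q

theorem kadj_symm {p q : ℤ × ℤ} (h : kadj p q) : kadj q p := by unfold kadj at *; omega

section Linked

variable {R R' : ℤ × ℤ → ℤ × ℤ → Prop} {X Y : Set (ℤ × ℤ)} {p q r : ℤ × ℤ}

theorem Linked.refl (p : ℤ × ℤ) : Linked R X p p := Relation.ReflTransGen.refl

theorem Linked.trans (h : Linked R X p q) (h' : Linked R X q r) : Linked R X p r :=
  Relation.ReflTransGen.trans h h'

theorem Linked.single (hp : p ∈ X) (hq : q ∈ X) (h : R p q) : Linked R X p q :=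
  Relation.ReflTransGen.single ⟨hp, hq, h⟩

theorem Linked.symm (hR : ∀ p q, R p q → R q p) (h : Linked R X p q) : Linked R X q p := by
  induction h with
  | refl => exact Linked.refl _
  | tail _ h ih => exact (Linked.single h.2.1 h.1 (hR _ _ h.2.2)).trans ih

theorem Linked.mem (h : Linked R X p q) (hp : p ∈ X) : q ∈ X := by
  induction h with
  | refl => exact hp
  | tail _ h _ => exact h.2.1

/-- A set that no step leaves contains everything that is linked to its members. -/
theorem Linked.mem_of_closed {F : Set (ℤ × ℤ)} (h : Linked R X p q)
    (hF : ∀ a ∈ F, ∀ b ∈ X, a ∈ X → R a b → b ∈ F) (hp : p ∈ F) : q ∈ F := by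
  induction h with
  | refl => exact hp
  | tail _ h ih => exact hF _ ih _ h.2.1 h.1 h.2.2

theorem Linked.lift (f : ℤ × ℤ → ℤ × ℤ) (h : Linked R X p q)
    (hf : ∀ a ∈ X, ∀ b ∈ X, R a b → Linked R' Y (f a) (f b)) : Linked R' Y (f p) (f q) := by
  induction h with
  | refl => exact Linked.refl _
  | tail _ h ih => exact ih.trans (hf _ h.1 _ h.2.1 h.2.2)

/-- A link is realized by a finite path. -/
theorem Linked.exists_path (h : Linked R X p q) (hp : p ∈ X) :
    ∃ (n : ℕ) (γ : ℕ → ℤ × ℤ), γ 0 = p ∧ γ n = q ∧ (∀ i ≤ n, Linked R X p (γ i)) ∧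
      (∀ i ≤ n, γ i ∈ X) ∧ ∀ i < n, R (γ i) (γ (i + 1)) := by
  induction h with
  | refl => exact ⟨0, fun _ => p, rfl, rfl, fun _ _ => Linked.refl _, fun _ _ => hp, by simp⟩
  | @tail b c hpb hs ih =>
    obtain ⟨n, γ, h0, hn, hl, hm, hst⟩ := ih
    have hc : Linked R X p c := Relation.ReflTransGen.tail hpb hs
    refine ⟨n + 1, fun i => if i ≤ n then γ i else c, by simp [h0], by simp, ?_, ?_, ?_⟩
    · intro i _
      by_cases h : i ≤ n
      · simpa [h] using hl i h
      · simpa [h] using hc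
    · intro i _
      by_cases h : i ≤ n
      · simpa [h] using hm i h
      · simpa [h] using hs.2.1
    · intro i hi
      rcases Nat.lt_or_ge i n with h | h
      · have h1 : i ≤ n := h.le
        have h2 : i + 1 ≤ n := h
        simpa [h1, h2] using hst i h
      · have : i = n := by omega
        subst this
        simpa [hn] using hs.2.2

end Linked

/-! ### Discrete planarity: the winding function of a left-to-right path. -/

section Planarity

/-- Signed crossing of the step `s → s'` with the vertical ray going down from the right side of
the cell `p`. -/
def crossing (s s' p : ℤ × ℤ) : ℤ :=
  if s.1 ≤ p.1 ∧ p.1 < s'.1 ∧ s.2 < p.2 then 1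
  else if s'.1 ≤ p.1 ∧ p.1 < s.1 ∧ s'.2 < p.2 then -1 else 0

/-- The height of a step is read at its left end, so raising the tip of the ray by one cell affects
only a step whose left end is `p` itself. -/
theorem crossing_vertical {s s' p p' : ℤ × ℤ} (h : kadj s s') (hs : s ≠ p) (hs' : s' ≠ p)
    (h1 : p'.1 = p.1) (h2 : p'.2 = p.2 + 1) : crossing s s' p = crossing s s' p' := by
  obtain ⟨a, b⟩ := s; obtain ⟨a', b'⟩ := s'; obtain ⟨x, y⟩ := p; obtain ⟨x', y'⟩ := p'
  simp only [crossing, kadj, ne_eq, Prod.mk.injEq] at *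
  split_ifs <;> omega

/-- Indicator of the part below height `θ` of column `x`. -/
def colBelow (x θ : ℤ) (s : ℤ × ℤ) : ℤ := if s.1 = x ∧ s.2 < θ then 1 else 0

/-- The two rays bound the part of column `p'.1` below `p'`. What enters it on the left minus what
leaves on the right is the change of its indicator. The last three hypotheses exclude steps that
slip diagonally between `p` and `p'`. -/
theorem crossing_horizontal {s s' p p' : ℤ × ℤ} (h : kadj s s') (hs : s ≠ p) (hs' : s' ≠ p)
    (ks : s ≠ p') (ks' : s' ≠ p') (h1 : p'.1 = p.1 + 1) (h2 : p.2 ≤ p'.2 + 1)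
    (h3 : p'.2 ≤ p.2 + 1)
    (hd : ¬ (s = (p.1, p.2 - 1) ∧ s' = (p.1 + 1, p.2)))
    (hd' : ¬ (s' = (p.1, p.2 - 1) ∧ s = (p.1 + 1, p.2)))
    (hc : p'.2 = p.2 + 1 → s ≠ (p.1 + 1, p.2) ∧ s' ≠ (p.1 + 1, p.2)) :
    crossing s s' p - crossing s s' p' =
      colBelow p'.1 p'.2 s' - colBelow p'.1 p'.2 s := by
  obtain ⟨a, b⟩ := s; obtain ⟨a', b'⟩ := s'; obtain ⟨x, y⟩ := p; obtain ⟨x', y'⟩ := p'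
  simp only [crossing, colBelow, kadj, ne_eq, Prod.mk.injEq] at *
  subst h1
  have : y' = y ∨ y' = y + 1 ∨ y' = y - 1 := by omega
  rcases this with rfl | rfl | rfl <;> split_ifs <;> omega

/-- The winding function of a left-to-right path. -/
def winding (γ : ℕ → ℤ × ℤ) (n : ℕ) (p : ℤ × ℤ) : ℤ :=
  (∑ i ∈ Finset.range n, crossing (γ i) (γ (i + 1)) p) +
    -- The end term acts as a final crossing, as if the path left the box to the right of its last
    -- cell.
    if p.1 = (γ n).1 ∧ (γ n).2 < p.2 then 1 else 0

variable {γ : ℕ → ℤ × ℤ} {n : ℕ} {M : ℤ} {p p' : ℤ × ℤ}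

theorem winding_vertical (hst : ∀ i < n, kadj (γ i) (γ (i + 1)))
    (hp : ∀ i ≤ n, γ i ≠ p) (h1 : p'.1 = p.1) (h2 : p'.2 = p.2 + 1) :
    winding γ n p = winding γ n p' := by
  unfold winding
  congr 1
  · refine Finset.sum_congr rfl fun i hi => ?_
    have hi := Finset.mem_range.1 hi
    exact crossing_vertical (hst i hi) (hp i hi.le) (hp _ hi) h1 h2
  · have := hp n le_rfl
    generalize γ n = s at this
    obtain ⟨a, b⟩ := s; obtain ⟨x, y⟩ := p; obtain ⟨x', y'⟩ := p'
    simp only [ne_eq, Prod.mk.injEq] at *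
    split_ifs <;> omega

/-- The differences telescope. The start contributes nothing because it lies in column 0, left of
`p'`; the contribution of the end is exactly the end term of `winding`. -/
theorem winding_horizontal (h0 : (γ 0).1 = 0) (hst : ∀ i < n, kadj (γ i) (γ (i + 1)))
    (hp : ∀ i ≤ n, γ i ≠ p) (hp' : ∀ i ≤ n, γ i ≠ p') (hx : 0 ≤ p.1) (hx' : p'.1 ≤ (γ n).1)
    (h1 : p'.1 = p.1 + 1) (h2 : p.2 ≤ p'.2 + 1) (h3 : p'.2 ≤ p.2 + 1)
    (hd : ∀ i < n, ¬ (γ i = (p.1, p.2 - 1) ∧ γ (i + 1) = (p.1 + 1, p.2)))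
    (hd' : ∀ i < n, ¬ (γ (i + 1) = (p.1, p.2 - 1) ∧ γ i = (p.1 + 1, p.2)))
    (hc : p'.2 = p.2 + 1 → ∀ i ≤ n, γ i ≠ (p.1 + 1, p.2)) :
    winding γ n p = winding γ n p' := by
  have key : ∑ i ∈ Finset.range n, (crossing (γ i) (γ (i + 1)) p -
      crossing (γ i) (γ (i + 1)) p') = colBelow p'.1 p'.2 (γ n) - colBelow p'.1 p'.2 (γ 0) := by
    rw [← Finset.sum_range_sub (fun i => colBelow p'.1 p'.2 (γ i))]
    refine Finset.sum_congr rfl fun i hi => ?_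
    have hi := Finset.mem_range.1 hi
    exact crossing_horizontal (hst i hi) (hp i hi.le) (hp _ hi) (hp' i hi.le) (hp' _ hi) h1 h2 h3
      (hd i hi) (hd' i hi) fun h => ⟨hc h i hi.le, hc h _ hi⟩
  rw [Finset.sum_sub_distrib] at key
  unfold winding
  have e0 : colBelow p'.1 p'.2 (γ 0) = 0 := by
    unfold colBelow; rw [if_neg]; omega
  rw [e0] at key
  unfold colBelow at key
  have e1 : ¬ (p.1 = (γ n).1 ∧ (γ n).2 < p.2) := by omega
  rw [if_neg e1]
  have : (if (γ n).1 = p'.1 ∧ (γ n).2 < p'.2 then (1 : ℤ) else 0) =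
      if p'.1 = (γ n).1 ∧ (γ n).2 < p'.2 then 1 else 0 := by
    simp only [eq_comm]
  linarith

theorem winding_left (h0 : (γ 0).1 = 0) (hst : ∀ i < n, kadj (γ i) (γ (i + 1)))
    (hn : 0 < (γ n).1) (hbox : ∀ i ≤ n, 0 ≤ (γ i).1) (hp : ∀ i ≤ n, γ i ≠ p) (hx : p.1 = 0) :
    winding γ n p = if (γ 0).2 < p.2 then 1 else 0 := by
  have key : ∑ i ∈ Finset.range n, crossing (γ i) (γ (i + 1)) p =
      - (colBelow 0 p.2 (γ n) - colBelow 0 p.2 (γ 0)) := by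
    rw [← Finset.sum_range_sub (fun i => colBelow 0 p.2 (γ i)), ← Finset.sum_neg_distrib]
    refine Finset.sum_congr rfl fun i hi => ?_
    have hi := Finset.mem_range.1 hi
    have a1 := hst i hi
    have a2 := hp i hi.le
    have a3 := hp _ hi
    have a4 := hbox i hi.le
    have a5 := hbox (i + 1) hi
    generalize γ i = s at *
    generalize γ (i + 1) = s' at *
    obtain ⟨a, b⟩ := s; obtain ⟨a', b'⟩ := s'; obtain ⟨x, y⟩ := p
    simp only [crossing, colBelow, kadj, ne_eq, Prod.mk.injEq] at *
    subst hx
    split_ifs <;> omega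
  unfold winding
  rw [key]
  unfold colBelow
  rw [if_neg (by omega), if_neg (by omega : ¬ (p.1 = (γ n).1 ∧ (γ n).2 < p.2))]
  simp [h0]

theorem winding_right (hbox : ∀ i ≤ n, (γ i).1 ≤ (γ n).1) (hx : p.1 = (γ n).1) :
    winding γ n p = if (γ n).2 < p.2 then 1 else 0 := by
  have key : ∑ i ∈ Finset.range n, crossing (γ i) (γ (i + 1)) p = 0 := by
    refine Finset.sum_eq_zero fun i hi => ?_
    have hi := Finset.mem_range.1 hi
    have a4 := hbox i hi.le
    have a5 := hbox (i + 1) hi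
    unfold crossing
    rw [if_neg (by omega), if_neg (by omega)]
  unfold winding
  rw [key]
  simp [hx]

/-- A path that stays at or below the row of `p` and avoids `p` has all its passages of the ray's
column counted, so the sum telescopes to one net passage. -/
theorem winding_top (h0 : (γ 0).1 = 0) (hst : ∀ i < n, kadj (γ i) (γ (i + 1)))
    (hbox : ∀ i ≤ n, (γ i).2 ≤ p.2) (hp : ∀ i ≤ n, γ i ≠ p) (hx : 0 ≤ p.1)
    (hx' : p.1 ≤ (γ n).1) : winding γ n p = 1 := by
  have key : ∑ i ∈ Finset.range n, crossing (γ i) (γ (i + 1)) p =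
      - ((if (γ n).1 ≤ p.1 then 1 else 0) - (if (γ 0).1 ≤ p.1 then 1 else 0)) := by
    rw [← Finset.sum_range_sub (fun i => if (γ i).1 ≤ p.1 then (1 : ℤ) else 0),
      ← Finset.sum_neg_distrib]
    refine Finset.sum_congr rfl fun i hi => ?_
    have hi := Finset.mem_range.1 hi
    have a1 := hst i hi
    have a2 := hp i hi.le
    have a3 := hp _ hi
    have a4 := hbox i hi.le
    have a5 := hbox (i + 1) hi
    generalize γ i = s at *
    generalize γ (i + 1) = s' at *
    obtain ⟨a, b⟩ := s; obtain ⟨a', b'⟩ := s'; obtain ⟨x, y⟩ := p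
    simp only [crossing, kadj, ne_eq, Prod.mk.injEq] at *
    split_ifs <;> omega
  unfold winding
  rw [key, h0]
  have a2 := hp n le_rfl
  have a3 := hbox n le_rfl
  generalize γ n = s at *
  obtain ⟨a, b⟩ := s; obtain ⟨x, y⟩ := p
  simp only [ne_eq, Prod.mk.injEq] at *
  split_ifs <;> omega

theorem winding_bottom (hbox : ∀ i ≤ n, 0 ≤ (γ i).2) (hy : p.2 = 0) : winding γ n p = 0 := by
  have key : ∑ i ∈ Finset.range n, crossing (γ i) (γ (i + 1)) p = 0 := by
    refine Finset.sum_eq_zero fun i hi => ?_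
    have hi := Finset.mem_range.1 hi
    have a4 := hbox i hi.le
    have a5 := hbox (i + 1) hi
    unfold crossing
    rw [if_neg (by omega), if_neg (by omega)]
  have a3 := hbox n le_rfl
  unfold winding
  rw [key, if_neg (by omega)]
  rfl

/-- Two `R`-components of `X` cannot cross each other diagonally. -/
def NonCrossing (R : ℤ × ℤ → ℤ × ℤ → Prop) (X : Set (ℤ × ℤ)) : Prop :=
  ∀ q ∈ X, (q.1 + 1, q.2 + 1) ∈ X → R q (q.1 + 1, q.2 + 1) →
    ((q.1 + 1, q.2) ∈ X → Linked R X q (q.1 + 1, q.2)) ∧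
    ((q.1, q.2 + 1) ∈ X → Linked R X q (q.1, q.2 + 1))

/-- A component that joins the left side of the box to its right side has every other component
either above it or below it. -/
theorem exists_side {R : ℤ × ℤ → ℤ × ℤ → Prop} {X : Set (ℤ × ℤ)} (hR : ∀ p q, R p q → R q p)
    (hk : ∀ p q, R p q → kadj p q) (hM : 2 ≤ M)
    (hX : ∀ p ∈ X, 0 ≤ p.1 ∧ p.1 < M ∧ 0 ≤ p.2 ∧ p.2 < M) (hNC : NonCrossing R X)
    {a a' b₀ : ℤ × ℤ} (ha : a ∈ X) (hl : Linked R X a a') (ha0 : a.1 = 0) (ha' : a'.1 = M - 1)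
    (hb₀ : b₀ ∈ X) (hnl : ¬ Linked R X a b₀) :
    ∃ up : Prop, ∀ b, Linked R X b₀ b → (b.1 = 0 → (a.2 < b.2 ↔ up)) ∧
      (b.1 = M - 1 → (a'.2 < b.2 ↔ up)) ∧ (b.2 = M - 1 → up) ∧ (b.2 = 0 → ¬ up) := by
  obtain ⟨n, γ, h0, hn, hγl, hγX, hγs⟩ := hl.exists_path ha
  have hst : ∀ i < n, kadj (γ i) (γ (i + 1)) := fun i hi => hk _ _ (hγs i hi)
  have hne : ∀ b, Linked R X b₀ b → ∀ i ≤ n, γ i ≠ b := by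
    intro b hb i hi h
    exact hnl ((hγl i hi).trans (h ▸ hb.symm hR))
  have inv : ∀ b, Linked R X b₀ b → winding γ n b = winding γ n b₀ := by
    -- a step of the second component to the next column
    have hor : ∀ c d, Linked R X b₀ c → Linked R X b₀ d → c ∈ X → d ∈ X → R c d →
        d.1 = c.1 + 1 → winding γ n c = winding γ n d := by
      intro c d hc hd hcX hdX hcd h1
      have hk' := hk _ _ hcd
      refine winding_horizontal (by rw [h0, ha0]) hst (hne c hc) (hne d hd) (hX c hcX).1
        ?_ h1 hk'.2.2.1 hk'.2.2.2 ?_ ?_ ?_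
      · rw [hn, ha']; have := (hX d hdX).2.1; omega
      · rintro i hi ⟨e1, e2⟩
        have hr := hγs i hi
        have m1 := hγX i hi.le
        have m2 := hγX (i + 1) hi
        rw [e1] at hr m1
        rw [e2] at hr m2
        have := (hNC (c.1, c.2 - 1) m1 (by simpa using m2) (by simpa using hr)).2
          (by simpa using hcX)
        apply hnl
        refine (e1 ▸ hγl i hi.le).trans (this.trans ?_)
        simpa using hc.symm hR
      · rintro i hi ⟨e1, e2⟩
        have hr := hR _ _ (hγs i hi)
        have m1 := hγX i hi.le
        have m2 := hγX (i + 1) hi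
        rw [e1] at hr m2
        rw [e2] at hr m1
        have := (hNC (c.1, c.2 - 1) m2 (by simpa using m1) (by simpa using hr)).2
          (by simpa using hcX)
        apply hnl
        refine (e1 ▸ hγl (i + 1) hi).trans (this.trans ?_)
        simpa using hc.symm hR
      · intro h2 i hi e
        have hd' : d = (c.1 + 1, c.2 + 1) := Prod.ext h1 h2
        have m := hγX i hi
        rw [e] at m
        have := (hNC c hcX (hd' ▸ hdX) (hd' ▸ hcd)).1 m
        exact hnl ((e ▸ hγl i hi).trans ((this.symm hR).trans (hc.symm hR)))
    intro b hb
    induction hb with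
    | refl => rfl
    | @tail c d hc hs ih =>
      have hd : Linked R X b₀ d := Relation.ReflTransGen.tail hc hs
      have hk' := hk _ _ hs.2.2
      rw [← ih]
      rcases lt_trichotomy c.1 d.1 with h | h | h
      · exact (hor c d hc hd hs.1 hs.2.1 hs.2.2 (by have := hk'.2.1; omega)).symm
      · rcases lt_trichotomy c.2 d.2 with g | g | g
        · exact (winding_vertical hst (hne c hc) h.symm (by have := hk'.2.2.2; omega)).symm
        · rw [Prod.ext h g]
        · exact winding_vertical hst (hne d hd) h (by have := hk'.2.2.1; omega)
      · exact hor d c hd hc hs.2.1 hs.1 (hR _ _ hs.2.2) (by have := hk'.1; omega)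
  -- Along the second component the winding function is constant. Its value is 1 above the path and
  -- 0 below it, as read off on each side of the box.
  refine ⟨winding γ n b₀ = 1, fun b hb => ⟨fun h => ?_, fun h => ?_, fun h => ?_, fun h => ?_⟩⟩
  · rw [← inv b hb, winding_left (by rw [h0, ha0]) hst (by rw [hn]; omega)
      (fun i hi => (hX _ (hγX i hi)).1) (hne b hb) h, h0]
    split_ifs with h <;> simp [h]
  · rw [← inv b hb, winding_right (fun i hi => by
      rw [hn, ha']; have := (hX _ (hγX i hi)).2.1; omega) (by rw [hn, ha', h]), hn]
    split_ifs with h <;> simp [h]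
  · have hbX := hX b (hb.mem hb₀)
    rw [← inv b hb]
    exact winding_top (by rw [h0, ha0]) hst (fun i hi => by
      have := (hX _ (hγX i hi)).2.2.2; omega) (hne b hb) hbX.1 (by rw [hn, ha']; omega)
  · rw [← inv b hb, winding_bottom (fun i hi => (hX _ (hγX i hi)).2.2.1) h]
    norm_num

end Planarity

end FractalSquare

/-! ### Positional addresses of cells. -/

namespace FractalSquare

/-- The cell with "digits" `w` followed by `u`, where `u` is read in the box of side `B`. -/
def cat (B : ℤ) (w u : ℤ × ℤ) : ℤ × ℤ := (B * w.1 + u.1, B * w.2 + u.2)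

/-- The digit sets `D_n` as sets of cells. -/
def level (N : ℤ) (D : Set (ℤ × ℤ)) : ℕ → Set (ℤ × ℤ)
  | 0 => {0}
  | n + 1 => {p | ∃ w ∈ level N D n, ∃ d ∈ D, p = cat N w d}

/-- The cells of `X` lie in the box `[0, B)²`. -/
def InBox (B : ℤ) (X : Set (ℤ × ℤ)) : Prop :=
  ∀ d ∈ X, 0 ≤ d.1 ∧ d.1 < B ∧ 0 ≤ d.2 ∧ d.2 < B

/-- A carry between neighbouring blocks occurs only from the last digit of one to the first digit of
the next. -/
theorem near_of_near {B a b w w' : ℤ} (ha : 0 ≤ a) (ha' : a < B) (hb' : b < B)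
    (h : B * w + a ≤ B * w' + b + 1) : w ≤ w' ∨ (w = w' + 1 ∧ a = 0 ∧ b = B - 1) := by
  by_cases hw : w ≤ w'
  · exact Or.inl hw
  · right
    by_cases h1 : w = w' + 1
    · subst h1
      have : B * (w' + 1) = B * w' + B := by ring
      omega
    · have : B * (w' + 2) ≤ B * w := mul_le_mul_of_nonneg_left (by omega) (by omega)
      have : B * (w' + 2) = B * w' + B + B := by ring
      omega

theorem digit_unique {B a b w w' : ℤ} (ha : 0 ≤ a) (ha' : a < B) (hb : 0 ≤ b) (hb' : b < B)
    (h : B * w + a = B * w' + b) : w = w' ∧ a = b := by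
  rcases near_of_near (w := w) (w' := w') ha ha' hb' (by omega) with h1 | h1
  · rcases near_of_near (w := w') (w' := w) hb hb' ha' (by omega) with h2 | h2
    · have : w = w' := by omega
      subst this
      omega
    · obtain ⟨h2, h3, h4⟩ := h2
      subst h2
      have : B * (w + 1) = B * w + B := by ring
      omega
  · obtain ⟨h2, h3, h4⟩ := h1
    subst h2
    have : B * (w' + 1) = B * w' + B := by ring
    omega

theorem cat_assoc (A B : ℤ) (c u v : ℤ × ℤ) : cat A (cat B c u) v = cat (A * B) c (cat A u v) := by
  simp only [cat, Prod.mk.injEq]; constructor <;> ring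

@[simp] theorem cat_zero_left (B : ℤ) (u : ℤ × ℤ) : cat B 0 u = u := by simp [cat]

@[simp] theorem cat_one_zero (w : ℤ × ℤ) : cat 1 w 0 = w := by simp [cat]

theorem cat_inj {B : ℤ} {X : Set (ℤ × ℤ)} (hX : InBox B X) {w w' u u' : ℤ × ℤ} (hu : u ∈ X)
    (hu' : u' ∈ X) (h : cat B w u = cat B w' u') : w = w' ∧ u = u' := by
  have h1 := hX u hu
  have h2 := hX u' hu'
  simp only [cat, Prod.mk.injEq] at h
  have a := digit_unique h1.1 h1.2.1 h2.1 h2.2.1 h.1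
  have b := digit_unique h1.2.2.1 h1.2.2.2 h2.2.2.1 h2.2.2.2 h.2
  exact ⟨Prod.ext a.1 b.1, Prod.ext a.2 b.2⟩

theorem kadj_cat {B : ℤ} {w u u' : ℤ × ℤ} : kadj (cat B w u) (cat B w u') ↔ kadj u u' := by
  simp only [kadj, cat]; omega

/-- The position of the boxes of two adjacent cells: coordinate by coordinate, the boxes agree or
the cells lie at facing ends of adjacent boxes. -/
theorem kadj_cat_cases {B : ℤ} {X : Set (ℤ × ℤ)} (hX : InBox B X) {w w' u u' : ℤ × ℤ} (hu : u ∈ X)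
    (hu' : u' ∈ X) (h : kadj (cat B w u) (cat B w' u')) :
    (w.1 = w'.1 ∧ u.1 ≤ u'.1 + 1 ∧ u'.1 ≤ u.1 + 1 ∨ w'.1 = w.1 + 1 ∧ u.1 = B - 1 ∧ u'.1 = 0 ∨
      w.1 = w'.1 + 1 ∧ u.1 = 0 ∧ u'.1 = B - 1) ∧
    (w.2 = w'.2 ∧ u.2 ≤ u'.2 + 1 ∧ u'.2 ≤ u.2 + 1 ∨ w'.2 = w.2 + 1 ∧ u.2 = B - 1 ∧ u'.2 = 0 ∨
      w.2 = w'.2 + 1 ∧ u.2 = 0 ∧ u'.2 = B - 1) := by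
  have h1 := hX u hu
  have h2 := hX u' hu'
  have key : ∀ {w w' u u' : ℤ}, 0 ≤ u → u < B → 0 ≤ u' → u' < B → B * w + u ≤ B * w' + u' + 1 →
      B * w' + u' ≤ B * w + u + 1 → (w = w' ∧ u ≤ u' + 1 ∧ u' ≤ u + 1 ∨
      w' = w + 1 ∧ u = B - 1 ∧ u' = 0 ∨ w = w' + 1 ∧ u = 0 ∧ u' = B - 1) := by
    intro w w' u u' a1 a2 a3 a4 a5 a6
    rcases near_of_near a1 a2 a4 a5 with b | b
    · rcases near_of_near a3 a4 a2 a6 with c | c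
      · have : w = w' := by omega
        subst this
        omega
      · omega
    · omega
  exact ⟨key h1.1 h1.2.1 h2.1 h2.2.1 h.1 h.2.1,
    key h1.2.2.1 h1.2.2.2 h2.2.2.1 h2.2.2.2 h.2.2.1 h.2.2.2⟩

theorem kadj_of_kadj_cat {B : ℤ} {X : Set (ℤ × ℤ)} (hX : InBox B X) {w w' u u' : ℤ × ℤ}
    (hu : u ∈ X) (hu' : u' ∈ X) (h : kadj (cat B w u) (cat B w' u')) : kadj w w' := by
  have := kadj_cat_cases hX hu hu' h
  unfold kadj
  omega

section level

variable {N : ℤ} {D : Set (ℤ × ℤ)}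

theorem mem_level_succ {n : ℕ} {p : ℤ × ℤ} :
    p ∈ level N D (n + 1) ↔ ∃ w ∈ level N D n, ∃ d ∈ D, p = cat N w d := Iff.rfl

theorem cat_mem_level_succ {n : ℕ} {w d : ℤ × ℤ} (hw : w ∈ level N D n) (hd : d ∈ D) :
    cat N w d ∈ level N D (n + 1) := ⟨w, hw, d, hd, rfl⟩

@[simp] theorem level_one : level N D 1 = D := by
  ext p
  constructor
  · rintro ⟨w, hw, d, hd, rfl⟩
    rw [Set.mem_singleton_iff.1 hw, cat_zero_left]
    exact hd
  · exact fun h => ⟨0, rfl, p, h, (cat_zero_left N p).symm⟩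

theorem mem_level_add {m k : ℕ} {p : ℤ × ℤ} :
    p ∈ level N D (m + k) ↔ ∃ c ∈ level N D m, ∃ u ∈ level N D k, p = cat (N ^ k) c u := by
  induction k generalizing p with
  | zero => simp [level]
  | succ k ih =>
    rw [← add_assoc, mem_level_succ]
    constructor
    · rintro ⟨w, hw, d, hd, rfl⟩
      obtain ⟨c, hc, u, hu, rfl⟩ := ih.1 hw
      exact ⟨c, hc, cat N u d, cat_mem_level_succ hu hd, by rw [cat_assoc, pow_succ, mul_comm]⟩
    · rintro ⟨c, hc, u, ⟨v, hv, d, hd, rfl⟩, rfl⟩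
      exact ⟨cat (N ^ k) c v, ih.2 ⟨c, hc, v, hv, rfl⟩, d, hd, by
        rw [cat_assoc, pow_succ, mul_comm]⟩

theorem cat_mem_level_add {m k : ℕ} {c u : ℤ × ℤ} (hc : c ∈ level N D m) (hu : u ∈ level N D k) :
    cat (N ^ k) c u ∈ level N D (m + k) := mem_level_add.2 ⟨c, hc, u, hu, rfl⟩

/-- The definition of `level` peels off the last digit. Peeling off the first one expresses
self-similarity and allows a common leading digit to be dropped and restored. -/
theorem mem_level_succ' {m : ℕ} {p : ℤ × ℤ} :
    p ∈ level N D (m + 1) ↔ ∃ d ∈ D, ∃ u ∈ level N D m, p = cat (N ^ m) d u := by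
  rw [add_comm, mem_level_add, level_one]

theorem cat_mem_level_succ' {m : ℕ} {d u : ℤ × ℤ} (hd : d ∈ D) (hu : u ∈ level N D m) :
    cat (N ^ m) d u ∈ level N D (m + 1) := mem_level_succ'.2 ⟨d, hd, u, hu, rfl⟩

theorem inBox_level (hD : InBox N D) (n : ℕ) : InBox (N ^ n) (level N D n) := by
  induction n with
  | zero => intro d hd; simp only [level, Set.mem_singleton_iff] at hd; subst hd; simp
  | succ n ih =>
    rintro _ ⟨w, hw, d, hd, rfl⟩
    have h1 := ih w hw
    have h2 := hD d hd
    have hN : 0 ≤ N := by omega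
    have k1 : N * (w.1 + 1) ≤ N * N ^ n := mul_le_mul_of_nonneg_left (by omega) hN
    have k2 : N * (w.2 + 1) ≤ N * N ^ n := mul_le_mul_of_nonneg_left (by omega) hN
    have k3 : 0 ≤ N * w.1 := mul_nonneg hN h1.1
    have k4 : 0 ≤ N * w.2 := mul_nonneg hN h1.2.2.1
    have e : N ^ (n + 1) = N * N ^ n := by ring
    simp only [cat]
    rw [e]
    refine ⟨by omega, by linarith, by omega, by linarith⟩

theorem InBox.finite {B : ℤ} {X : Set (ℤ × ℤ)} (h : InBox B X) : X.Finite := by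
  refine ((Set.finite_Icc (0 : ℤ) B).prod (Set.finite_Icc (0 : ℤ) B)).subset fun p hp => ?_
  have := h p hp
  simp only [Set.mem_prod, Set.mem_Icc]
  omega

theorem level_nonempty (hne : D.Nonempty) (n : ℕ) : (level N D n).Nonempty := by
  induction n with
  | zero => exact ⟨0, rfl⟩
  | succ n ih =>
    obtain ⟨w, hw⟩ := ih
    obtain ⟨d, hd⟩ := hne
    exact ⟨_, cat_mem_level_succ hw hd⟩

/-- A finite set of cells has a cell with no neighbour in the row in direction `sy`, and none in
direction `sx` of its own row. -/
theorem exists_extreme {S : Set (ℤ × ℤ)} (hS : S.Finite) (hne : S.Nonempty) (sx sy : ℤ)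
    (hx : sx = 1 ∨ sx = -1) (hy : sy = 1 ∨ sy = -1) :
    ∃ z ∈ S, ∀ z' ∈ S, kadj z z' → z' = z ∨ z' = (z.1 - sx, z.2) ∨
      ∃ e : ℤ, -1 ≤ e ∧ e ≤ 1 ∧ z' = (z.1 + e, z.2 - sy) := by
  -- With weight 2 on rows, a step to the next row in direction `sy` gains at least 1 whatever its
  -- horizontal part, so a maximizer excludes all three such neighbours.
  obtain ⟨z, hz, hmax⟩ := Set.exists_max_image S (fun p => 2 * (sy * p.2) + sx * p.1) hS hne
  refine ⟨z, hz, fun z' hz' hk => ?_⟩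
  have h := hmax z' hz'
  obtain ⟨a, b⟩ := z
  obtain ⟨a', b'⟩ := z'
  simp only [kadj, Prod.mk.injEq] at *
  by_cases e1 : b' = b
  · rcases hx with rfl | rfl <;> rcases hy with rfl | rfl <;> omega
  · right; right
    refine ⟨a' - a, by omega, by omega, by omega, ?_⟩
    rcases hx with rfl | rfl <;> rcases hy with rfl | rfl <;> omega

end level

/-! ### Touching copies of the digit set, and rigidity. -/

section Gd

variable {N : ℤ} {D : Set (ℤ × ℤ)}

/-- The copies of `D` in the cells `p` and `q` touch each other. -/
def Gd (N : ℤ) (D : Set (ℤ × ℤ)) (p q : ℤ × ℤ) : Prop :=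
  ∃ a ∈ D, ∃ b ∈ D, kadj (cat N p a) (cat N q b)

theorem Gd_symm (p q : ℤ × ℤ) (h : Gd N D p q) : Gd N D q p := by
  obtain ⟨a, ha, b, hb, h⟩ := h
  exact ⟨b, hb, a, ha, kadj_symm h⟩

theorem Gd_kadj (hD : InBox N D) (p q : ℤ × ℤ) (h : Gd N D p q) : kadj p q := by
  obtain ⟨a, ha, b, hb, h⟩ := h
  exact kadj_of_kadj_cat hD ha hb h

/-- Only the difference of the cells matters, and they need not lie in the box: adding `N` to a
coordinate of a digit stands for the digit in a neighbouring copy of `D`. -/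
theorem Gd_translate {p q p' q' : ℤ × ℤ} (h : Gd N D p q) (h1 : q'.1 - p'.1 = q.1 - p.1)
    (h2 : q'.2 - p'.2 = q.2 - p.2) : Gd N D p' q' := by
  obtain ⟨a, ha, b, hb, h⟩ := h
  refine ⟨a, ha, b, hb, ?_⟩
  have e1 : N * q'.1 - N * p'.1 = N * q.1 - N * p.1 := by rw [← mul_sub, h1, mul_sub]
  have e2 : N * q'.2 - N * p'.2 = N * q.2 - N * p.2 := by rw [← mul_sub, h2, mul_sub]
  simp only [kadj, cat] at *
  omega

theorem Gd_cat {B : ℤ} {w u u' : ℤ × ℤ} : Gd N D (cat B w u) (cat B w u') ↔ Gd N D u u' := by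
  constructor <;> intro h <;> refine Gd_translate h ?_ ?_ <;> simp [cat]

theorem linked_kadj_cat {m k : ℕ} {d p q : ℤ × ℤ} (hd : d ∈ level N D k)
    (h : Linked kadj (level N D m) p q) :
    Linked kadj (level N D (k + m)) (cat (N ^ m) d p) (cat (N ^ m) d q) :=
  h.lift _ fun _ ha _ hb hab =>
    Linked.single (cat_mem_level_add hd ha) (cat_mem_level_add hd hb) (kadj_cat.2 hab)

theorem linked_Gd_cat {m k : ℕ} {d p q : ℤ × ℤ} (hd : d ∈ level N D k)
    (h : Linked (Gd N D) (level N D m) p q) :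
    Linked (Gd N D) (level N D (k + m)) (cat (N ^ m) d p) (cat (N ^ m) d q) :=
  h.lift _ fun _ ha _ hb hab =>
    Linked.single (cat_mem_level_add hd ha) (cat_mem_level_add hd hb) (Gd_cat.2 hab)

/-- Every component of `D_m` contains just one component of `D_{m+1}`. -/
def Rigid (N : ℤ) (D : Set (ℤ × ℤ)) (m : ℕ) : Prop :=
  ∀ p ∈ level N D m, ∀ q, Linked kadj (level N D m) p q → ∀ a ∈ D, ∀ b ∈ D,
    Linked kadj (level N D (m + 1)) (cat N p a) (cat N q b)

/-- The cell of `D_m` that contains a given cell of `D_{m+1}`. -/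
def parent (N : ℤ) (p : ℤ × ℤ) : ℤ × ℤ := (p.1 / N, p.2 / N)

theorem parent_cat (hD : InBox N D) {w d : ℤ × ℤ} (hd : d ∈ D) : parent N (cat N w d) = w := by
  have h := hD d hd
  have hN : N ≠ 0 := by omega
  ext
  · simp only [parent, cat]
    rw [Int.add_comm, Int.add_mul_ediv_left _ _ hN, Int.ediv_eq_zero_of_lt h.1 h.2.1, zero_add]
  · simp only [parent, cat]
    rw [Int.add_comm, Int.add_mul_ediv_left _ _ hN, Int.ediv_eq_zero_of_lt h.2.2.1 h.2.2.2,
      zero_add]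

/-- An adjacency one level down witnesses contact of the copies of `D`, which is stronger than
adjacency of the parents. -/
theorem linked_Gd_parent (hD : InBox N D) {m : ℕ} {p q : ℤ × ℤ}
    (h : Linked kadj (level N D (m + 1)) p q) :
    Linked (Gd N D) (level N D m) (parent N p) (parent N q) := by
  refine h.lift (parent N) ?_
  rintro _ ⟨w, hw, d, hd, rfl⟩ _ ⟨w', hw', d', hd', rfl⟩ hab
  rw [parent_cat hD hd, parent_cat hD hd']
  exact Linked.single hw hw' ⟨d, hd, d', hd', hab⟩

theorem linked_kadj_parent (hD : InBox N D) {m : ℕ} {p q : ℤ × ℤ}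
    (h : Linked kadj (level N D (m + 1)) p q) :
    Linked kadj (level N D m) (parent N p) (parent N q) := by
  simpa using (linked_Gd_parent hD h).lift id fun a ha b hb hab =>
    Linked.single ha hb (Gd_kadj hD _ _ hab)

theorem Rigid.linked_Gd (hD : InBox N D) {m : ℕ} (H : Rigid N D m) (hne : D.Nonempty)
    {p q : ℤ × ℤ} (hp : p ∈ level N D m) (h : Linked kadj (level N D m) p q) :
    Linked (Gd N D) (level N D m) p q := by
  obtain ⟨a, ha⟩ := hne
  simpa [parent_cat hD ha] using linked_Gd_parent hD (H p hp q h a ha a ha)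

/-- This is the form in which rigidity yields contradictions: a `Gd`-closed set of cells cannot be
left by king steps either. -/
theorem Rigid.closed (hD : InBox N D) {m : ℕ} (H : Rigid N D m) (hne : D.Nonempty)
    {F : Set (ℤ × ℤ)}
    (hF : ∀ a ∈ F, ∀ b ∈ level N D m, a ∈ level N D m → Gd N D a b → b ∈ F) :
    ∀ a ∈ F, ∀ b ∈ level N D m, a ∈ level N D m → kadj a b → b ∈ F := by
  intro a ha b hb haL hab
  exact (H.linked_Gd hD hne haL (Linked.single haL hb hab)).mem_of_closed hF ha

end Gd

end FractalSquare

namespace FractalSquare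

/-! ### Exits of a proper closed part of the digit set. -/

section Exit

variable {N : ℤ} {D : Set (ℤ × ℤ)}

/-- A proper `Gd`-closed part of `D` must touch copies of `D` in the directions that are not
excluded by the position of an extreme cell. -/
theorem Rigid.exists_exit (hD : InBox N D) {k : ℕ} (H : Rigid N D (k + 2)) {Y : Set (ℤ × ℤ)}
    (hYD : Y ⊆ D) (hYne : Y.Nonempty)
    (hcl : ∀ y ∈ Y, ∀ u ∈ D, Gd N D y u → u ∈ Y) (hpr : ∃ u ∈ D, u ∉ Y)
    {sx sy : ℤ} (hx : sx = 1 ∨ sx = -1) (hy : sy = 1 ∨ sy = -1) :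
    ∃ y ∈ Y, ∃ u ∈ D, Gd N D y (u.1 - N * sx, u.2) ∨
      ∃ e : ℤ, -1 ≤ e ∧ e ≤ 1 ∧ Gd N D y (u.1 + N * e, u.2 - N * sy) := by
  by_contra! hno
  have hne : D.Nonempty := hYne.mono hYD
  have hbox := fun n => inBox_level hD n
  -- an extreme cell has no `Gd`-neighbour inside the copy of `Y`
  have step : ∀ {z z' y y' : ℤ × ℤ}, y ∈ Y → y' ∈ D → Gd N D (cat N z y) (cat N z' y') →
      (z' = z ∨ z' = (z.1 - sx, z.2) ∨ ∃ e : ℤ, -1 ≤ e ∧ e ≤ 1 ∧ z' = (z.1 + e, z.2 - sy)) →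
      z' = z ∧ y' ∈ Y := by
    rintro z z' y y' hyY hy' hg (rfl | rfl | ⟨e, he, he', rfl⟩)
    · exact ⟨rfl, hcl y hyY y' hy' (Gd_cat.1 hg)⟩
    · refine absurd (Gd_translate hg ?_ ?_) (hno y hyY y' hy').1 <;> simp only [cat] <;> ring
    · refine absurd (Gd_translate hg ?_ ?_) ((hno y hyY y' hy').2 e he he') <;>
        simp only [cat] <;> ring
  obtain ⟨z, hz, hzext⟩ := exists_extreme (hbox (k + 1)).finite (level_nonempty hne (k + 1))
    sx sy hx hy
  obtain ⟨y, hyY, hyext⟩ := exists_extreme (hD.finite.subset hYD) hYne sx sy hx hy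
  -- In an extreme cell `z` the copy of `Y` has no exit, so it is `Gd`-closed, and rigidity makes it
  -- closed under adjacency.
  have hFcl := H.closed hD hne (F := {p | ∃ y ∈ Y, p = cat N z y}) (by
    rintro _ ⟨y1, hy1, rfl⟩ _ ⟨z', hz', y', hy', rfl⟩ _ hg
    have := step hy1 hy' hg (hzext z' hz' (kadj_of_kadj_cat hD (hYD hy1) hy' (Gd_kadj hD _ _ hg)))
    exact ⟨y', this.2, by rw [this.1]⟩)
  obtain ⟨d, hd, z₀, hz₀, hzd⟩ := mem_level_succ'.1 hz
  have hp : cat N z y ∈ level N D (k + 2) := cat_mem_level_succ hz (hYD hyY)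
  have hassoc : ∀ u v, cat N (cat N z u) v = cat (N ^ (k + 2)) d (cat N (cat N z₀ u) v) := by
    intro u v
    rw [hzd]
    simp only [cat, Prod.mk.injEq]
    constructor <;> ring
  -- The same one level down, at the extreme cell `y` of `Y`: the neighbours of `cat N z y` are now
  -- known to lie in the copy of `Y`.
  have hF'cl : ∀ a ∈ {p | ∃ y1 ∈ Y, p = cat N (cat N z y) y1}, ∀ b ∈ level N D (k + 3),
      a ∈ level N D (k + 3) → Gd N D a b → b ∈ {p | ∃ y1 ∈ Y, p = cat N (cat N z y) y1} := by
    rintro _ ⟨y1, hy1, rfl⟩ _ ⟨q, hq, y3, hy3, rfl⟩ _ hg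
    have hk := kadj_of_kadj_cat hD (hYD hy1) hy3 (Gd_kadj hD _ _ hg)
    obtain ⟨y2, hy2, rfl⟩ := hFcl _ ⟨y, hyY, rfl⟩ q hq hp hk
    have hh := hyext y2 hy2 (kadj_cat.1 hk)
    have := step hy1 hy3 hg (by
      rcases hh with rfl | rfl | ⟨e, he, he', rfl⟩
      · exact Or.inl rfl
      · exact Or.inr (Or.inl (Prod.ext (by simp only [cat]; ring) rfl))
      · exact Or.inr (Or.inr ⟨e, he, he', Prod.ext (by simp only [cat]; ring)
          (by simp only [cat]; ring)⟩))
    exact ⟨y3, this.2, by rw [this.1]⟩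
  obtain ⟨u, huD, huY⟩ := hpr
  have hlink := H _ hp _ (Linked.refl _) y (hYD hyY) u huD
  have : cat N (cat N z y) u ∈ {p | ∃ y1 ∈ Y, p = cat N (cat N z y) y1} := by
    refine hlink.mem_of_closed ?_ ⟨y, hyY, rfl⟩
    rintro a ⟨y1, hy1, rfl⟩ _ ⟨q, hq, y3, hy3, rfl⟩ haL hk
    obtain ⟨y2, hy2, rfl⟩ := hFcl _ ⟨y, hyY, rfl⟩ q hq hp
      (kadj_of_kadj_cat hD (hYD hy1) hy3 hk)
    -- Both cells begin with the digit `d`. Without it they lie in level k+2, where rigidity turns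
    -- adjacency into a `Gd`-link; restoring `d` preserves that link.
    rw [hassoc, hassoc] at hk
    have m1 : cat N (cat N z₀ y) y1 ∈ level N D (k + 2) :=
      cat_mem_level_succ (cat_mem_level_succ hz₀ (hYD hyY)) (hYD hy1)
    have m2 : cat N (cat N z₀ y2) y3 ∈ level N D (k + 2) :=
      cat_mem_level_succ (cat_mem_level_succ hz₀ (hYD hy2)) hy3
    have l1 := H.linked_Gd hD hne m1 (Linked.single m1 m2 (kadj_cat.1 hk))
    have l2 := linked_Gd_cat (k := 1) (d := d) (by simpa using hd) l1
    rw [← hassoc, ← hassoc, add_comm 1] at l2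
    exact l2.mem_of_closed hF'cl ⟨y1, hy1, rfl⟩
  obtain ⟨y1, hy1, he⟩ := this
  exact huY ((cat_inj hD huD (hYD hy1) he).2 ▸ hy1)

end Exit

end FractalSquare

namespace FractalSquare

/-! ### Criteria for non-crossing, and the exits of `Gd`-components. -/

section Planarity

variable {R : ℤ × ℤ → ℤ × ℤ → Prop} {X : Set (ℤ × ℤ)}

/-- Links along the horizontal edges suffice, since a diagonal step followed by such a link reaches
the remaining cell of the 2×2 block. -/
theorem nonCrossing_of_horizontal (hR : ∀ p q, R p q → R q p)
    (h : ∀ q ∈ X, (q.1 + 1, q.2) ∈ X → Linked R X q (q.1 + 1, q.2)) : NonCrossing R X := by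
  intro q hq hq' hs
  refine ⟨fun h1 => h q hq h1, fun h1 => ?_⟩
  exact (Linked.single hq hq' hs).trans ((h _ h1 hq').symm hR)

theorem NonCrossing.swap (h : NonCrossing R X) :
    NonCrossing (fun p q => R p.swap q.swap) (Prod.swap ⁻¹' X) := by
  intro q hq hq' hs
  have := h q.swap hq hq' hs
  have lift : ∀ p, Linked R X q.swap p →
      Linked (fun p q => R p.swap q.swap) (Prod.swap ⁻¹' X) q p.swap := fun p hp =>
    hp.lift Prod.swap fun a ha b hb hab => Linked.single (by simpa) (by simpa) (by simpa)
  exact ⟨fun h1 => lift _ (this.2 h1), fun h1 => lift _ (this.1 h1)⟩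

/-- A component that joins the bottom of the box to its top has every other component
either on its right or on its left. -/
theorem exists_side_swap {M : ℤ} (hR : ∀ p q, R p q → R q p)
    (hk : ∀ p q, R p q → kadj p q) (hM : 2 ≤ M)
    (hX : ∀ p ∈ X, 0 ≤ p.1 ∧ p.1 < M ∧ 0 ≤ p.2 ∧ p.2 < M) (hNC : NonCrossing R X)
    {a a' b₀ : ℤ × ℤ} (ha : a ∈ X) (hl : Linked R X a a') (ha0 : a.2 = 0) (ha' : a'.2 = M - 1)
    (hb₀ : b₀ ∈ X) (hnl : ¬ Linked R X a b₀) :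
    ∃ right : Prop, ∀ b, Linked R X b₀ b → (b.2 = 0 → (a.1 < b.1 ↔ right)) ∧
      (b.2 = M - 1 → (a'.1 < b.1 ↔ right)) ∧ (b.1 = M - 1 → right) ∧ (b.1 = 0 → ¬ right) := by
  have lift : ∀ p q, Linked R X p q ↔
      Linked (fun p q => R p.swap q.swap) (Prod.swap ⁻¹' X) p.swap q.swap := fun p q =>
    ⟨fun hp => hp.lift Prod.swap fun a ha b hb hab => Linked.single (by simpa) (by simpa) (by simpa),
      fun hp => by
        have := hp.lift (R' := R) (Y := X) Prod.swap fun a ha b hb hab => Linked.single ha hb hab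
        simpa using this⟩
  obtain ⟨up, h⟩ := exists_side (R := fun p q => R p.swap q.swap) (X := Prod.swap ⁻¹' X)
    (M := M) (fun p q h => hR _ _ h) (fun p q h => by
      have := hk _ _ h
      simp only [kadj, Prod.fst_swap, Prod.snd_swap] at *
      tauto) hM (fun p hp => by
      have := hX _ hp
      simp only [Prod.fst_swap, Prod.snd_swap] at this
      tauto) (hNC.swap) (a := a.swap) (a' := a'.swap) (b₀ := b₀.swap) (by simpa)
    ((lift _ _).1 hl) ha0 ha' (by simpa) (fun h => hnl ((lift _ _).2 h))
  exact ⟨up, fun b hb => h b.swap ((lift _ _).1 hb)⟩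

end Planarity

section Components

variable {N : ℤ} {D : Set (ℤ × ℤ)}

/-- Contact of the copies of `D` in the cells `s` and `t` of two copies of `D` side by side. -/
def Contact (N : ℤ) (D : Set (ℤ × ℤ)) (s t : ℤ × ℤ) : Prop :=
  s ∈ D ∧ t ∈ D ∧ Gd N D s (t.1 + N, t.2)

theorem Contact.bounds (hD : InBox N D) {s t : ℤ × ℤ} (h : Contact N D s t) :
    s.1 = N - 1 ∧ t.1 = 0 ∧ s.2 ≤ t.2 + 1 ∧ t.2 ≤ s.2 + 1 := by
  obtain ⟨hs, ht, hg⟩ := h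
  have h1 := hD s hs
  have h2 := hD t ht
  have h3 := Gd_kadj hD _ _ hg
  simp only [kadj] at h3
  omega

/-- If two copies of `D` side by side touch at all, then they touch everywhere. -/
theorem Gd_right {c : ℤ} (h0 : (0, c) ∈ D) (h1 : (N - 1, c) ∈ D) (q : ℤ × ℤ) :
    Gd N D q (q.1 + 1, q.2) := by
  refine ⟨_, h1, _, h0, ?_⟩
  have : N * (q.1 + 1) = N * q.1 + N := by ring
  simp only [kadj, cat]
  omega

theorem nonCrossing_Gd {c : ℤ} (h0 : (0, c) ∈ D) (h1 : (N - 1, c) ∈ D) :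
    NonCrossing (Gd N D) D :=
  nonCrossing_of_horizontal Gd_symm fun q hq hq' => Linked.single hq hq' (Gd_right h0 h1 q)

/-- The `Gd`-components of `D` reach both lateral neighbours, or the opposite horizontal sides. -/
theorem Rigid.component_exits (hD : InBox N D) {k : ℕ} (H : Rigid N D (k + 2)) {a b u : ℤ × ℤ}
    (ha : a ∈ D) (hb : b ∈ D) (hab : ¬ Linked (Gd N D) D a b) (hu : u ∈ D) :
    ((∃ s t, Linked (Gd N D) D u s ∧ Contact N D s t) ∧
      ∃ s t, Linked (Gd N D) D u t ∧ Contact N D s t) ∨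
    ((∃ p ∈ D, Linked (Gd N D) D u p ∧ p.2 = N - 1) ∧
      ∃ p ∈ D, Linked (Gd N D) D u p ∧ p.2 = 0) := by
  have main : ∀ sx sy : ℤ, sx = 1 ∨ sx = -1 → sy = 1 ∨ sy = -1 →
      ∃ y ∈ {v | v ∈ D ∧ Linked (Gd N D) D u v}, ∃ u ∈ D, Gd N D y (u.1 - N * sx, u.2) ∨
        ∃ e : ℤ, -1 ≤ e ∧ e ≤ 1 ∧ Gd N D y (u.1 + N * e, u.2 - N * sy) := by
    intro sx sy hx hy
    refine H.exists_exit hD (Y := {v | v ∈ D ∧ Linked (Gd N D) D u v}) (fun v hv => hv.1)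
      ⟨u, hu, Linked.refl _⟩ ?_ ?_ hx hy
    · rintro y ⟨hy, hl⟩ v hv hg
      exact ⟨hv, hl.trans (Linked.single hy hv hg)⟩
    · by_contra! h
      exact hab (((h a ha).2.symm Gd_symm).trans (h b hb).2)
  have tb : ∀ y ∈ D, ∀ v ∈ D, ∀ e sy : ℤ, sy = 1 ∨ sy = -1 →
      Gd N D y (v.1 + N * e, v.2 - N * sy) → y.2 = if sy = 1 then 0 else N - 1 := by
    intro y hy v hv e sy hsy hg
    have h1 := hD y hy
    have h2 := hD v hv
    have h3 := Gd_kadj hD _ _ hg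
    simp only [kadj] at h3
    rcases hsy with rfl | rfl <;> simp <;> omega
  have alt : ∀ sx sy : ℤ, sx = 1 ∨ sx = -1 → sy = 1 ∨ sy = -1 →
      (∃ y v, Linked (Gd N D) D u y ∧ y ∈ D ∧ v ∈ D ∧ Gd N D y (v.1 - N * sx, v.2)) ∨
      ∃ p ∈ D, Linked (Gd N D) D u p ∧ p.2 = if sy = 1 then 0 else N - 1 := by
    intro sx sy hx hy
    obtain ⟨y, ⟨hyD, hl⟩, v, hv, hg | ⟨e, -, -, hg⟩⟩ := main sx sy hx hy
    · exact Or.inl ⟨y, v, hl, hyD, hv, hg⟩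
    · exact Or.inr ⟨y, hyD, hl, tb y hyD v hv e sy hy hg⟩
  have right : (∃ y v, Linked (Gd N D) D u y ∧ y ∈ D ∧ v ∈ D ∧ Gd N D y (v.1 - N * (-1), v.2)) →
      ∃ s t, Linked (Gd N D) D u s ∧ Contact N D s t := by
    rintro ⟨y, v, hl, hy, hv, hg⟩
    exact ⟨y, v, hl, hy, hv, by simpa using hg⟩
  have left : (∃ y v, Linked (Gd N D) D u y ∧ y ∈ D ∧ v ∈ D ∧ Gd N D y (v.1 - N * 1, v.2)) →
      ∃ s t, Linked (Gd N D) D u t ∧ Contact N D s t := by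
    rintro ⟨y, v, hl, hy, hv, hg⟩
    refine ⟨v, y, hl, hv, hy, Gd_translate (Gd_symm _ _ hg) ?_ ?_⟩ <;> ring
  -- With `sy = 1` the alternative to a lateral exit is the bottom row, with `sy = -1` the top row;
  -- `sx = 1` offers the left neighbour and `sx = -1` the right one.
  have bot : ∀ sx : ℤ, sx = 1 ∨ sx = -1 →
      (∃ y v, Linked (Gd N D) D u y ∧ y ∈ D ∧ v ∈ D ∧ Gd N D y (v.1 - N * sx, v.2)) ∨
      ∃ p ∈ D, Linked (Gd N D) D u p ∧ p.2 = 0 := fun sx hx => by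
    simpa only [if_pos] using alt sx 1 hx (Or.inl rfl)
  have top : ∀ sx : ℤ, sx = 1 ∨ sx = -1 →
      (∃ y v, Linked (Gd N D) D u y ∧ y ∈ D ∧ v ∈ D ∧ Gd N D y (v.1 - N * sx, v.2)) ∨
      ∃ p ∈ D, Linked (Gd N D) D u p ∧ p.2 = N - 1 := fun sx hx => by
    have := alt sx (-1) hx (Or.inr rfl)
    rwa [if_neg (by norm_num)] at this
  have one : (1 : ℤ) = 1 ∨ (1 : ℤ) = -1 := Or.inl rfl
  have mone : (-1 : ℤ) = 1 ∨ (-1 : ℤ) = -1 := Or.inr rfl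
  rcases bot 1 one with h1 | h1
  · rcases bot (-1) mone with h2 | h2
    · exact Or.inl ⟨right h2, left h1⟩
    · rcases top (-1) mone with h3 | h3
      · exact Or.inl ⟨right h3, left h1⟩
      · exact Or.inr ⟨h3, h2⟩
  · rcases top 1 one with h2 | h2
    · rcases top (-1) mone with h3 | h3
      · exact Or.inl ⟨right h3, left h2⟩
      · exact Or.inr ⟨h3, h1⟩
    · exact Or.inr ⟨h2, h1⟩

end Components

end FractalSquare

namespace FractalSquare

/-! ### The vertical order of lateral components. -/

section Order

variable {N : ℤ} {D : Set (ℤ × ℤ)}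

/-- The component of `u` touches both neighbouring copies of `D` in its row. -/
def Lateral (N : ℤ) (D : Set (ℤ × ℤ)) (u : ℤ × ℤ) : Prop :=
  (∃ s t, Linked (Gd N D) D u s ∧ Contact N D s t) ∧
    ∃ s t, Linked (Gd N D) D u t ∧ Contact N D s t

/-- A component that is not lateral joins top to bottom and separates the box, so no other component
can be lateral and all of them join top to bottom. They are then ordered from left to right, and
only one of them can meet each lateral column. -/
theorem Rigid.lateral_or (hN : 2 ≤ N) (hD : InBox N D) {k : ℕ} (H : Rigid N D (k + 2)) {c : ℤ}
    (h0 : (0, c) ∈ D) (h1 : (N - 1, c) ∈ D) :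
    ((∀ u ∈ D, ∀ v ∈ D, u.1 = N - 1 → v.1 = N - 1 → Linked (Gd N D) D u v) ∧
      ∀ u ∈ D, ∀ v ∈ D, u.1 = 0 → v.1 = 0 → Linked (Gd N D) D u v) ∨
    ∀ u ∈ D, Lateral N D u := by
  by_cases hall : ∀ a ∈ D, ∀ b ∈ D, Linked (Gd N D) D a b
  · exact Or.inl ⟨fun u hu v hv _ _ => hall u hu v hv, fun u hu v hv _ _ => hall u hu v hv⟩
  push Not at hall
  obtain ⟨a, ha, b, hb, hab⟩ := hall
  by_cases hlat : ∀ u ∈ D, Lateral N D u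
  · exact Or.inr hlat
  left
  push Not at hlat
  obtain ⟨u, hu, hul⟩ := hlat
  have hNC := nonCrossing_Gd h0 h1
  have side : ∀ {p q v : ℤ × ℤ}, p ∈ D → p.2 = N - 1 → q ∈ D → q.2 = 0 →
      Linked (Gd N D) D q p → v ∈ D → ¬ Linked (Gd N D) D q v → _ := fun hp hp2 hq hq2 hl hv hv' =>
    exists_side_swap Gd_symm (Gd_kadj hD) hN hD hNC hq hl hq2 hp2 hv hv'
  have tbu := (H.component_exits hD ha hb hab hu).resolve_left hul
  have tb : ∀ v ∈ D, (∃ p ∈ D, Linked (Gd N D) D v p ∧ p.2 = N - 1) ∧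
      ∃ p ∈ D, Linked (Gd N D) D v p ∧ p.2 = 0 := by
    intro v hv
    obtain ⟨⟨p, hp, hup, hp2⟩, q, hq, huq, hq2⟩ := tbu
    by_cases huv : Linked (Gd N D) D u v
    · have := huv.symm Gd_symm
      exact ⟨⟨p, hp, this.trans hup, hp2⟩, q, hq, this.trans huq, hq2⟩
    refine (H.component_exits hD ha hb hab hv).resolve_left ?_
    rintro ⟨⟨s, t, hvs, hst⟩, s', t', hvt, hst'⟩
    obtain ⟨right, hr⟩ := side hp hp2 hq hq2 ((huq.symm Gd_symm).trans hup) hv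
      (fun h => huv (huq.trans h))
    exact (hr t' hvt).2.2.2 (hst'.bounds hD).2.1 ((hr s hvs).2.2.1 (hst.bounds hD).1)
  have cmp : ∀ u ∈ D, ∀ v ∈ D, ¬ Linked (Gd N D) D u v → ∀ p ∈ D, p.2 = N - 1 →
      Linked (Gd N D) D u p → ∃ right : Prop, (v.1 = N - 1 → right) ∧ (v.1 = 0 → ¬ right) ∧
        ∀ p', p'.2 = N - 1 → Linked (Gd N D) D v p' → (p.1 < p'.1 ↔ right) := by
    intro u hu v hv huv p hp hp2 hup
    obtain ⟨-, q, hq, huq, hq2⟩ := tb u hu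
    obtain ⟨right, hr⟩ := side hp hp2 hq hq2 ((huq.symm Gd_symm).trans hup) hv
      (fun h => huv (huq.trans h))
    exact ⟨right, (hr v (Linked.refl _)).2.2.1, (hr v (Linked.refl _)).2.2.2,
      fun p' hp' hvp' => (hr p' hvp').2.1 hp'⟩
  constructor <;>
  · intro u hu v hv hu1 hv1
    by_contra huv
    obtain ⟨⟨p, hp, hup, hp2⟩, -⟩ := tb u hu
    obtain ⟨⟨p', hp', hvp', hp2'⟩, -⟩ := tb v hv
    obtain ⟨r, r1, r2, r3⟩ := cmp u hu v hv huv p hp hp2 hup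
    obtain ⟨r', r1', r2', r3'⟩ := cmp v hv u hu (fun h => huv (h.symm Gd_symm)) p' hp' hp2' hvp'
    have e := r3 p' hp2' hvp'
    have e' := r3' p hp2 hup
    simp only [hu1, hv1, forall_const] at r1 r2 r1' r2'
    -- In the right column each component would be strictly to the right of the other. In the left
    -- column neither is, so their top cells coincide and they are linked.
    first
      | (have := e.2 r1; have := e'.2 r1'; omega)
      | (have e1 := e.not.2 r2
         have e2 := e'.not.2 r2'
         have e3 : p.1 = p'.1 := by omega
         exact huv ((Prod.ext e3 (hp2.trans hp2'.symm) ▸ hup).trans (hvp'.symm Gd_symm)))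

/-- A height function that orders the components of `D` from bottom to top, when all of them
join the left side to the right side. -/
structure IsHeight (N : ℤ) (D : Set (ℤ × ℤ)) (h : ℤ × ℤ → ℤ) : Prop where
  nonneg : ∀ u ∈ D, 0 ≤ h u
  lt : ∀ u ∈ D, h u < N
  eq_iff : ∀ u ∈ D, ∀ v ∈ D, (h u = h v ↔ Linked (Gd N D) D u v)
  mono : ∀ {s t s' t'}, Contact N D s t → Contact N D s' t' → h s < h s' → h t ≤ h t'
  exists_right : ∀ u ∈ D, ∃ s t, Contact N D s t ∧ h s = h u
  exists_left : ∀ u ∈ D, ∃ s t, Contact N D s t ∧ h t = h u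
  le_top : ∀ u ∈ D, u.2 = N - 1 → ∀ v ∈ D, h v ≤ h u
  bot_le : ∀ u ∈ D, u.2 = 0 → ∀ v ∈ D, h u ≤ h v

/-- The height of a component is the row of its topmost cell in column 0. By planarity its
comparison with the other components is the same on every side of the box. -/
theorem exists_isHeight (hN : 2 ≤ N) (hD : InBox N D) {c : ℤ} (h0 : (0, c) ∈ D)
    (h1 : (N - 1, c) ∈ D) (hlat : ∀ u ∈ D, Lateral N D u) : ∃ h, IsHeight N D h := by
  have hNC := nonCrossing_Gd h0 h1
  have hmem : ∀ {s t}, Contact N D s t → s ∈ D ∧ t ∈ D := fun h => ⟨h.1, h.2.1⟩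
  have hex : ∀ u, ∃ y, u ∈ D → ((0, y) ∈ D ∧ Linked (Gd N D) D u (0, y)) ∧
      ∀ y', (0, y') ∈ D → Linked (Gd N D) D u (0, y') → y' ≤ y := by
    intro u
    by_cases hu : u ∈ D
    · obtain ⟨-, s, t, hut, hst⟩ := hlat u hu
      have ht0 := (hst.bounds hD).2.1
      obtain ⟨p, ⟨hp, hup, hp0⟩, hmax⟩ := Set.exists_max_image
        {p | p ∈ D ∧ Linked (Gd N D) D u p ∧ p.1 = 0} Prod.snd (hD.finite.subset fun p hp => hp.1)
        ⟨t, hst.2.1, hut, ht0⟩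
      have e : p = (0, p.2) := Prod.ext hp0 rfl
      exact ⟨p.2, fun _ => ⟨⟨e ▸ hp, e ▸ hup⟩, fun y' hy' hl => hmax (0, y') ⟨hy', hl, rfl⟩⟩⟩
    · exact ⟨0, fun h => absurd h hu⟩
  choose h hh using hex
  have heq : ∀ u ∈ D, ∀ v ∈ D, Linked (Gd N D) D u v → h u = h v := by
    intro u hu v hv huv
    exact le_antisymm ((hh v hv).2 _ (hh u hu).1.1 ((huv.symm Gd_symm).trans (hh u hu).1.2))
      ((hh u hu).2 _ (hh v hv).1.1 (huv.trans (hh v hv).1.2))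
  have heq' : ∀ u ∈ D, ∀ v ∈ D, h u = h v → Linked (Gd N D) D u v := fun u hu v hv e =>
    (hh u hu).1.2.trans (e ▸ (hh v hv).1.2.symm Gd_symm)
  -- the components are ordered alike on all sides of the box
  have cmp : ∀ u ∈ D, ∀ v ∈ D, h u ≠ h v → ∀ b, Linked (Gd N D) D v b →
      (b.1 = 0 → (h u < b.2 ↔ h u < h v)) ∧
      (∀ a, Linked (Gd N D) D u a → a.1 = N - 1 → b.1 = N - 1 → (a.2 < b.2 ↔ h u < h v)) ∧
      (b.2 = N - 1 → h u < h v) ∧ (b.2 = 0 → ¬ h u < h v) := by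
    intro u hu v hv huv b hvb
    have key : ∀ a, Linked (Gd N D) D u a → a.1 = N - 1 → _ := fun a hua ha1 =>
      exists_side Gd_symm (Gd_kadj hD) hN hD hNC (hh u hu).1.1
        (((hh u hu).1.2.symm Gd_symm).trans hua) rfl ha1 hv
        (fun hl => huv (heq u hu v hv ((hh u hu).1.2.trans hl)))
    have key' : ∀ a, Linked (Gd N D) D u a → a.1 = N - 1 →
        (b.1 = 0 → (h u < b.2 ↔ h u < h v)) ∧
        (b.1 = N - 1 → (a.2 < b.2 ↔ h u < h v)) ∧
        (b.2 = N - 1 → h u < h v) ∧ (b.2 = 0 → ¬ h u < h v) := by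
      intro a hua ha1
      obtain ⟨up, hup⟩ := key a hua ha1
      have e : h u < h v ↔ up := (hup _ (hh v hv).1.2).1 rfl
      simpa only [e] using hup b hvb
    obtain ⟨⟨s, t, hus, hst⟩, -⟩ := hlat u hu
    have := key' s hus (hst.bounds hD).1
    exact ⟨this.1, fun a hua ha1 => (key' a hua ha1).2.1, this.2.2⟩
  have hle : ∀ t ∈ D, t.1 = 0 → t.2 ≤ h t := fun t ht ht0 => by
    have e : t = (0, t.2) := Prod.ext ht0 rfl
    exact (hh t ht).2 _ (e ▸ ht) (e ▸ Linked.refl _)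
  refine ⟨h, fun u hu => (hD _ (hh u hu).1.1).2.2.1, fun u hu => (hD _ (hh u hu).1.1).2.2.2,
    fun u hu v hv => ⟨heq' u hu v hv, heq u hu v hv⟩, ?_, ?_, ?_, ?_, ?_⟩
  · intro s t s' t' hst hst' hs
    by_contra! ht
    have b := hst.bounds hD
    have b' := hst'.bounds hD
    have e1 := ((cmp s hst.1 s' hst'.1 hs.ne s' (Linked.refl _)).2.1 s (Linked.refl _) b.1 b'.1).2 hs
    have e2 := ((cmp t' hst'.2.1 t hst.2.1 ht.ne t (Linked.refl _)).1 b.2.1).2 ht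
    have e3 := hle t' hst'.2.1 b'.2.1
    -- An inversion leaves one configuration: `s'` directly above `s`, with one contact going up and
    -- the other down. Then `D` has both corners of its left column, so vertical copies touch and
    -- `s`, `s'` are linked after all.
    have es' : s' = (s.1, s.2 + 1) := Prod.ext (by omega) (by simp only; omega)
    have hup : Gd N D s (s.1 + 1, s.2 + 1) := Gd_translate hst.2.2
      (by simp only; omega) (by simp only; omega)
    have hdn : Gd N D s (s.1 + 1, s.2 - 1) := Gd_translate hst'.2.2
      (by simp only; omega) (by simp only; omega)
    obtain ⟨a1, ha1, b1, hb1, g1⟩ := hup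
    obtain ⟨a2, ha2, b2, hb2, g2⟩ := hdn
    have A1 := hD a1 ha1
    have B1 := hD b1 hb1
    have A2 := hD a2 ha2
    have B2 := hD b2 hb2
    have x1 : N * (s.1 + 1) = N * s.1 + N := by ring
    have x2 : N * (s.2 + 1) = N * s.2 + N := by ring
    have x3 : N * (s.2 - 1) = N * s.2 - N := by ring
    simp only [kadj, cat] at g1 g2
    refine absurd (heq s hst.1 s' hst'.1 (Linked.single hst.1 hst'.1 ?_)) hs.ne
    rw [es']
    refine ⟨b2, hb2, b1, hb1, ?_⟩
    simp only [kadj, cat]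
    omega
  · intro u hu
    obtain ⟨⟨s, t, hus, hst⟩, -⟩ := hlat u hu
    exact ⟨s, t, hst, (heq u hu s hst.1 hus).symm⟩
  · intro u hu
    obtain ⟨-, s, t, hut, hst⟩ := hlat u hu
    exact ⟨s, t, hst, (heq u hu t hst.2.1 hut).symm⟩
  · intro u hu hu2 v hv
    by_contra! hlt
    exact absurd ((cmp v hv u hu hlt.ne' u (Linked.refl _)).2.2.1 hu2) hlt.not_gt
  · intro u hu hu2 v hv
    by_contra! hlt
    exact (cmp v hv u hu hlt.ne u (Linked.refl _)).2.2.2 hu2 hlt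

end Order

end FractalSquare

namespace FractalSquare

/-! ### Consecutive heights and cuts between them. -/

section Cuts

variable {α : Type*} {X : Set α} {h : α → ℤ}

/-- A discrete intermediate value argument: take the highest class below `v` on which `P` holds, and
the next class above it. -/
theorem exists_consecutive (hX : X.Finite) {P : α → Prop}
    (hP : ∀ x ∈ X, ∀ y ∈ X, h x = h y → P x → P y) {u v : α} (hu : u ∈ X) (hv : v ∈ X)
    (hPu : P u) (hPv : ¬ P v) (huv : h u < h v) :
    ∃ a ∈ X, ∃ b ∈ X, P a ∧ ¬ P b ∧ h a < h b ∧ (∀ x ∈ X, h x ≤ h a ∨ h b ≤ h x) ∧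
      h u ≤ h a ∧ h b ≤ h v := by
  obtain ⟨a, ⟨ha, hPa, hav⟩, hmax⟩ := Set.exists_max_image {x | x ∈ X ∧ P x ∧ h x < h v} h
    (hX.subset fun x hx => hx.1) ⟨u, hu, hPu, huv⟩
  obtain ⟨b, ⟨hb, hab⟩, hmin⟩ := Set.exists_min_image {x | x ∈ X ∧ h a < h x} h
    (hX.subset fun x hx => hx.1) ⟨v, hv, hav⟩
  have hbv := hmin v ⟨hv, hav⟩
  refine ⟨a, ha, b, hb, hPa, fun hPb => ?_, hab, fun x hx => ?_, hmax u ⟨hu, hPu, huv⟩, hbv⟩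
  · rcases hbv.lt_or_eq with h1 | h1
    · exact (hmax b ⟨hb, hPb, h1⟩).not_gt hab
    · exact hPv (hP b hb v hv h1 hPb)
  · by_contra! hlt
    exact (hmin x ⟨hx, hlt.1⟩).not_gt hlt.2

/-- Two consecutive classes without a common contact are in contact with two consecutive
classes. -/
theorem exists_cut (hX : X.Finite) {G : α → α → Prop}
    (hG : ∀ {s t}, G s t → s ∈ X ∧ t ∈ X)
    (mono : ∀ {s t s' t'}, G s t → G s' t' → h s < h s' → h t ≤ h t')
    (hr : ∀ u ∈ X, ∃ s t, G s t ∧ h s = h u) (hl : ∀ u ∈ X, ∃ s t, G s t ∧ h t = h u)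
    {a b : α} (ha : a ∈ X) (hb : b ∈ X) (hab : h a < h b)
    (cons : ∀ x ∈ X, h x ≤ h a ∨ h b ≤ h x)
    (sep : ∀ s t s' t', G s t → G s' t' → h s = h a → h s' = h b → h t ≠ h t') :
    ∃ s a' s' b', G s a' ∧ h s = h a ∧ G s' b' ∧ h s' = h b ∧ h a' < h b' ∧
      (∀ x ∈ X, h x ≤ h a' ∨ h b' ≤ h x) ∧ ∀ s t, G s t → (h s ≤ h a ↔ h t ≤ h a') := by
  obtain ⟨s₀, t₀, g₀, e₀⟩ := hr a ha
  obtain ⟨s₁, t₁, g₁, e₁⟩ := hr b hb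
  -- The highest class touched by `a`; next, the lowest class touched by `b`. Every class is touched
  -- from somewhere, so monotonicity leaves no class between them.
  obtain ⟨a', ⟨-, s, hs, hsa⟩, hmax⟩ := Set.exists_max_image {t | t ∈ X ∧ ∃ s, G s t ∧ h s = h a} h
    (hX.subset fun x hx => hx.1) ⟨t₀, (hG g₀).2, s₀, g₀, e₀⟩
  obtain ⟨b', ⟨-, s', hs', hsb⟩, hmin⟩ := Set.exists_min_image {t | t ∈ X ∧ ∃ s, G s t ∧ h s = h b} h
    (hX.subset fun x hx => hx.1) ⟨t₁, (hG g₁).2, s₁, g₁, e₁⟩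
  have hle : h a' ≤ h b' := mono hs hs' (by omega)
  have hne : h a' ≠ h b' := sep _ _ _ _ hs hs' hsa hsb
  have up : ∀ s t, G s t → h s ≤ h a → h t ≤ h a' := by
    intro s₂ t₂ g h₂
    rcases h₂.lt_or_eq with h₃ | h₃
    · exact mono g hs (by omega)
    · exact hmax t₂ ⟨(hG g).2, s₂, g, h₃⟩
  have dn : ∀ s t, G s t → h b ≤ h s → h b' ≤ h t := by
    intro s₂ t₂ g h₂
    rcases h₂.lt_or_eq with h₃ | h₃
    · exact mono hs' g (by omega)
    · exact hmin t₂ ⟨(hG g).2, s₂, g, h₃.symm⟩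
  refine ⟨s, a', s', b', hs, hsa, hs', hsb, by omega, fun x hx => ?_, fun s₂ t₂ g => ?_⟩
  · obtain ⟨s₂, t₂, g, e⟩ := hl x hx
    rcases cons s₂ (hG g).1 with h₂ | h₂
    · exact Or.inl (e ▸ up _ _ g h₂)
    · exact Or.inr (e ▸ dn _ _ g h₂)
  · rcases cons s₂ (hG g).1 with h₂ | h₂
    · exact iff_of_true h₂ (up _ _ g h₂)
    · have := dn _ _ g h₂
      constructor <;> intro <;> omega

end Cuts

/-! ### Rows of tiles, thresholds and strips. -/

section Tiles

variable {N : ℤ} {D : Set (ℤ × ℤ)}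

theorem linked_tile {n : ℕ} {x u v : ℤ × ℤ} (hx : x ∈ level N D n) (h : Linked (Gd N D) D u v) :
    Linked (Gd N D) (level N D (n + 1)) (cat N x u) (cat N x v) := by
  have := linked_Gd_cat (m := 1) (p := u) (q := v) hx (by rwa [level_one])
  rwa [pow_one] at this

theorem linked_contact {n : ℕ} {x s t : ℤ × ℤ} (hx : x ∈ level N D n)
    (hx' : (x.1 + 1, x.2) ∈ level N D n) (h : Contact N D s t) :
    Linked (Gd N D) (level N D (n + 1)) (cat N x s) (cat N (x.1 + 1, x.2) t) :=
  Linked.single (cat_mem_level_succ hx h.1) (cat_mem_level_succ hx' h.2.1)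
    (Gd_translate h.2.2 (by simp only [cat]; ring) (by simp only [cat]; ring))

theorem contact_of_Gd {x u v : ℤ × ℤ} (hu : u ∈ D) (hv : v ∈ D)
    (h : Gd N D (cat N x u) (cat N (x.1 + 1, x.2) v)) : Contact N D u v :=
  ⟨hu, hv, Gd_translate h (by simp only [cat]; ring) (by simp only [cat]; ring)⟩

/-- Under `Rigid`, a `Gd`-closed set cannot cut a copy of `D` if its translate is isolated from
the other translates. -/
theorem Rigid.no_split (hD : InBox N D) {k : ℕ} (H : Rigid N D (k + 2)) {e a b d : ℤ × ℤ}
    {F : Set (ℤ × ℤ)} (he : e ∈ level N D (k + 1)) (ha : a ∈ D) (hb : b ∈ D)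
    (hF : ∀ p ∈ F, ∀ q ∈ level N D (k + 2), p ∈ level N D (k + 2) → Gd N D p q → q ∈ F)
    (hea : cat N e a ∈ F) (heb : cat N e b ∉ F) (hd : d ∈ D)
    (hiso : ∀ d' ∈ D, ∀ f ∈ F, f ∈ level N D (k + 2) → ∀ f' ∈ level N D (k + 2),
      kadj (cat (N ^ (k + 2)) d f) (cat (N ^ (k + 2)) d' f') → d' = d) : False := by
  have hbox := inBox_level hD (k + 2)
  have hFk := H.closed hD ⟨a, ha⟩ hF
  have hp : cat (N ^ (k + 1)) d e ∈ level N D (k + 2) := cat_mem_level_succ' hd he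
  have hl := H _ hp _ (Linked.refl _) a ha b hb
  have hassoc : ∀ u, cat N (cat (N ^ (k + 1)) d e) u = cat (N ^ (k + 2)) d (cat N e u) := by
    intro u
    rw [cat_assoc, pow_succ' _ (k + 1)]
  rw [hassoc, hassoc] at hl
  have : cat (N ^ (k + 2)) d (cat N e b) ∈
      {p | ∃ f ∈ F, f ∈ level N D (k + 2) ∧ p = cat (N ^ (k + 2)) d f} := by
    refine hl.mem_of_closed ?_ ⟨_, hea, cat_mem_level_succ he ha, rfl⟩
    rintro _ ⟨f, hfF, hf, rfl⟩ q hq - hk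
    obtain ⟨d', hd', f', hf', rfl⟩ := mem_level_succ'.1 hq
    obtain rfl := hiso d' hd' f hfF hf f' hf' hk
    exact ⟨f', hFk f hfF f' hf' hf (kadj_cat.1 hk), hf', rfl⟩
  obtain ⟨f, hfF, hf, e⟩ := this
  exact heb ((cat_inj hbox (cat_mem_level_succ he hb) hf e).2 ▸ hfF)

theorem last_digit {B w a : ℤ} (ha : 0 ≤ a) (ha' : a < N) (h : N * w + a = N * B - 1) :
    w = B - 1 ∧ a = N - 1 :=
  digit_unique ha ha' (b := N - 1) (by omega) (by omega) (by linarith)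

theorem first_digit {w a : ℤ} (ha : 0 ≤ a) (ha' : a < N) (h : N * w + a = 0) : w = 0 ∧ a = 0 :=
  digit_unique ha ha' le_rfl (by omega) (by linarith)

/-- The threshold `p` on right sides corresponds to the threshold `q` on left sides. -/
def Clean (N : ℤ) (D : Set (ℤ × ℤ)) (h : ℤ × ℤ → ℤ) (p q : ℤ) : Prop :=
  ∀ s t, Contact N D s t → (h s ≤ p ↔ h t ≤ q)

/-- A threshold that separates two consecutive heights. -/
def Threshold (D : Set (ℤ × ℤ)) (h : ℤ × ℤ → ℤ) (p : ℤ) : Prop :=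
  ∃ a ∈ D, ∃ b ∈ D, h a = p ∧ h a < h b ∧ ∀ x ∈ D, h x ≤ h a ∨ h b ≤ h x

variable {h : ℤ × ℤ → ℤ} {p q r : ℤ}

theorem Threshold.not_top (hh : IsHeight N D h) (hp : Threshold D h p) {u : ℤ × ℤ} (hu : u ∈ D)
    (hu2 : u.2 = N - 1) : p < h u := by
  obtain ⟨a, ha, b, hb, rfl, hab, -⟩ := hp
  exact hab.trans_le (hh.le_top u hu hu2 b hb)

theorem Threshold.bot (hh : IsHeight N D h) (hp : Threshold D h p) {u : ℤ × ℤ} (hu : u ∈ D)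
    (hu2 : u.2 = 0) : h u ≤ p := by
  obtain ⟨a, ha, b, hb, rfl, hab, -⟩ := hp
  exact hh.bot_le u hu hu2 a ha

/-- A class at height `q` touches some class on its right, and that one lies above `q` and not above
`r`. With `Clean.gt` this shows that thresholds drift strictly in one direction along a row. -/
theorem Clean.lt (hh : IsHeight N D h) (h1 : Clean N D h p q) (h2 : Clean N D h q r)
    (hq : Threshold D h q) (hpq : p < q) : q < r := by
  obtain ⟨a, ha, -, -, rfl, -⟩ := hq
  obtain ⟨s, t, g, e⟩ := hh.exists_right a ha
  have k1 := h1 s t g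
  have k2 := h2 s t g
  omega

theorem Clean.gt (hh : IsHeight N D h) (h1 : Clean N D h p q) (h2 : Clean N D h q r)
    (hp : Threshold D h p) (hq : Threshold D h q) (hpq : q < p) : r < q := by
  obtain ⟨a, ha, b, hb, rfl, hab, cons⟩ := hq
  obtain ⟨s, t, g, e⟩ := hh.exists_right b hb
  have k1 := h1 s t g
  have k2 := h2 s t g
  obtain ⟨c, hc, -, -, rfl, -⟩ := hp
  have := cons c hc
  omega

/-- The part of a row of tiles enclosed by a sequence of thresholds. -/
def strip (N : ℤ) (D : Set (ℤ × ℤ)) (h : ℤ × ℤ → ℤ) (x : ℤ × ℤ) (g : ℕ) (μ : ℕ → ℤ) :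
    Set (ℤ × ℤ) :=
  {f | ∃ k ≤ g, ∃ u ∈ D, f = cat N (x.1 + k, x.2) u ∧ ¬ (h u ≤ μ k ↔ h u ≤ μ (k + 1))}

theorem strip_not_top {hh : IsHeight N D h} {g : ℕ} {μ : ℕ → ℤ}
    (hμ : ∀ k ≤ g + 1, Threshold D h (μ k)) {k : ℕ} (hk : k ≤ g) {u : ℤ × ℤ} (hu : u ∈ D)
    (hmem : ¬ (h u ≤ μ k ↔ h u ≤ μ (k + 1))) : u.2 ≠ N - 1 ∧ u.2 ≠ 0 := by
  constructor <;> intro hu2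
  · have h1 := (hμ k (by omega)).not_top hh hu hu2
    have h2 := (hμ (k + 1) (by omega)).not_top hh hu hu2
    omega
  · have h1 := (hμ k (by omega)).bot hh hu hu2
    have h2 := (hμ (k + 1) (by omega)).bot hh hu hu2
    omega

/-- In tile k the strip lies between `μ k` and `μ (k + 1)`, and clean contacts carry this band to
the band of tile k+1. It avoids the top and bottom cells of its tiles, begins at the left side of
the box and ends at a missing tile. -/
theorem strip_closed (hD : InBox N D) (hh : IsHeight N D h) {n g : ℕ} {μ : ℕ → ℤ} {x : ℤ × ℤ}
    (hx0 : x.1 = 0) (hg : (x.1 + (g + 1 : ℕ), x.2) ∉ level N D n)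
    (hμ : ∀ k ≤ g + 1, Threshold D h (μ k)) (hc : ∀ k ≤ g, Clean N D h (μ k) (μ (k + 1))) :
    ∀ f ∈ strip N D h x g μ, ∀ q ∈ level N D (n + 1), Gd N D f q → q ∈ strip N D h x g μ := by
  rintro _ ⟨k, hk, u, hu, rfl, hmem⟩ _ ⟨z, hz, v, hv, rfl⟩ hgd
  obtain ⟨c1, c2⟩ := kadj_cat_cases hD hu hv (Gd_kadj hD _ _ hgd)
  obtain ⟨nt, nb⟩ := strip_not_top (hh := hh) hμ hk hu hmem
  have hz2 : x.2 = z.2 := by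
    rcases c2 with c2 | c2 | c2
    · exact c2.1
    · exact absurd c2.2.1 nt
    · exact absurd c2.2.1 nb
  rcases c1 with c1 | c1 | c1
  · have ez : z = (x.1 + k, x.2) := Prod.ext c1.1.symm hz2.symm
    subst ez
    have := (hh.eq_iff u hu v hv).2 (Linked.single hu hv (Gd_cat.1 hgd))
    exact ⟨k, hk, v, hv, rfl, this ▸ hmem⟩
  · have ez : z = (x.1 + (k + 1 : ℕ), x.2) := Prod.ext (by push_cast; simp only at c1; omega) hz2.symm
    have hkg : k + 1 ≤ g := by
      by_contra hkg
      have : k = g := by omega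
      subst this
      exact hg (ez ▸ hz)
    have ez' : z = (((x.1 + k, x.2) : ℤ × ℤ).1 + 1, ((x.1 + k, x.2) : ℤ × ℤ).2) :=
      Prod.ext c1.1 hz2.symm
    rw [ez'] at hgd
    have g := contact_of_Gd hu hv hgd
    have k1 := hc k hk u v g
    have k2 := hc (k + 1) hkg u v g
    exact ⟨k + 1, hkg, v, hv, by rw [ez], by rw [← k1, ← k2]; exact hmem⟩
  · obtain ⟨k', rfl⟩ : ∃ k', k = k' + 1 := by
      cases k with
      | zero =>
        have := (inBox_level hD n z hz).1
        simp only [hx0] at c1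
        push_cast at c1
        omega
      | succ k' => exact ⟨k', rfl⟩
    have ez : z = (x.1 + (k' : ℕ), x.2) := Prod.ext (by push_cast at c1; simp only; omega) hz2.symm
    have e' : ((x.1 + (k' + 1 : ℕ), x.2) : ℤ × ℤ) = (z.1 + 1, z.2) := by
      rw [ez]; push_cast; rw [add_assoc]
    rw [e'] at hgd
    have g := contact_of_Gd hv hu (Gd_symm _ _ hgd)
    have k1 := hc k' (by omega) v u g
    have k2 := hc (k' + 1) hk v u g
    exact ⟨k', by omega, v, hv, by rw [ez], by rw [k1, k2]; exact hmem⟩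

end Tiles

end FractalSquare

namespace FractalSquare

/-! ### The two contradictions with rigidity. -/

section Horizontal

variable {N : ℤ} {D : Set (ℤ × ℤ)} {h : ℤ × ℤ → ℤ}

/-- Thresholds propagate along a row of tiles. -/
theorem exists_thresholds (hD : InBox N D) (hh : IsHeight N D h) {n : ℕ} {x a b : ℤ × ℤ} {μ₀ : ℤ}
    (ha : a ∈ D) (hb : b ∈ D) (hab : h a < h b) (cons : ∀ y ∈ D, h y ≤ h a ∨ h b ≤ h y)
    (hsep : ¬ Linked (Gd N D) (level N D (n + 1)) (cat N x a) (cat N x b))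
    (hμ₀ : Threshold D h μ₀) (hc : Clean N D h μ₀ (h a)) (K : ℕ)
    (hK : ∀ j ≤ K, (x.1 + (j : ℤ), x.2) ∈ level N D n) :
    ∃ μ : ℕ → ℤ, μ 0 = μ₀ ∧ μ 1 = h a ∧ (∀ j ≤ K + 1, Threshold D h (μ j)) ∧
      (∀ j ≤ K, Clean N D h (μ j) (μ (j + 1))) ∧
      ∃ a' ∈ D, ∃ b' ∈ D, h a' = μ (K + 1) ∧ h a' < h b' ∧ (∀ y ∈ D, h y ≤ h a' ∨ h b' ≤ h y) ∧
        ¬ Linked (Gd N D) (level N D (n + 1)) (cat N (x.1 + (K : ℤ), x.2) a')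
          (cat N (x.1 + (K : ℤ), x.2) b') := by
  induction K with
  | zero =>
    refine ⟨fun j => if j = 0 then μ₀ else h a, rfl, rfl, ?_, ?_, a, ha, b, hb, rfl, hab, cons, ?_⟩
    · intro j hj
      by_cases h0 : j = 0
      · simpa [h0] using hμ₀
      · have hT : Threshold D h (h a) := ⟨a, ha, b, hb, rfl, hab, cons⟩
        simpa only [if_neg h0] using hT
    · intro j hj
      obtain rfl : j = 0 := by omega
      simpa using hc
    · simpa using hsep
  | succ K ih =>
    obtain ⟨μ, h0, h1, hth, hcl, a', ha', b', hb', e, hab', cons', hsep'⟩ :=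
      ih fun j hj => hK j (by omega)
    set y : ℤ × ℤ := (x.1 + (K : ℤ), x.2) with hy
    have hyL : y ∈ level N D n := hK K (by omega)
    have ey : ((x.1 + ((K + 1 : ℕ) : ℤ), x.2) : ℤ × ℤ) = (y.1 + 1, y.2) := by
      rw [hy]; push_cast; rw [add_assoc]
    have hyL' : (y.1 + 1, y.2) ∈ level N D n := ey ▸ hK (K + 1) le_rfl
    have lk : ∀ {u s t}, u ∈ D → Contact N D s t → h s = h u →
        Linked (Gd N D) (level N D (n + 1)) (cat N y u) (cat N (y.1 + 1, y.2) t) :=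
      fun hu g e => (linked_tile hyL ((hh.eq_iff _ hu _ g.1).1 e.symm)).trans
        (linked_contact hyL hyL' g)
    -- If the two classes touched a common class, they would be linked through the next tile,
    -- against the separation carried along the row.
    obtain ⟨s, a'', s', b'', g, es, g', es', hab'', cons'', hcl''⟩ :=
      exists_cut hD.finite (G := Contact N D) (fun g => ⟨g.1, g.2.1⟩) hh.mono hh.exists_right
        hh.exists_left ha' hb' hab' cons' (by
        intro s t s' t' g g' es es' et
        exact hsep' ((lk ha' g es).trans ((linked_tile hyL' ((hh.eq_iff _ g.2.1 _ g'.2.1).1 et)).trans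
          ((lk hb' g' es').symm Gd_symm))))
    refine ⟨fun j => if j ≤ K + 1 then μ j else h a'', by simpa using h0, by simpa using h1, ?_, ?_,
      a'', g.2.1, b'', g'.2.1, by simp, hab'', cons'', ?_⟩
    · intro j hj
      by_cases hj' : j ≤ K + 1
      · simpa [hj'] using hth j hj'
      · have hT : Threshold D h (h a'') := ⟨a'', g.2.1, b'', g'.2.1, rfl, hab'', cons''⟩
        simpa only [if_neg hj'] using hT
    · intro j hj
      by_cases hj' : j ≤ K
      · simpa [hj', hj] using hcl j hj'
      · obtain rfl : j = K + 1 := by omega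
        simpa [Clean, e] using hcl''
    · rw [ey]
      intro hl
      exact hsep' ((lk ha' g es).trans (hl.trans ((lk hb' g' es').symm Gd_symm)))

/-- When the threshold changes from one tile to the next, it moves strictly along the whole row. Its
values lie in `[0, N)`, so the row ends before the right side of the box. The strip it encloses is
`Gd`-closed and cuts the first tile. -/
theorem Rigid.run_false (hN : 2 ≤ N) (hD : InBox N D) {k : ℕ} (H : Rigid N D (k + 2))
    (hh : IsHeight N D h) {x a b : ℤ × ℤ} {μ₀ : ℤ} (hx : x ∈ level N D (k + 1)) (hx0 : x.1 = 0)
    (ha : a ∈ D) (hb : b ∈ D) (hab : h a < h b) (cons : ∀ y ∈ D, h y ≤ h a ∨ h b ≤ h y)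
    (hsep : ¬ Linked (Gd N D) (level N D (k + 2)) (cat N x a) (cat N x b))
    (hμ₀ : Threshold D h μ₀) (hc : Clean N D h μ₀ (h a)) (hne : μ₀ ≠ h a) : False := by
  classical
  have hbox := inBox_level hD (k + 1)
  have hgap : ∃ j : ℕ, (x.1 + ((j + 1 : ℕ) : ℤ), x.2) ∉ level N D (k + 1) := by
    refine ⟨(N ^ (k + 1)).toNat, fun hm => ?_⟩
    have := (hbox _ hm).2.1
    simp only at this
    omega
  obtain ⟨g, hg, hmin⟩ : ∃ g : ℕ, (x.1 + ((g + 1 : ℕ) : ℤ), x.2) ∉ level N D (k + 1) ∧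
      ∀ j ≤ g, (x.1 + (j : ℤ), x.2) ∈ level N D (k + 1) := by
    refine ⟨Nat.find hgap, Nat.find_spec hgap, fun j hj => ?_⟩
    cases j with
    | zero => simpa using hx
    | succ j => exact not_not.1 (Nat.find_min hgap (m := j) (by omega))
  obtain ⟨μ, h0, h1, hth, hcl, -⟩ := exists_thresholds hD hh ha hb hab cons hsep hμ₀ hc g hmin
  have rng : ∀ j ≤ g + 1, 0 ≤ μ j ∧ μ j < N := by
    intro j hj
    obtain ⟨c, hcD, -, -, e, -⟩ := hth j hj
    exact ⟨e ▸ hh.nonneg c hcD, e ▸ hh.lt c hcD⟩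
  -- the thresholds are strictly monotone, so that the run of tiles is short
  have hgN : (g : ℤ) + 2 ≤ N := by
    rcases lt_or_gt_of_ne hne with hlt | hlt
    · have st : ∀ j ≤ g, μ j < μ (j + 1) := by
        intro j hj
        induction j with
        | zero => rw [h0, h1]; exact hlt
        | succ j ih =>
          exact (hcl j (by omega)).lt hh (hcl (j + 1) hj) (hth _ (by omega)) (ih (by omega))
      have gr : ∀ j ≤ g + 1, (j : ℤ) ≤ μ j := by
        intro j hj
        induction j with
        | zero => exact_mod_cast (rng 0 hj).1
        | succ j ih =>
          have := st j (by omega)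
          have := ih (by omega)
          push_cast
          omega
      have := gr (g + 1) le_rfl
      have := (rng (g + 1) le_rfl).2
      push_cast at *
      omega
    · have st : ∀ j ≤ g, μ (j + 1) < μ j := by
        intro j hj
        induction j with
        | zero => rw [h0, h1]; exact hlt
        | succ j ih =>
          exact (hcl j (by omega)).gt hh (hcl (j + 1) hj) (hth _ (by omega)) (hth _ (by omega))
            (ih (by omega))
      have gr : ∀ j ≤ g + 1, μ j + j ≤ N - 1 := by
        intro j hj
        induction j with
        | zero => have := (rng 0 hj).2; push_cast; omega
        | succ j ih =>
          have := st j (by omega)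
          have := ih (by omega)
          push_cast
          omega
      have := gr (g + 1) le_rfl
      have := (rng (g + 1) le_rfl).1
      push_cast at *
      omega
  have hpow : N ≤ N ^ (k + 1) := le_self_pow₀ (by omega) (by omega)
  -- The strip can meet only the left side of the box, so its copy in a leftmost digit touches no
  -- other copy.
  obtain ⟨d, hd, hdmin⟩ := Set.exists_min_image D Prod.fst hD.finite ⟨a, ha⟩
  have mem0 : ∀ u ∈ D, (cat N x u ∈ strip N D h x g μ ↔ ¬ (h u ≤ μ₀ ↔ h u ≤ h a)) := by
    intro u hu
    constructor
    · rintro ⟨j, hj, v, hv, e, hm⟩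
      obtain ⟨e1, rfl⟩ := cat_inj hD hu hv e
      have : j = 0 := by
        have := congrArg Prod.fst e1
        simp only at this
        omega
      subst this
      rwa [h0, h1] at hm
    · intro hm
      exact ⟨0, by omega, u, hu, by simp, by rwa [h0, h1]⟩
  obtain ⟨e, heD, f, hfD, heF, hfF⟩ : ∃ e ∈ D, ∃ f ∈ D, cat N x e ∈ strip N D h x g μ ∧
      cat N x f ∉ strip N D h x g μ := by
    rcases lt_or_gt_of_ne hne with hlt | hlt
    · exact ⟨a, ha, b, hb, (mem0 a ha).2 (by omega), fun hm => by
        have := (mem0 b hb).1 hm; omega⟩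
    · obtain ⟨c, hcD, -, -, e, -⟩ := hμ₀
      exact ⟨c, hcD, a, ha, (mem0 c hcD).2 (by omega), fun hm => by
        have := (mem0 a ha).1 hm; omega⟩
  refine H.no_split hD (F := strip N D h x g μ) hx heD hfD
    (fun p hp q hq _ hgd => strip_closed hD hh hx0 hg hth hcl p hp q hq hgd) heF hfF hd ?_
  rintro d' hd' _ ⟨j, hj, u, hu, rfl, hm⟩ hf f' hf' hk
  obtain ⟨c1, c2⟩ := kadj_cat_cases (inBox_level hD (k + 2)) hf hf' hk
  obtain ⟨nt, nb⟩ := strip_not_top (hh := hh) hth hj hu hm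
  have hub := hD u hu
  have hpe : N ^ (k + 2) = N * N ^ (k + 1) := pow_succ' _ _
  have hmin' := hdmin d' hd'
  rw [hpe] at c1 c2
  refine Prod.ext ?_ ?_
  · rcases c1 with c1 | c1 | c1
    · exact c1.1.symm
    · have := (last_digit hub.1 hub.2.1 c1.2.1).1
      simp only at this
      omega
    · omega
  · rcases c2 with c2 | c2 | c2
    · exact c2.1.symm
    · exact absurd (last_digit hub.2.2.1 hub.2.2.2 c2.2.1).2 nt
    · exact absurd (first_digit hub.2.2.1 hub.2.2.2 c2.2.1).2 nb

/-- When the threshold does not move, the parts below it in the lowest row form a `Gd`-closed set.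
The bad pair `i`, `j` would leave that set across two neighbouring tiles, so the lowest row has no
neighbouring tiles; then a copy in the lowest row of `D` is isolated. -/
theorem Rigid.equal_false (hD : InBox N D) {k : ℕ} (H : Rigid N D (k + 2))
    (hh : IsHeight N D h) {t : ℤ} (ht : Threshold D h t) (hc : Clean N D h t t) {i j : ℤ × ℤ}
    (hi : i ∈ D) (hj : j ∈ D) (hij : kadj (cat N (0, 0) i) (cat N (1, 0) j))
    (hbad : ¬ (h i ≤ t ↔ h j ≤ t)) : False := by
  have hne : D.Nonempty := ⟨i, hi⟩
  have hbox := fun n => inBox_level hD n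
  obtain ⟨e, he, hemin⟩ := Set.exists_min_image (level N D (k + 1)) Prod.snd (hbox _).finite
    (level_nonempty hne _)
  set F : Set (ℤ × ℤ) := {p | ∃ z ∈ level N D (k + 1), z.2 = e.2 ∧ ∃ u ∈ D, h u ≤ t ∧ p = cat N z u}
    with hF
  have hFcl : ∀ p ∈ F, ∀ q ∈ level N D (k + 2), p ∈ level N D (k + 2) → Gd N D p q → q ∈ F := by
    rintro _ ⟨z, hz, hze, u, hu, hut, rfl⟩ _ ⟨z', hz', v, hv, rfl⟩ - hgd
    obtain ⟨c1, c2⟩ := kadj_cat_cases hD hu hv (Gd_kadj hD _ _ hgd)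
    have hz2 : z.2 = z'.2 := by
      rcases c2 with c2 | c2 | c2
      · exact c2.1
      · have := ht.not_top hh hu c2.2.1
        omega
      · have := hemin z' hz'
        omega
    refine ⟨z', hz', hz2 ▸ hze, v, hv, ?_, rfl⟩
    rcases c1 with c1 | c1 | c1
    · obtain rfl : z = z' := Prod.ext c1.1 hz2
      exact (hh.eq_iff u hu v hv).2 (Linked.single hu hv (Gd_cat.1 hgd)) ▸ hut
    · obtain rfl : z' = (z.1 + 1, z.2) := Prod.ext c1.1 hz2.symm
      exact (hc u v (contact_of_Gd hu hv hgd)).1 hut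
    · obtain rfl : z = (z'.1 + 1, z'.2) := Prod.ext c1.1 hz2
      exact (hc v u (contact_of_Gd hv hu (Gd_symm _ _ hgd))).2 hut
  have memF : ∀ z ∈ level N D (k + 1), z.2 = e.2 → ∀ u ∈ D, (cat N z u ∈ F ↔ h u ≤ t) := by
    intro z hz hze u hu
    constructor
    · rintro ⟨z', -, -, v, hv, hvt, e⟩
      rwa [(cat_inj hD hu hv e).2]
    · exact fun hut => ⟨z, hz, hze, u, hu, hut, rfl⟩
  -- no two tiles in the lowest row are adjacent
  have hrow : ∀ z ∈ level N D (k + 1), z.2 = e.2 → (z.1 + 1, z.2) ∉ level N D (k + 1) := by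
    intro z hz hze hz'
    have hk : kadj (cat N z i) (cat N (z.1 + 1, z.2) j) := by
      have h1 : N * (z.1 + 1) = N * z.1 + N := by ring
      simp only [kadj, cat] at hij ⊢
      omega
    have m1 := cat_mem_level_succ hz hi
    have m2 := cat_mem_level_succ hz' hj
    have cl := H.closed hD hne hFcl
    have := fun hm => cl _ hm _ m2 m1 hk
    have := fun hm => cl _ hm _ m1 m2 (kadj_symm hk)
    rw [memF _ hz hze i hi, memF _ hz' hze j hj] at *
    tauto
  obtain ⟨d, hd, hdmin⟩ := Set.exists_min_image D Prod.snd hD.finite hne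
  obtain ⟨y, hy, hymin⟩ := Set.exists_min_image (level N D k) Prod.snd (hbox _).finite
    (level_nonempty hne _)
  have hN : 0 < N := by have := hD i hi; omega
  have hDrow : ∀ z ∈ D, z.2 = d.2 → (z.1 + 1, z.2) ∉ D := by
    intro z hz hzd hz'
    have m1 := cat_mem_level_succ hy hz
    have m2 := cat_mem_level_succ hy hz'
    refine hrow _ m1 (le_antisymm ?_ (hemin _ m1)) (by simpa [cat, add_assoc] using m2)
    obtain ⟨w, hw, c, hcD, rfl⟩ := he
    have h1 := hymin w hw
    have h2 := hdmin c hcD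
    have h3 : N * y.2 ≤ N * w.2 := mul_le_mul_of_nonneg_left h1 hN.le
    simp only [cat]
    omega
  obtain ⟨a, ha, b, hb, rfl, hab, -⟩ := id ht
  refine H.no_split hD (F := F) he ha hb hFcl ((memF e he rfl a ha).2 le_rfl)
    (fun hm => by have := (memF e he rfl b hb).1 hm; omega) hd ?_
  rintro d' hd' _ ⟨z, hz, hze, u, hu, hut, rfl⟩ hf f' hf' hk
  obtain ⟨c1, c2⟩ := kadj_cat_cases (hbox (k + 2)) hf hf' hk
  have hub := hD u hu
  have hpe : N ^ (k + 2) = N * N ^ (k + 1) := pow_succ' _ _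
  have hmin' := hdmin d' hd'
  rw [hpe] at c1 c2
  have e2 : d'.2 = d.2 := by
    rcases c2 with c2 | c2 | c2
    · exact c2.1.symm
    · have := ht.not_top hh hu (last_digit hub.2.2.1 hub.2.2.2 c2.2.1).2
      omega
    · omega
  refine Prod.ext ?_ e2
  rcases c1 with c1 | c1 | c1
  · exact c1.1.symm
  · exact absurd (show (d.1 + 1, d.2) ∈ D by rw [← c1.1, ← e2]; exact hd') (hDrow d hd rfl)
  · exact absurd (show (d'.1 + 1, d'.2) ∈ D by rw [← c1.1, e2]; exact hd) (hDrow d' hd' e2)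

end Horizontal

end FractalSquare

namespace FractalSquare

/-! ### Adjacent cells in adjacent first-level copies. -/

section Horizontal

variable {N : ℤ} {D : Set (ℤ × ℤ)}

theorem Gd_corner (h0 : (0, 0) ∈ D) (h1 : (N - 1, N - 1) ∈ D) (q : ℤ × ℤ) :
    Gd N D q (q.1 + 1, q.2 + 1) := by
  refine ⟨_, h1, _, h0, ?_⟩
  have h1 : N * (q.1 + 1) = N * q.1 + N := by ring
  have h2 : N * (q.2 + 1) = N * q.2 + N := by ring
  simp only [kadj, cat]
  omega

theorem Gd_corner' (h0 : (0, N - 1) ∈ D) (h1 : (N - 1, 0) ∈ D) (q : ℤ × ℤ) :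
    Gd N D q (q.1 + 1, q.2 - 1) := by
  refine ⟨_, h1, _, h0, ?_⟩
  have h1 : N * (q.1 + 1) = N * q.1 + N := by ring
  have h2 : N * (q.2 - 1) = N * q.2 - N := by ring
  simp only [kadj, cat]
  omega

/-- Diagonally adjacent boxes whose cells touch have copies of `D` that touch. -/
theorem Gd_of_kadj_corner (hD : InBox N D) {P Q i j : ℤ × ℤ} (hi : i ∈ D) (hj : j ∈ D)
    (hPQ : Q.1 = P.1 + 1) (hPQ' : Q.2 ≠ P.2) (h : kadj (cat N P i) (cat N Q j)) :
    Gd N D (cat N P i) (cat N Q j) := by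
  obtain ⟨c1, c2⟩ := kadj_cat_cases hD hi hj h
  have h1 : i.1 = N - 1 ∧ j.1 = 0 := by omega
  have e1 : N * Q.1 = N * P.1 + N := by rw [hPQ]; ring
  rcases c2 with c2 | c2 | c2
  · omega
  · have ei : (N - 1, N - 1) ∈ D := by
      rw [← show i = (N - 1, N - 1) from Prod.ext h1.1 c2.2.1]; exact hi
    have ej : (0, 0) ∈ D := by rw [← show j = (0, 0) from Prod.ext h1.2 c2.2.2]; exact hj
    have e2 : N * Q.2 = N * P.2 + N := by rw [c2.1]; ring
    refine Gd_translate (Gd_corner ej ei 0) ?_ ?_ <;> simp only [cat, Prod.fst_zero, Prod.snd_zero]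
      <;> omega
  · have ei : (N - 1, 0) ∈ D := by
      rw [← show i = (N - 1, 0) from Prod.ext h1.1 c2.2.1]; exact hi
    have ej : (0, N - 1) ∈ D := by
      rw [← show j = (0, N - 1) from Prod.ext h1.2 c2.2.2]; exact hj
    have e2 : N * P.2 = N * Q.2 + N := by rw [c2.1]; ring
    refine Gd_translate (Gd_corner' ej ei 0) ?_ ?_ <;> simp only [cat, Prod.fst_zero, Prod.snd_zero]
      <;> omega

theorem Rigid.linked_horizontal (hN : 2 ≤ N) (hD : InBox N D) {k : ℕ} (H : Rigid N D (k + 2))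
    {d w w' : ℤ × ℤ} (hd : d ∈ D) (hd' : (d.1 + 1, d.2) ∈ D) (hw : w ∈ level N D (k + 2))
    (hw' : w' ∈ level N D (k + 2))
    (hk : kadj (cat (N ^ (k + 2)) d w) (cat (N ^ (k + 2)) (d.1 + 1, d.2) w')) :
    Linked (Gd N D) (level N D (k + 3)) (cat (N ^ (k + 2)) d w)
      (cat (N ^ (k + 2)) (d.1 + 1, d.2) w') := by
  set d' : ℤ × ℤ := (d.1 + 1, d.2) with hdd
  have hbox := fun n => inBox_level hD n
  obtain ⟨c1, c2⟩ := kadj_cat_cases (hbox (k + 2)) hw hw' hk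
  have hpe : N ^ (k + 2) = N * N ^ (k + 1) := pow_succ' _ _
  obtain ⟨x, hx, i, hi, rfl⟩ := hw
  obtain ⟨x', hx', j, hj, rfl⟩ := hw'
  have hib := hD i hi
  have hjb := hD j hj
  have hxb := hbox _ x hx
  have hxb' := hbox _ x' hx'
  have hcc : (cat N x i).1 = N ^ (k + 2) - 1 ∧ (cat N x' j).1 = 0 := by
    have : d'.1 = d.1 + 1 := rfl
    omega
  rw [hpe] at hcc
  have hx1 := last_digit hib.1 hib.2.1 hcc.1
  have hx1' := first_digit hjb.1 hjb.2.1 hcc.2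
  set P := cat (N ^ (k + 1)) d x with hP
  set Q := cat (N ^ (k + 1)) d' x' with hQ
  have hassoc : ∀ d x u, cat (N ^ (k + 2)) d (cat N x u) = cat N (cat (N ^ (k + 1)) d x) u := by
    intro d x u
    rw [cat_assoc, hpe]
  rw [hassoc, hassoc] at hk ⊢
  have hPL : P ∈ level N D (k + 2) := cat_mem_level_succ' hd hx
  have hQL : Q ∈ level N D (k + 2) := cat_mem_level_succ' hd' hx'
  have hPQ1 : Q.1 = P.1 + 1 := by
    simp only [hP, hQ, cat, hx1.1, hx1'.1, hdd]
    ring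
  by_cases hPQ2 : Q.2 = P.2
  swap
  · exact Linked.single (cat_mem_level_succ hPL hi) (cat_mem_level_succ hQL hj)
      (Gd_of_kadj_corner hD hi hj hPQ1 hPQ2 hk)
  have hxx : x'.2 = x.2 := by
    simp only [hP, hQ, cat, hdd] at hPQ2
    omega
  have hQe : Q = (P.1 + 1, P.2) := Prod.ext hPQ1 hPQ2
  have hij : kadj (cat N (0, 0) i) (cat N (1, 0) j) := by
    have hi1 := hx1.2
    have hj1 := hx1'.2
    rcases (kadj_cat_cases hD hi hj hk).2 with c2 | c2 | c2
    · simp only [kadj, cat]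
      omega
    · exact absurd (hPQ2.symm.trans c2.1).symm (lt_add_one P.2).ne'
    · exact absurd (hPQ2.trans c2.1).symm (lt_add_one Q.2).ne'
  -- Level k+2 has at least two digits. The next-to-last digits of the two cells face each other in
  -- the same row, which gives cells of `D` at both ends of that row.
  obtain ⟨c, hc0, hc1⟩ : ∃ c, (0, c) ∈ D ∧ (N - 1, c) ∈ D := by
    obtain ⟨x₀, hx₀, c, hc, rfl⟩ := hx
    obtain ⟨x₀', hx₀', c', hc', rfl⟩ := hx'
    have b := hD c hc
    have b' := hD c' hc'
    rw [pow_succ'] at hx1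
    have e1 := (last_digit b.1 b.2.1 hx1.1).2
    have e2 := (first_digit b'.1 b'.2.1 hx1'.1).2
    have e3 := (digit_unique b'.2.2.1 b'.2.2.2 b.2.2.1 b.2.2.2 hxx).2
    refine ⟨c.2, ?_, ?_⟩
    · rw [← e2, ← e3]; exact hc'
    · rw [← e1]; exact hc
  have hcon : Contact N D (N - 1, c) (0, c) :=
    ⟨hc1, hc0, Gd_translate (Gd_right hc0 hc1 0) (by simp) (by simp)⟩
  have lk : ∀ {s t}, Contact N D s t →
      Linked (Gd N D) (level N D (k + 3)) (cat N P s) (cat N Q t) := fun g => by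
    rw [hQe]
    exact linked_contact hPL (hQe ▸ hQL) g
  rcases H.lateral_or hN hD hc0 hc1 with hlr | hlat
  · exact (linked_tile hPL (hlr.1 i hi _ hc1 hx1.2 rfl)).trans
      ((lk hcon).trans (linked_tile hQL (hlr.2 _ hc0 j hj rfl hx1'.2)))
  obtain ⟨h, hh⟩ := exists_isHeight hN hD hc0 hc1 hlat
  by_contra hun
  obtain ⟨s₀, t₀, g₀, e₀⟩ := hh.exists_right i hi
  have hi₀ : Linked (Gd N D) (level N D (k + 3)) (cat N P i) (cat N Q t₀) :=
    (linked_tile hPL ((hh.eq_iff _ hi _ g₀.1).1 e₀.symm)).trans (lk g₀)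
  have hQt : ∀ u ∈ D, ∀ v ∈ D, h u = h v →
      Linked (Gd N D) (level N D (k + 3)) (cat N Q u) (cat N Q v) := fun u hu v hv e =>
    linked_tile hQL ((hh.eq_iff u hu v hv).1 e)
  have hPt : ∀ u ∈ D, ∀ v ∈ D, h u = h v →
      Linked (Gd N D) (level N D (k + 3)) (cat N P u) (cat N P v) := fun u hu v hv e =>
    linked_tile hPL ((hh.eq_iff u hu v hv).1 e)
  have fin : ∀ a ∈ D, ∀ b ∈ D, h a < h b → (∀ y ∈ D, h y ≤ h a ∨ h b ≤ h y) →
      ¬ Linked (Gd N D) (level N D (k + 3)) (cat N Q a) (cat N Q b) →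
      ¬ (h t₀ ≤ h a ↔ h j ≤ h a) → False := by
    intro a ha b hb hab cons hsep hbad
    -- The cut is transported backwards, from `Q` to `P`, so the contact relation is reversed. The
    -- resulting threshold either agrees with that in `Q` or starts a drifting row there.
    obtain ⟨t, a', t', b', g, et, g', et', hab', cons', hcl⟩ :=
      exists_cut hD.finite (G := fun t s => Contact N D s t) (h := h) (fun g => ⟨g.2.1, g.1⟩)
        (fun {s t s' t'} g g' hlt => by
          by_contra! hlt'
          exact absurd (hh.mono g' g hlt') hlt.not_ge)
        (fun u hu => by obtain ⟨s, t, g, e⟩ := hh.exists_left u hu; exact ⟨t, s, g, e⟩)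
        (fun u hu => by obtain ⟨s, t, g, e⟩ := hh.exists_right u hu; exact ⟨t, s, g, e⟩)
        ha hb hab cons (by
          intro t s t' s' g g' et et' es
          exact hsep ((hQt a ha t g.2.1 et.symm).trans (((lk g).symm Gd_symm).trans
            ((hPt s g.1 s' g'.1 es).trans ((lk g').trans (hQt t' g'.2.1 b hb et'))))))
    have hthr : Threshold D h (h a') := ⟨a', g.1, b', g'.1, rfl, hab', cons'⟩
    have hclean : Clean N D h (h a') (h a) := fun s t g => (hcl t s g).symm
    have hbad' : ¬ (h i ≤ h a' ↔ h j ≤ h a) := by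
      rw [← e₀, hclean _ _ g₀]
      exact hbad
    by_cases heq : h a' = h a
    · rw [heq] at hclean hbad' hthr
      exact H.equal_false hD hh hthr hclean hi hj hij hbad'
    · refine H.run_false hN hD hh hx' hx1'.1 ha hb hab cons (fun hl => hsep ?_) hthr hclean heq
      have := linked_Gd_cat (k := 1) (d := d') (by simpa using hd') hl
      rw [hassoc, hassoc, add_comm 1] at this
      exact this
  have hP' : ∀ u ∈ D, ∀ v ∈ D, h u = h v →
      Linked (Gd N D) (level N D (k + 3)) (cat N Q t₀) (cat N Q u) →
      Linked (Gd N D) (level N D (k + 3)) (cat N Q t₀) (cat N Q v) := fun u hu v hv e hl =>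
    hl.trans (hQt u hu v hv e)
  have hnj : ¬ Linked (Gd N D) (level N D (k + 3)) (cat N Q t₀) (cat N Q j) :=
    fun hl => hun (hi₀.trans hl)
  rcases lt_trichotomy (h t₀) (h j) with hlt | heq | hlt
  · obtain ⟨a, ha, b, hb, ha', hb', hab, cons, h1, h2⟩ :=
      exists_consecutive hD.finite hP' g₀.2.1 hj (Linked.refl _) hnj hlt
    exact fin a ha b hb hab cons (fun hl => hb' (ha'.trans hl)) (by omega)
  · exact hnj (hQt _ g₀.2.1 j hj heq)
  · obtain ⟨a, ha, b, hb, ha', hb', hab, cons, h1, h2⟩ :=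
      exists_consecutive hD.finite (P := fun u => ¬ Linked (Gd N D) (level N D (k + 3))
        (cat N Q t₀) (cat N Q u)) (fun u hu v hv e hl hl' => hl (hP' v hv u hu e.symm hl'))
        hj g₀.2.1 hnj (by simpa using Linked.refl _) hlt
    exact fin a ha b hb hab cons (fun hl => ha' ((not_not.1 hb').trans (hl.symm Gd_symm)))
      (by omega)

end Horizontal

end FractalSquare

namespace FractalSquare

/-! ### Exchange of the coordinates, and inheritance of rigidity. -/

section Swap

variable {N : ℤ} {D : Set (ℤ × ℤ)}

theorem cat_swap (B : ℤ) (w u : ℤ × ℤ) : (cat B w u).swap = cat B w.swap u.swap := rfl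

theorem kadj_swap {p q : ℤ × ℤ} : kadj p.swap q.swap ↔ kadj p q := by
  simp only [kadj, Prod.fst_swap, Prod.snd_swap]; tauto

theorem level_swap (N : ℤ) (D : Set (ℤ × ℤ)) (n : ℕ) :
    level N (Prod.swap ⁻¹' D) n = Prod.swap ⁻¹' level N D n := by
  induction n with
  | zero => ext p; simp [level, Prod.ext_iff, and_comm]
  | succ n ih =>
    ext p
    simp only [mem_level_succ, Set.mem_preimage, ih]
    constructor
    · rintro ⟨w, hw, d, hd, rfl⟩
      exact ⟨w.swap, hw, d.swap, hd, cat_swap N w d⟩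
    · rintro ⟨w, hw, d, hd, e⟩
      exact ⟨w.swap, hw, d.swap, hd, by rw [← cat_swap, ← e, Prod.swap_swap]⟩

theorem InBox.swap {B : ℤ} {X : Set (ℤ × ℤ)} (h : InBox B X) : InBox B (Prod.swap ⁻¹' X) := by
  intro p hp
  have := h _ hp
  simp only [Prod.fst_swap, Prod.snd_swap] at this
  tauto

theorem Gd_swap {p q : ℤ × ℤ} : Gd N (Prod.swap ⁻¹' D) p q ↔ Gd N D p.swap q.swap := by
  constructor
  · rintro ⟨a, ha, b, hb, h⟩
    exact ⟨_, ha, _, hb, by rwa [← cat_swap, ← cat_swap, kadj_swap]⟩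
  · rintro ⟨a, ha, b, hb, h⟩
    exact ⟨a.swap, ha, b.swap, hb, by
      rwa [← kadj_swap, cat_swap, cat_swap, Prod.swap_swap, Prod.swap_swap]⟩

theorem linked_swap {R R' : ℤ × ℤ → ℤ × ℤ → Prop} {X : Set (ℤ × ℤ)}
    (hR : ∀ p q, R' p q ↔ R p.swap q.swap) {p q : ℤ × ℤ} :
    Linked R' (Prod.swap ⁻¹' X) p q ↔ Linked R X p.swap q.swap := by
  constructor
  · intro h
    exact h.lift Prod.swap fun a ha b hb hab => Linked.single ha hb ((hR _ _).1 hab)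
  · intro h
    have := h.lift (R' := R') (Y := Prod.swap ⁻¹' X) Prod.swap fun a ha b hb hab =>
      Linked.single ha hb ((hR _ _).2 hab)
    simpa using this

theorem linked_kadj_swap {n : ℕ} {p q : ℤ × ℤ} :
    Linked kadj (level N (Prod.swap ⁻¹' D) n) p q ↔ Linked kadj (level N D n) p.swap q.swap := by
  rw [level_swap]
  exact linked_swap fun _ _ => kadj_swap.symm

theorem linked_Gd_swap {n : ℕ} {p q : ℤ × ℤ} :
    Linked (Gd N (Prod.swap ⁻¹' D)) (level N (Prod.swap ⁻¹' D) n) p q ↔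
      Linked (Gd N D) (level N D n) p.swap q.swap := by
  rw [level_swap]
  exact linked_swap fun _ _ => Gd_swap

theorem Rigid.swap {m : ℕ} (H : Rigid N D m) : Rigid N (Prod.swap ⁻¹' D) m := by
  intro p hp q hl a ha b hb
  rw [linked_kadj_swap]
  rw [level_swap] at hp
  exact H _ hp _ (linked_kadj_swap.1 hl) _ ha _ hb

theorem Rigid.linked_vertical (hN : 2 ≤ N) (hD : InBox N D) {k : ℕ} (H : Rigid N D (k + 2))
    {d w w' : ℤ × ℤ} (hd : d ∈ D) (hd' : (d.1, d.2 + 1) ∈ D) (hw : w ∈ level N D (k + 2))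
    (hw' : w' ∈ level N D (k + 2))
    (hk : kadj (cat (N ^ (k + 2)) d w) (cat (N ^ (k + 2)) (d.1, d.2 + 1) w')) :
    Linked (Gd N D) (level N D (k + 3)) (cat (N ^ (k + 2)) d w)
      (cat (N ^ (k + 2)) (d.1, d.2 + 1) w') := by
  have := H.swap.linked_horizontal hN hD.swap (d := d.swap) (w := w.swap) (w' := w'.swap)
    (by simpa using hd) (by simpa using hd') (by rw [level_swap]; simpa using hw)
    (by rw [level_swap]; simpa using hw') (kadj_swap.2 hk)
  exact linked_Gd_swap.1 this

/-- A cell of `D` in a neighbouring row and a neighbouring column. -/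
theorem Gd_of_kadj_diagonal (hD : InBox N D) {k : ℕ} {d d' w w' : ℤ × ℤ}
    (hw : w ∈ level N D (k + 2)) (hw' : w' ∈ level N D (k + 2)) (h1 : d'.1 = d.1 + 1)
    (h2 : d'.2 ≠ d.2) (hk : kadj (cat (N ^ (k + 2)) d w) (cat (N ^ (k + 2)) d' w')) :
    Gd N D (cat (N ^ (k + 2)) d w) (cat (N ^ (k + 2)) d' w') := by
  obtain ⟨x, hx, i, hi, rfl⟩ := hw
  obtain ⟨x', hx', j, hj, rfl⟩ := hw'
  have hpe : N ^ (k + 2) = N * N ^ (k + 1) := pow_succ' _ _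
  have hassoc : ∀ d x u, cat (N ^ (k + 2)) d (cat N x u) = cat N (cat (N ^ (k + 1)) d x) u := by
    intro d x u
    rw [cat_assoc, hpe]
  rw [hassoc, hassoc] at hk ⊢
  obtain ⟨c1, c2⟩ := kadj_cat_cases (inBox_level hD (k + 1)) hx hx' (kadj_of_kadj_cat hD hi hj hk)
  refine Gd_of_kadj_corner hD hi hj ?_ ?_ hk
  · have h3 : x.1 = N ^ (k + 1) - 1 ∧ x'.1 = 0 := by omega
    simp only [cat, h1, h3.1, h3.2]
    ring
  · rcases c2 with c2 | c2 | c2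
    · exact absurd c2.1.symm h2
    · simp only [cat, c2.1, c2.2.1, c2.2.2, mul_add]
      omega
    · simp only [cat, c2.1, c2.2.1, c2.2.2, mul_add]
      omega

/-- Cells with the same first digit reduce to rigidity, those with diagonal first digits to a corner
contact, and those in side-by-side copies to `Rigid.linked_horizontal` or its mirror image. -/
theorem Rigid.linked_Gd_succ (hN : 2 ≤ N) (hD : InBox N D) (hne : D.Nonempty) {k : ℕ}
    (H : Rigid N D (k + 2)) {p q : ℤ × ℤ} (hp : p ∈ level N D (k + 3))
    (hq : q ∈ level N D (k + 3)) (hk : kadj p q) :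
    Linked (Gd N D) (level N D (k + 3)) p q := by
  obtain ⟨d, hd, w, hw, rfl⟩ := mem_level_succ'.1 hp
  obtain ⟨d', hd', w', hw', rfl⟩ := mem_level_succ'.1 hq
  have hdd := kadj_of_kadj_cat (inBox_level hD (k + 2)) hw hw' hk
  have hor : d'.1 = d.1 ∨ d'.1 = d.1 + 1 ∨ d.1 = d'.1 + 1 := by simp only [kadj] at hdd; omega
  have ver : d'.2 = d.2 ∨ d'.2 = d.2 + 1 ∨ d.2 = d'.2 + 1 := by simp only [kadj] at hdd; omega
  rcases hor with h1 | h1 | h1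
  · rcases ver with h2 | h2 | h2
    · obtain rfl : d' = d := Prod.ext h1 h2
      have := linked_Gd_cat (k := 1) (d := d') (by simpa using hd')
        (H.linked_Gd hD hne hw (Linked.single hw hw' (kadj_cat.1 hk)))
      rwa [add_comm 1] at this
    · obtain rfl : d' = (d.1, d.2 + 1) := Prod.ext h1 h2
      exact H.linked_vertical hN hD hd hd' hw hw' hk
    · obtain rfl : d = (d'.1, d'.2 + 1) := Prod.ext h1.symm h2
      exact (H.linked_vertical hN hD hd' hd hw' hw (kadj_symm hk)).symm Gd_symm
  · by_cases h2 : d'.2 = d.2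
    · obtain rfl : d' = (d.1 + 1, d.2) := Prod.ext h1 h2
      exact H.linked_horizontal hN hD hd hd' hw hw' hk
    · exact Linked.single hp hq (Gd_of_kadj_diagonal hD hw hw' h1 h2 hk)
  · by_cases h2 : d'.2 = d.2
    · obtain rfl : d = (d'.1 + 1, d'.2) := Prod.ext h1 h2.symm
      exact (H.linked_horizontal hN hD hd' hd hw' hw (kadj_symm hk)).symm Gd_symm
    · exact (Linked.single hq hp
        (Gd_of_kadj_diagonal hD hw' hw h1 (Ne.symm h2) (kadj_symm hk))).symm Gd_symm

/-- Once a level splits no component of the previous one, no later level does. -/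
theorem Rigid.succ (hN : 2 ≤ N) (hD : InBox N D) {k : ℕ} (H : Rigid N D (k + 2)) :
    Rigid N D (k + 3) := by
  intro p hp q hl
  have inner : ∀ p ∈ level N D (k + 3), ∀ a ∈ D, ∀ b ∈ D,
      Linked kadj (level N D (k + 4)) (cat N p a) (cat N p b) := by
    intro p hp a ha b hb
    obtain ⟨d, hd, w, hw, rfl⟩ := mem_level_succ'.1 hp
    have := linked_kadj_cat (k := 1) (d := d) (by simpa using hd)
      (H w hw w (Linked.refl _) a ha b hb)
    rwa [add_comm 1, pow_succ' _ (k + 2), ← cat_assoc, ← cat_assoc] at this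
  have main : ∀ q, Linked (Gd N D) (level N D (k + 3)) p q → ∀ a ∈ D, ∀ b ∈ D,
      Linked kadj (level N D (k + 4)) (cat N p a) (cat N q b) := by
    intro q hl
    induction hl with
    | refl => exact inner p hp
    | tail _ hs ih =>
      intro a ha b hb
      obtain ⟨h1, h2, a', ha', b', hb', hk⟩ := hs
      exact (ih a ha a' ha').trans ((Linked.single (cat_mem_level_succ h1 ha')
        (cat_mem_level_succ h2 hb') hk).trans (inner _ h2 b' hb' b hb))
  intro a ha b hb
  refine main q ?_ a ha b hb
  induction hl with
  | refl => exact Linked.refl _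
  | tail _ hs ih => exact ih.trans (H.linked_Gd_succ hN hD ⟨a, ha⟩ hs.1 hs.2.1 hs.2.2)

end Swap

end FractalSquare

namespace FractalSquare

/-! ### Words that block two sides of their cell. -/

section Blocked

variable {N : ℤ} {D : Set (ℤ × ℤ)}

/-- The number of components of `D_n` tends to infinity: no bounded number of cells represents
all of them. -/
def ManyComponents (N : ℤ) (D : Set (ℤ × ℤ)) : Prop :=
  ∀ M : ℕ, ∃ n₀ : ℕ, ∀ n ≥ n₀, ∀ Z : Finset (ℤ × ℤ), Z.card < M →
    ∃ s ∈ level N D n, ∀ z ∈ Z, ¬ Linked kadj (level N D n) z s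

/-- Some row of the box meets `D` without being contained in it. -/
def PartialRow (N : ℤ) (D : Set (ℤ × ℤ)) : Prop :=
  ∃ x x' y, (x, y) ∈ D ∧ (x', y) ∉ D ∧ 0 ≤ x' ∧ x' < N

/-- The last digit in the direction `s`. -/
def edge (N s : ℤ) : ℤ := if s = 1 then N - 1 else 0

theorem letter_mem (hD : InBox N D) {n : ℕ} {p : ℤ × ℤ} (h : p ∈ level N D (n + 1)) :
    (p.1 % N, p.2 % N) ∈ D ∧ parent N p ∈ level N D n := by
  obtain ⟨w, hw, v, hv, rfl⟩ := h
  have hb := hD v hv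
  refine ⟨?_, by rwa [parent_cat hD hv]⟩
  simp only [cat, Int.mul_add_emod_self_left]
  rwa [Int.emod_eq_of_lt hb.1 hb.2.1, Int.emod_eq_of_lt hb.2.2.1 hb.2.2.2]

theorem div_emod_add {w a s : ℤ} (hN : 2 ≤ N) (ha : 0 ≤ a) (ha' : a < N) (hs : s = 1 ∨ s = -1) :
    ((N * w + a + s) / N = w ∧ (N * w + a + s) % N = a + s) ∨
    (a = edge N s ∧ (N * w + a + s) / N = w + s ∧ (N * w + a + s) % N = edge N (-s)) := by
  have key : ∀ q r : ℤ, N * w + a + s = r + N * q → 0 ≤ r → r < N →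
      (N * w + a + s) / N = q ∧ (N * w + a + s) % N = r := by
    intro q r e h0 h1
    rw [e, Int.add_mul_ediv_left _ _ (by omega), Int.add_mul_emod_self_left,
      Int.ediv_eq_zero_of_lt h0 h1, Int.emod_eq_of_lt h0 h1]
    simp
  by_cases h : 0 ≤ a + s ∧ a + s < N
  · exact Or.inl (key w (a + s) (by ring) h.1 h.2)
  · right
    rcases hs with rfl | rfl
    · have : a = N - 1 := by omega
      simp only [edge, if_true, this, true_and]
      rw [← this]
      exact key _ _ (by norm_num; rw [this]; ring) (by norm_num) (by norm_num; omega)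
    · have : a = 0 := by omega
      simp only [edge, this]
      norm_num
      subst this
      have := key (w - 1) (N - 1) (by ring) (by omega) (by omega)
      simpa [← sub_eq_add_neg] using this

/-- Moving one cell either changes only the last digit, or carries: the last digit jumps to the
opposite edge and the preceding cell moves. -/
theorem shift_mem (hN : 2 ≤ N) (hD : InBox N D) {n : ℕ} {P d : ℤ × ℤ} {s : ℤ}
    (hs : s = 1 ∨ s = -1) (hd : d ∈ D) (h : ((cat N P d).1 + s, (cat N P d).2) ∈ level N D (n + 1)) :
    (d.1 + s, d.2) ∈ D ∨
      d.1 = edge N s ∧ (P.1 + s, P.2) ∈ level N D n ∧ (edge N (-s), d.2) ∈ D := by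
  have hb := hD d hd
  obtain ⟨h1, h2⟩ := letter_mem hD h
  simp only [cat, parent, Int.mul_add_emod_self_left, Int.emod_eq_of_lt hb.2.2.1 hb.2.2.2] at h1 h2
  rw [show N * P.2 + d.2 = d.2 + N * P.2 by ring, Int.add_mul_ediv_left _ _ (by omega),
    Int.ediv_eq_zero_of_lt hb.2.2.1 hb.2.2.2, zero_add] at h2
  rcases div_emod_add (w := P.1) hN hb.1 hb.2.1 hs with e | e
  · rw [e.2] at h1
    exact Or.inl h1
  · rw [e.2.2] at h1
    rw [e.2.1] at h2
    exact Or.inr ⟨e.1, h2, h1⟩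

theorem shift_mem_swap (hN : 2 ≤ N) (hD : InBox N D) {n : ℕ} {P d : ℤ × ℤ} {s : ℤ}
    (hs : s = 1 ∨ s = -1) (hd : d ∈ D) (h : ((cat N P d).1, (cat N P d).2 + s) ∈ level N D (n + 1)) :
    (d.1, d.2 + s) ∈ D ∨
      d.2 = edge N s ∧ (P.1, P.2 + s) ∈ level N D n ∧ (d.1, edge N (-s)) ∈ D := by
  have := shift_mem hN hD.swap (n := n) (P := P.swap) (d := d.swap) hs (by simpa using hd)
    (by rw [level_swap]; exact h)
  rw [level_swap] at this
  exact this

/-- A digit after which no cell on the side `s` is ever used. -/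
theorem PartialRow.exists_digit (hN : 2 ≤ N) (hD : InBox N D) (h : PartialRow N D) {s : ℤ}
    (hs : s = 1 ∨ s = -1) :
    ∃ d ∈ D, ∀ n w, ((cat N w d).1 + s, (cat N w d).2) ∉ level N D (n + 1) := by
  obtain ⟨x, x', y, hx, hx', h0, h1⟩ := h
  suffices ∃ d ∈ D, ((d.1 + s) % N, d.2) ∉ D by
    obtain ⟨d, hd, hds⟩ := this
    refine ⟨d, hd, fun n w hm => hds ?_⟩
    have hb := hD d hd
    have := (letter_mem hD hm).1
    simp only [cat, add_assoc, Int.mul_add_emod_self_left,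
      Int.emod_eq_of_lt hb.2.2.1 hb.2.2.2] at this
    exact this
  -- Otherwise the row would be closed under the cyclic shift by `s` modulo `N`, hence full.
  by_contra! hcl
  have all : ∀ k : ℕ, ((x + s * k) % N, y) ∈ D := by
    intro k
    induction k with
    | zero =>
      have hb := hD _ hx
      simp only at hb
      simpa [Int.emod_eq_of_lt hb.1 hb.2.1] using hx
    | succ k ih =>
      have := hcl _ ih
      simp only [Int.emod_add_emod] at this
      convert this using 3
      push_cast
      ring
  apply hx'
  have hr := Int.emod_nonneg (s * (x' - x)) (show N ≠ 0 by omega)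
  have := all ((s * (x' - x)) % N).toNat
  rw [Int.toNat_of_nonneg hr] at this
  have e : (x + s * (s * (x' - x) % N)) % N = x' := by
    have h2 : s * s = 1 := by rcases hs with rfl | rfl <;> norm_num
    have h3 : x + s * (s * (x' - x) % N) = x' + N * (-(s * (s * (x' - x) / N))) := by
      rw [Int.emod_def]
      linear_combination (x' - x) * h2
    rw [h3, Int.add_mul_emod_self_left, Int.emod_eq_of_lt h0 h1]
  rwa [e] at this

theorem PartialRow.exists_digit_swap (hN : 2 ≤ N) (hD : InBox N D)
    (h : PartialRow N (Prod.swap ⁻¹' D)) {s : ℤ} (hs : s = 1 ∨ s = -1) :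
    ∃ d ∈ D, ∀ n w, ((cat N w d).1, (cat N w d).2 + s) ∉ level N D (n + 1) := by
  obtain ⟨d, hd, hh⟩ := h.exists_digit hN hD.swap hs
  refine ⟨d.swap, hd, fun n w hm => hh n w.swap ?_⟩
  rw [level_swap]
  exact hm

/-- Cells with a common side, oriented by signs. -/
def sideAdj (sx sy : ℤ) (p q : ℤ × ℤ) : Prop :=
  q = (p.1 + sx, p.2) ∨ q = (p.1, p.2 + sy) ∨ p = (q.1 + sx, q.2) ∨ p = (q.1, q.2 + sy)

theorem sideAdj_symm {sx sy : ℤ} (p q : ℤ × ℤ) (h : sideAdj sx sy p q) : sideAdj sx sy q p := by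
  unfold sideAdj at *; tauto

theorem edge_shift {s w : ℤ} (hs : s = 1 ∨ s = -1) :
    N * (w + s) + edge N (-s) = N * w + edge N s + s := by
  rcases hs with rfl | rfl <;> simp [edge] <;> ring

theorem sideAdj.kadj {sx sy : ℤ} (hx : sx = 1 ∨ sx = -1) (hy : sy = 1 ∨ sy = -1) {p q : ℤ × ℤ}
    (h : sideAdj sx sy p q) : kadj p q := by
  simp only [sideAdj, Prod.ext_iff] at h
  unfold FractalSquare.kadj
  omega

/-- The corner digit and its two opposite edge cells face each other across every common side of
tiles, so connectedness of `D` through sides passes to all levels. -/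
theorem linked_of_corners {sx sy : ℤ} (hx : sx = 1 ∨ sx = -1)
    (hy : sy = 1 ∨ sy = -1)
    (hκ : (edge N sx, edge N sy) ∈ D) (h1 : (edge N (-sx), edge N sy) ∈ D)
    (h2 : (edge N sx, edge N (-sy)) ∈ D)
    (hcon : ∀ p ∈ D, Linked (sideAdj sx sy) D p (edge N sx, edge N sy)) (n : ℕ) :
    ∀ p ∈ level N D n, ∀ q ∈ level N D n, Linked (sideAdj sx sy) (level N D n) p q := by
  have hconn : ∀ a ∈ D, ∀ b ∈ D, Linked (sideAdj sx sy) D a b := fun a ha b hb =>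
    (hcon a ha).trans ((hcon b hb).symm sideAdj_symm)
  induction n with
  | zero =>
    rintro p hp q hq
    rw [Set.mem_singleton_iff.1 hp, Set.mem_singleton_iff.1 hq]
    exact Linked.refl _
  | succ n ih =>
    have inner : ∀ w ∈ level N D n, ∀ a ∈ D, ∀ b ∈ D,
        Linked (sideAdj sx sy) (level N D (n + 1)) (cat N w a) (cat N w b) := by
      intro w hw a ha b hb
      refine (hconn a ha b hb).lift _ fun a ha b hb hab => Linked.single
        (cat_mem_level_succ hw ha) (cat_mem_level_succ hw hb) ?_
      rcases hab with rfl | rfl | rfl | rfl <;> simp [sideAdj, cat, add_assoc]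
    have across : ∀ w ∈ level N D n, ∀ w' ∈ level N D n, (w' = (w.1 + sx, w.2) ∨
        w' = (w.1, w.2 + sy)) → ∃ a ∈ D, ∃ b ∈ D,
        Linked (sideAdj sx sy) (level N D (n + 1)) (cat N w a) (cat N w' b) := by
      rintro w hw w' hw' (rfl | rfl)
      · refine ⟨_, hκ, _, h1, Linked.single (cat_mem_level_succ hw hκ)
          (cat_mem_level_succ hw' h1) (Or.inl (Prod.ext (edge_shift hx) rfl))⟩
      · refine ⟨_, hκ, _, h2, Linked.single (cat_mem_level_succ hw hκ)
          (cat_mem_level_succ hw' h2) (Or.inr (Or.inl (Prod.ext rfl (edge_shift hy))))⟩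
    rintro _ ⟨w, hw, a, ha, rfl⟩ _ ⟨w', hw', b, hb, rfl⟩
    have key : ∀ w', Linked (sideAdj sx sy) (level N D n) w w' → ∀ b ∈ D,
        Linked (sideAdj sx sy) (level N D (n + 1)) (cat N w a) (cat N w' b) := by
      intro w' hl
      induction hl with
      | refl => exact fun b hb => inner w hw a ha b hb
      | @tail u v _ hs ih =>
        intro b hb
        obtain ⟨hu, hv, hst⟩ := hs
        have : ∃ a ∈ D, ∃ b ∈ D,
            Linked (sideAdj sx sy) (level N D (n + 1)) (cat N u a) (cat N v b) := by
          rcases hst with h | h | h | h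
          · exact across u hu v hv (Or.inl h)
          · exact across u hu v hv (Or.inr h)
          · obtain ⟨a, ha, b, hb, hl⟩ := across v hv u hu (Or.inl h)
            exact ⟨b, hb, a, ha, hl.symm sideAdj_symm⟩
          · obtain ⟨a, ha, b, hb, hl⟩ := across v hv u hu (Or.inr h)
            exact ⟨b, hb, a, ha, hl.symm sideAdj_symm⟩
        obtain ⟨a', ha', b', hb', hl⟩ := this
        exact (ih a' ha').trans (hl.trans (inner v hv b' hb' b hb))
    exact key w' (ih w hw w' hw') b hb

/-- A word whose cell never has a neighbour on the sides `sx` and `sy`. -/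
def BlockedWord (N : ℤ) (D : Set (ℤ × ℤ)) (sx sy : ℤ) (c : ℤ × ℤ) : Prop :=
  ∀ m, ∀ c' ∈ level N D m,
    ((cat (N ^ 2) c' c).1 + sx, (cat (N ^ 2) c' c).2) ∉ level N D (m + 2) ∧
    ((cat (N ^ 2) c' c).1, (cat (N ^ 2) c' c).2 + sy) ∉ level N D (m + 2)

/-- A digit with no neighbour in `D` on the two sides is exposed only to carries. Preceding it by
`dx` or `dy` stops the carry in one direction. If this never suffices, every digit climbs to one
corner and all levels are connected. -/
theorem exists_blockedWord (hN : 2 ≤ N) (hD : InBox N D) (hne : D.Nonempty)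
    (hM : ManyComponents N D) (hr : PartialRow N D) (hc : PartialRow N (Prod.swap ⁻¹' D))
    {sx sy : ℤ} (hx : sx = 1 ∨ sx = -1) (hy : sy = 1 ∨ sy = -1) :
    ∃ c ∈ level N D 2, BlockedWord N D sx sy c := by
  obtain ⟨dx, hdx, hdx'⟩ := hr.exists_digit hN hD hx
  obtain ⟨dy, hdy, hdy'⟩ := hc.exists_digit_swap hN hD hy
  have hassoc : ∀ c' e d, cat (N ^ 2) c' (cat N e d) = cat N (cat N c' e) d := by
    intro c' e d
    rw [cat_assoc, sq]
  have mem2 : ∀ {e d}, e ∈ D → d ∈ D → cat N e d ∈ level N D 2 := fun he hd =>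
    cat_mem_level_succ (n := 1) (by simpa using he) hd
  have bx : ∀ d ∈ D, (d.1 + sx, d.2) ∉ D → (d.1, d.2 + sy) ∉ D →
      (d.2 ≠ edge N sy ∨ (d.1, edge N (-sy)) ∉ D) → BlockedWord N D sx sy (cat N dx d) := by
    intro d hd h1 h2 h3 m c' hc'
    rw [hassoc]
    constructor <;> intro hm
    · rcases shift_mem hN hD hx hd hm with h | h
      · exact h1 h
      · exact hdx' _ _ h.2.1
    · rcases shift_mem_swap hN hD hy hd hm with h | h
      · exact h2 h
      · exact h3.elim (fun h3 => h3 h.1) fun h3 => h3 h.2.2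
  have by' : ∀ d ∈ D, (d.1 + sx, d.2) ∉ D → (d.1, d.2 + sy) ∉ D →
      (d.1 ≠ edge N sx ∨ (edge N (-sx), d.2) ∉ D) → BlockedWord N D sx sy (cat N dy d) := by
    intro d hd h1 h2 h3 m c' hc'
    rw [hassoc]
    constructor <;> intro hm
    · rcases shift_mem hN hD hx hd hm with h | h
      · exact h1 h
      · exact h3.elim (fun h3 => h3 h.1) fun h3 => h3 h.2.2
    · rcases shift_mem_swap hN hD hy hd hm with h | h
      · exact h2 h
      · exact hdy' _ _ h.2.1
  by_contra! hno
  have stuck : ∀ d ∈ D, (d.1 + sx, d.2) ∉ D → (d.1, d.2 + sy) ∉ D →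
      d.1 = edge N sx ∧ d.2 = edge N sy ∧ (edge N (-sx), d.2) ∈ D ∧ (d.1, edge N (-sy)) ∈ D := by
    intro d hd h1 h2
    have k1 := fun h => hno _ (mem2 hdx hd) (bx d hd h1 h2 h)
    have k2 := fun h => hno _ (mem2 hdy hd) (by' d hd h1 h2 h)
    tauto
  -- every cell climbs to the corner
  set f : ℤ × ℤ → ℤ := fun p => sx * p.1 + sy * p.2 with hf
  have hx2 : sx * sx = 1 := by rcases hx with rfl | rfl <;> norm_num
  have hy2 : sy * sy = 1 := by rcases hy with rfl | rfl <;> norm_num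
  obtain ⟨d, hd, hdmax⟩ := Set.exists_max_image D f hD.finite hne
  obtain ⟨e1, e2, c1, c2⟩ := stuck d hd
    (fun h => by have := hdmax _ h; simp only [hf] at this; linarith [mul_add sx d.1 sx])
    (fun h => by have := hdmax _ h; simp only [hf] at this; linarith [mul_add sy d.2 sy])
  rw [e1] at c2
  rw [e2] at c1
  have hκ : (edge N sx, edge N sy) ∈ D := by rw [← e1, ← e2]; exact hd
  have climb : ∀ k : ℕ, ∀ p ∈ D, f d - f p ≤ k →
      Linked (sideAdj sx sy) D p (edge N sx, edge N sy) := by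
    intro k
    induction k with
    | zero =>
      intro p hp hk
      obtain ⟨a1, a2, -⟩ := stuck p hp
        (fun h => by have := hdmax _ h; simp only [hf] at this hk; push_cast at hk; linarith [mul_add sx p.1 sx])
        (fun h => by have := hdmax _ h; simp only [hf] at this hk; push_cast at hk; linarith [mul_add sy p.2 sy])
      rw [← a1, ← a2]
      exact Linked.refl _
    | succ k ih =>
      intro p hp hk
      by_cases h1 : (p.1 + sx, p.2) ∈ D
      · refine (Linked.single hp h1 (Or.inl rfl)).trans (ih _ h1 ?_)
        simp only [hf] at hk ⊢; push_cast at hk; linarith [mul_add sx p.1 sx]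
      by_cases h2 : (p.1, p.2 + sy) ∈ D
      · refine (Linked.single hp h2 (Or.inr (Or.inl rfl))).trans (ih _ h2 ?_)
        simp only [hf] at hk ⊢; push_cast at hk; linarith [mul_add sy p.2 sy]
      obtain ⟨a1, a2, -⟩ := stuck p hp h1 h2
      rw [← a1, ← a2]
      exact Linked.refl _
  have hconn := linked_of_corners hx hy hκ c1 c2
    (fun p hp => climb (f d - f p).toNat p hp (Int.self_le_toNat _))
  obtain ⟨n, hn⟩ := hM 2
  obtain ⟨z, hz⟩ := level_nonempty (N := N) hne n
  obtain ⟨s, hs, hzs⟩ := hn n le_rfl {z} (by simp)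
  refine hzs z (by simp) ?_
  have := (hconn n z hz s hs).lift (R' := kadj) (Y := level N D n) id fun a ha b hb hab =>
    Linked.single ha hb (hab.kadj hx hy)
  simpa using this

end Blocked

end FractalSquare

namespace FractalSquare

/-! ### Components that avoid the corners, and words with bounded components. -/

section Cut

variable {N : ℤ} {D : Set (ℤ × ℤ)}

/-- A word `u` whose cells have components of bounded size, whatever precedes `u`. -/
def HasCut (N : ℤ) (D : Set (ℤ × ℤ)) : Prop :=
  ∃ (n : ℕ) (C : ℤ), ∃ u ∈ level N D n, ∀ m, ∀ c ∈ level N D m, ∀ w,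
    Linked kadj (level N D (m + n)) (cat (N ^ n) c u) w →
      |w.1 - (cat (N ^ n) c u).1| ≤ C ∧ |w.2 - (cat (N ^ n) c u).2| ≤ C

theorem HasCut.swap (h : HasCut N (Prod.swap ⁻¹' D)) : HasCut N D := by
  obtain ⟨n, C, u, hu, hh⟩ := h
  rw [level_swap] at hu
  refine ⟨n, C, u.swap, hu, fun m c hc w hw => ?_⟩
  have := hh m c.swap (by rw [level_swap]; simpa using hc) w.swap (linked_kadj_swap.2 hw)
  exact ⟨this.2, this.1⟩

/-- The component of `s` contains no corner of the box of side `B`. -/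
def NonCorner (B : ℤ) (X : Set (ℤ × ℤ)) (s : ℤ × ℤ) : Prop :=
  ∀ p, Linked kadj X s p → ¬ ((p.1 = 0 ∨ p.1 = B - 1) ∧ (p.2 = 0 ∨ p.2 = B - 1))

/-- The component of `s` joins the left side of the box to its right side. -/
def Across (B : ℤ) (X : Set (ℤ × ℤ)) (s : ℤ × ℤ) : Prop :=
  (∃ p, Linked kadj X s p ∧ p.1 = 0) ∧ ∃ p, Linked kadj X s p ∧ p.1 = B - 1

theorem abs_cat_sub_le {B : ℤ} {X : Set (ℤ × ℤ)} (hX : InBox B X) {w a b : ℤ × ℤ} (ha : a ∈ X)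
    (hb : b ∈ X) : |(cat B w a).1 - (cat B w b).1| ≤ B ∧ |(cat B w a).2 - (cat B w b).2| ≤ B := by
  have h1 := hX a ha
  have h2 := hX b hb
  simp only [cat, abs_le]
  omega

/-- A component joining no two opposite sides misses one lateral and one horizontal side. After a
word blocked on the other two sides it cannot leave its tile, diagonal exits being excluded by
`NonCorner`; this would be a cut. -/
theorem across_or (hN : 2 ≤ N) (hD : InBox N D) (hne : D.Nonempty) (hM : ManyComponents N D)
    (hr : PartialRow N D) (hc : PartialRow N (Prod.swap ⁻¹' D)) (hcut : ¬ HasCut N D) {n : ℕ}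
    {s : ℤ × ℤ} (hs : s ∈ level N D n) (hnc : NonCorner (N ^ n) (level N D n) s) :
    Across (N ^ n) (level N D n) s ∨
      ((∃ p, Linked kadj (level N D n) s p ∧ p.2 = 0) ∧
        ∃ p, Linked kadj (level N D n) s p ∧ p.2 = N ^ n - 1) := by
  have hbox := inBox_level hD n
  by_contra! hno
  obtain ⟨hno1, hno2⟩ := hno
  have hx : ∃ sx : ℤ, (sx = 1 ∨ sx = -1) ∧
      ∀ p, Linked kadj (level N D n) s p → (sx = 1 → p.1 ≠ 0) ∧ (sx = -1 → p.1 ≠ N ^ n - 1) := by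
    by_cases h : ∃ p, Linked kadj (level N D n) s p ∧ p.1 = 0
    · refine ⟨-1, Or.inr rfl, fun p hp => ⟨by norm_num, fun _ h1 => hno1 ⟨h, p, hp, h1⟩⟩⟩
    · push Not at h
      exact ⟨1, Or.inl rfl, fun p hp => ⟨fun _ => h p hp, by norm_num⟩⟩
  have hy : ∃ sy : ℤ, (sy = 1 ∨ sy = -1) ∧
      ∀ p, Linked kadj (level N D n) s p → (sy = 1 → p.2 ≠ 0) ∧ (sy = -1 → p.2 ≠ N ^ n - 1) := by
    by_cases h : ∃ p, Linked kadj (level N D n) s p ∧ p.2 = 0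
    · refine ⟨-1, Or.inr rfl, fun p hp => ⟨by norm_num, fun _ h1 => hno2 h p hp h1⟩⟩
    · push Not at h
      exact ⟨1, Or.inl rfl, fun p hp => ⟨fun _ => h p hp, by norm_num⟩⟩
  obtain ⟨sx, hsx, hx⟩ := hx
  obtain ⟨sy, hsy, hy⟩ := hy
  obtain ⟨c, hcL, hcb⟩ := exists_blockedWord hN hD hne hM hr hc hsx hsy
  refine hcut ⟨2 + n, N ^ n, _, cat_mem_level_add hcL hs, fun m c' hc' w hw => ?_⟩
  have e : cat (N ^ (2 + n)) c' (cat (N ^ n) c s) = cat (N ^ n) (cat (N ^ 2) c' c) s := by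
    rw [cat_assoc, ← pow_add, add_comm n 2]
  rw [e] at hw ⊢
  obtain ⟨a, hsa, rfl⟩ : w ∈ {q | ∃ a, Linked kadj (level N D n) s a ∧
      q = cat (N ^ n) (cat (N ^ 2) c' c) a} := by
    refine hw.mem_of_closed ?_ ⟨s, Linked.refl _, rfl⟩
    rintro _ ⟨a, hsa, rfl⟩ q hq - hk
    rw [← add_assoc, mem_level_add] at hq
    obtain ⟨z, hz, a', ha', rfl⟩ := hq
    have ha := hsa.mem hs
    obtain ⟨c1, c2⟩ := kadj_cat_cases hbox ha ha' hk
    have hx := hx a hsa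
    have hy := hy a hsa
    have hnc := hnc a hsa
    have hb := hcb m c' hc'
    set P := cat (N ^ 2) c' c
    have k1 : P.1 = z.1 ∨ z.1 = P.1 + sx ∧ (a.1 = 0 ∨ a.1 = N ^ n - 1) := by
      rcases hsx with rfl | rfl <;> simp at hx <;> omega
    have k2 : P.2 = z.2 ∨ z.2 = P.2 + sy ∧ (a.2 = 0 ∨ a.2 = N ^ n - 1) := by
      rcases hsy with rfl | rfl <;> simp at hy <;> omega
    rcases k1 with k1 | k1 <;> rcases k2 with k2 | k2
    · obtain rfl : P = z := Prod.ext k1 k2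
      exact ⟨a', hsa.trans (Linked.single ha ha' (kadj_cat.1 hk)), rfl⟩
    · exact absurd (show (P.1, P.2 + sy) ∈ _ by rw [k1, ← k2.1]; exact hz) hb.2
    · exact absurd (show (P.1 + sx, P.2) ∈ _ by rw [k2, ← k1.1]; exact hz) hb.1
    · exact absurd ⟨k1.2, k2.2⟩ hnc
  exact abs_cat_sub_le hbox (hsa.mem hs) hs

theorem nonCrossing_kadj (X : Set (ℤ × ℤ)) : NonCrossing kadj X :=
  nonCrossing_of_horizontal (fun _ _ => kadj_symm) fun q hq hq' =>
    Linked.single hq hq' (by simp only [kadj]; omega)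

/-- The four corners of a box. -/
def corners (B : ℤ) : Finset (ℤ × ℤ) := {0, B - 1} ×ˢ {0, B - 1}

theorem card_corners_le (B : ℤ) : (corners B).card ≤ 4 := by
  have : ({0, B - 1} : Finset ℤ).card ≤ 2 := Finset.card_le_two
  rw [corners, Finset.card_product]
  nlinarith

theorem nonCorner_of_corners {B : ℤ} {X : Set (ℤ × ℤ)} {s : ℤ × ℤ}
    (h : ∀ z ∈ corners B, ¬ Linked kadj X z s) : NonCorner B X s := by
  intro p hp hc
  refine h p ?_ (hp.symm fun _ _ => kadj_symm)
  simp only [corners, Finset.mem_product, Finset.mem_insert, Finset.mem_singleton]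
  exact hc

/-- If a component without corners joins the lateral sides, then few components touch the
horizontal sides. -/
theorem exists_reps (hN : 2 ≤ N) (hD : InBox N D) (hne : D.Nonempty) (hM : ManyComponents N D)
    (hr : PartialRow N D) (hc : PartialRow N (Prod.swap ⁻¹' D)) (hcut : ¬ HasCut N D) {n : ℕ}
    (hn : 1 ≤ n) {s : ℤ × ℤ} (hs : s ∈ level N D n)
    (hA : Across (N ^ n) (level N D n) s) :
    ∃ Z : Finset (ℤ × ℤ), Z.card ≤ 6 ∧ ∀ t ∈ level N D n, (t.2 = 0 ∨ t.2 = N ^ n - 1) →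
      ∃ z ∈ Z, Linked kadj (level N D n) z t := by
  classical
  have hbox := inBox_level hD n
  have ks : ∀ p q : ℤ × ℤ, kadj p q → kadj q p := fun _ _ => kadj_symm
  have hB : 2 ≤ N ^ n := hN.trans (le_self_pow₀ (by omega) (by omega))
  have side : ∀ {t t' b : ℤ × ℤ}, t ∈ level N D n → Linked kadj (level N D n) t t' → t.1 = 0 →
      t'.1 = N ^ n - 1 → b ∈ level N D n → ¬ Linked kadj (level N D n) t b → _ :=
    fun ht hl h0 h1 hb hnl => exists_side ks (fun _ _ h => h) hB hbox (nonCrossing_kadj _) ht hl h0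
      h1 hb hnl
  -- A component joining bottom to top would be on both sides of the component of `s`.
  have across : ∀ t ∈ level N D n, NonCorner (N ^ n) (level N D n) t →
      Across (N ^ n) (level N D n) t := by
    intro t ht hnc
    rcases across_or hN hD hne hM hr hc hcut ht hnc with h | ⟨⟨p, hp, hp0⟩, q, hq, hq1⟩
    · exact h
    obtain ⟨⟨a, hsa, ha⟩, b, hsb, hb⟩ := hA
    by_cases hst : Linked kadj (level N D n) s t
    · exact ⟨⟨a, (hst.symm ks).trans hsa, ha⟩, b, (hst.symm ks).trans hsb, hb⟩
    obtain ⟨up, h⟩ := side (hsa.mem hs) ((hsa.symm ks).trans hsb) ha hb ht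
      (fun h => hst (hsa.trans h))
    exact absurd ((h q hq).2.2.1 hq1) ((h p hp).2.2.2 hp0)
  -- At the bottom each of two such components would lie below the other, at the top above it;
  -- comparing their cells in column 0 forces them to coincide.
  have uniq : ∀ t ∈ level N D n, ∀ t' ∈ level N D n, NonCorner (N ^ n) (level N D n) t →
      NonCorner (N ^ n) (level N D n) t' → (t.2 = 0 ∧ t'.2 = 0 ∨ t.2 = N ^ n - 1 ∧ t'.2 = N ^ n - 1) →
      Linked kadj (level N D n) t t' := by
    intro t ht t' ht' hnc hnc' he
    obtain ⟨⟨a, hta, ha⟩, b, htb, hb⟩ := across t ht hnc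
    obtain ⟨⟨a', hta', ha'⟩, b', htb', hb'⟩ := across t' ht' hnc'
    by_contra hl
    obtain ⟨up, h⟩ := side (hta.mem ht) ((hta.symm ks).trans htb) ha hb ht'
      (fun h => hl (hta.trans h))
    obtain ⟨up', h'⟩ := side (hta'.mem ht') ((hta'.symm ks).trans htb') ha' hb' ht
      (fun h => hl ((hta'.trans h).symm ks))
    have k1 := (h a' hta').1 ha'
    have k1' := (h' a hta).1 ha
    have k2 := h t' (Linked.refl _)
    have k2' := h' t (Linked.refl _)
    rcases he with he | he
    · have e : a.2 = a'.2 := by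
        have := k1.not.2 (k2.2.2.2 he.2)
        have := k1'.not.2 (k2'.2.2.2 he.1)
        omega
      have : a = a' := Prod.ext (ha.trans ha'.symm) e
      exact hl (hta.trans (this ▸ hta'.symm ks))
    · have := k1.2 (k2.2.2.1 he.2)
      have := k1'.2 (k2'.2.2.1 he.1)
      omega
  have rep : ∀ y : ℤ, (y = 0 ∨ y = N ^ n - 1) → ∃ z, ∀ t ∈ level N D n,
      NonCorner (N ^ n) (level N D n) t → t.2 = y → Linked kadj (level N D n) z t := by
    intro y hy
    by_cases h : ∃ t ∈ level N D n, NonCorner (N ^ n) (level N D n) t ∧ t.2 = y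
    · obtain ⟨t, ht, hnc, e⟩ := h
      exact ⟨t, fun t' ht' hnc' e' => uniq t ht t' ht' hnc hnc' (by omega)⟩
    · exact ⟨0, fun t ht hnc e => absurd ⟨t, ht, hnc, e⟩ h⟩
  obtain ⟨z0, hz0⟩ := rep 0 (Or.inl rfl)
  obtain ⟨z1, hz1⟩ := rep _ (Or.inr rfl)
  -- Four corners, and one cornerless component for each of the two horizontal sides.
  refine ⟨corners (N ^ n) ∪ {z0, z1}, ?_, ?_⟩
  · have h1 := Finset.card_union_le (corners (N ^ n)) {z0, z1}
    have h2 := card_corners_le (N ^ n)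
    have h3 : ({z0, z1} : Finset (ℤ × ℤ)).card ≤ 2 := Finset.card_le_two
    omega
  · intro t ht h
    by_contra! hno
    have hnc : NonCorner (N ^ n) (level N D n) t := nonCorner_of_corners fun z hz =>
      hno z (Finset.mem_union_left _ hz)
    rcases h with h | h
    · exact hno z0 (by simp) (hz0 t ht hnc h)
    · exact hno z1 (by simp) (hz1 t ht hnc h)

end Cut

end FractalSquare

namespace FractalSquare

/-! ### Existence of a word with bounded components. -/

section CutExists

variable {N : ℤ} {D : Set (ℤ × ℤ)}

theorem kadj_translate {B x y x' y' δ δ' : ℤ} {a a' : ℤ × ℤ}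
    (h : kadj (cat B (x + δ, y) a) (cat B (x + δ', y) a')) :
    kadj (cat B (x' + δ, y') a) (cat B (x' + δ', y') a') := by
  simp only [kadj, cat, mul_add] at *
  omega

/-- A component that stays in one row of tiles and crosses the box gives a cut. -/
theorem hasCut_of_row (hN : 2 ≤ N) (hD : InBox N D) (hr : PartialRow N D) {n : ℕ} {t : ℤ × ℤ}
    {y₀ : ℤ}
    (hinner : ∀ e a, a ∈ level N D n → Linked kadj (level N D (2 + n)) t (cat (N ^ n) e a) →
      a.2 ≠ 0 ∧ a.2 ≠ N ^ n - 1)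
    (hcol : ∀ X, 0 ≤ X → X < N ^ 2 → (X, y₀) ∈ level N D 2 ∧ ∃ a ∈ level N D n,
      Linked kadj (level N D (2 + n)) t (cat (N ^ n) (X, y₀) a)) : HasCut N D := by
  have hbox := inBox_level hD n
  have hN2 : 2 * N - 2 ≤ N ^ 2 := by nlinarith
  obtain ⟨x, x', y, hxD, hx'D, h0, h1⟩ := hr
  have hxb := hD _ hxD
  simp only at hxb
  obtain ⟨-, a₀, ha₀, hl₀⟩ := hcol (N - 1) (by omega) (by omega)
  -- The tiles at offsets `lo` and `lo + N` both carry the missing digit `x'`, so the component is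
  -- trapped strictly between them.
  obtain ⟨lo, hlo, hlo1, hlo2⟩ : ∃ lo : ℤ, (x + lo = x' ∨ x + lo = x' - N) ∧ -N < lo ∧ lo < 0 := by
    by_cases h : x < x'
    · exact ⟨x' - x - N, by omega, by omega, by omega⟩
    · have : x ≠ x' := fun e => hx'D (e ▸ hxD)
      exact ⟨x' - x, by omega, by omega, by omega⟩
  refine ⟨1 + n, N * N ^ n, _, cat_mem_level_add (by rwa [level_one]) ha₀, fun m c' hc' w hw => ?_⟩
  have e : cat (N ^ (1 + n)) c' (cat (N ^ n) (x, y) a₀) = cat (N ^ n) (cat N c' (x, y)) a₀ := by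
    rw [cat_assoc, add_comm 1 n, pow_succ]
  rw [e] at hw ⊢
  set P := cat N c' (x, y) with hP
  have hmiss : ∀ δ, δ = lo ∨ δ = lo + N → (P.1 + δ, P.2) ∉ level N D (m + 1) := by
    intro δ hδ hm
    apply hx'D
    have := (letter_mem hD hm).1
    obtain ⟨k, hk⟩ : ∃ k, x + δ = x' + N * k := by
      rcases hδ with rfl | rfl <;> rcases hlo with h | h
      exacts [⟨0, by omega⟩, ⟨-1, by omega⟩, ⟨1, by omega⟩, ⟨0, by omega⟩]
    simpa only [hP, cat, add_assoc, hk, Int.mul_add_emod_self_left, Int.add_mul_emod_self_left,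
      Int.emod_eq_of_lt h0 h1, Int.emod_eq_of_lt hxb.2.2.1 hxb.2.2.2] using this
  -- The component is compared with that of `t`, offset δ corresponding to tile `N - 1 + δ` of row
  -- `y₀`. All such tiles are present, so `hinner` applies and the component stays in its row of
  -- tiles.
  obtain ⟨δ, a, hδ1, hδ2, ha, rfl, -⟩ : w ∈ {q | ∃ δ a, lo < δ ∧ δ < lo + N ∧ a ∈ level N D n ∧
      q = cat (N ^ n) (P.1 + δ, P.2) a ∧
      Linked kadj (level N D (2 + n)) t (cat (N ^ n) (N - 1 + δ, y₀) a)} := by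
    refine hw.mem_of_closed ?_ ⟨0, a₀, by omega, by omega, ha₀, by simp, by simpa using hl₀⟩
    rintro _ ⟨δ, a, hδ1, hδ2, ha, rfl, hl⟩ q hq - hk
    rw [← add_assoc, mem_level_add] at hq
    obtain ⟨z, hz, a', ha', rfl⟩ := hq
    obtain ⟨c1, c2⟩ := kadj_cat_cases hbox ha ha' hk
    have hin := hinner _ _ ha hl
    have hz2 : z.2 = P.2 := by
      rcases c2 with c2 | c2 | c2
      · exact c2.1.symm
      · exact absurd c2.2.1 hin.2
      · exact absurd c2.2.1 hin.1
    obtain ⟨δ', rfl⟩ : ∃ δ', z = (P.1 + δ', P.2) := ⟨z.1 - P.1, Prod.ext (by simp) hz2⟩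
    have n1 : δ' ≠ lo := fun h => hmiss δ' (Or.inl h) hz
    have n2 : δ' ≠ lo + N := fun h => hmiss δ' (Or.inr h) hz
    simp only at c1
    have d1 : lo < δ' := by omega
    have d2 : δ' < lo + N := by omega
    have m1 := (hcol (N - 1 + δ) (by omega) (by omega)).1
    have m2 := (hcol (N - 1 + δ') (by omega) (by omega)).1
    exact ⟨δ', a', d1, d2, ha', rfl, hl.trans (Linked.single (cat_mem_level_add m1 ha)
      (cat_mem_level_add m2 ha') (kadj_translate hk))⟩
  have b1 := hbox a ha
  have b2 := hbox a₀ ha₀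
  have hB : 0 ≤ N ^ n := by positivity
  have k1 : N ^ n * δ ≤ N ^ n * (N - 2) := mul_le_mul_of_nonneg_left (by omega) hB
  have k2 : N ^ n * (-(N - 2)) ≤ N ^ n * δ := mul_le_mul_of_nonneg_left (by omega) hB
  have k3 : N ^ n ≤ N * N ^ n := le_mul_of_one_le_left hB (by omega)
  simp only [cat, abs_le]
  refine ⟨⟨by linarith, by linarith⟩, by linarith, by linarith⟩

/-- Each tile has at most six components reaching its horizontal sides. A component of level n+2
outside all of these and the corners cannot change rows of tiles, hence runs through one whole row.
-/
theorem hasCut_of_across (hN : 2 ≤ N) (hD : InBox N D) (hne : D.Nonempty)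
    (hM : ManyComponents N D) (hr : PartialRow N D) (hc : PartialRow N (Prod.swap ⁻¹' D)) {n : ℕ}
    (hn : 1 ≤ n) {s : ℤ × ℤ} (hs : s ∈ level N D n) (hA : Across (N ^ n) (level N D n) s)
    (hbig : ∀ Z : Finset (ℤ × ℤ), Z.card ≤ 4 + (level N D 2).ncard * 6 →
      ∃ t ∈ level N D (2 + n), ∀ z ∈ Z, ¬ Linked kadj (level N D (2 + n)) z t) : HasCut N D := by
  classical
  by_contra hcut
  have hbox := inBox_level hD n
  have hbox2 := inBox_level hD 2
  have hpe : N ^ (2 + n) = N ^ n * N ^ 2 := by rw [add_comm, pow_add]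
  have ks : ∀ p q : ℤ × ℤ, kadj p q → kadj q p := fun _ _ => kadj_symm
  obtain ⟨Z, hZ, hrep⟩ := exists_reps hN hD hne hM hr hc hcut hn hs hA
  set E := hbox2.finite.toFinset with hE
  obtain ⟨t, ht, htZ⟩ := hbig (corners (N ^ (2 + n)) ∪
    (E ×ˢ Z).image fun q => cat (N ^ n) q.1 q.2) (by
      refine (Finset.card_union_le _ _).trans (add_le_add (card_corners_le _) ?_)
      refine Finset.card_image_le.trans ?_
      rw [Finset.card_product, Set.ncard_eq_toFinset_card _ hbox2.finite]
      exact Nat.mul_le_mul_left _ hZ)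
  have hnc : NonCorner (N ^ (2 + n)) (level N D (2 + n)) t := nonCorner_of_corners fun z hz =>
    htZ z (Finset.mem_union_left _ hz)
  have hmem : ∀ e a, a ∈ level N D n → Linked kadj (level N D (2 + n)) t (cat (N ^ n) e a) →
      e ∈ level N D 2 := by
    intro e a ha hl
    obtain ⟨e', he', a', ha', h⟩ := mem_level_add.1 (hl.mem ht)
    rwa [(cat_inj hbox ha ha' h).1]
  have hinner : ∀ e a, a ∈ level N D n → Linked kadj (level N D (2 + n)) t (cat (N ^ n) e a) →
      a.2 ≠ 0 ∧ a.2 ≠ N ^ n - 1 := by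
    intro e a ha hl
    have he := hmem e a ha hl
    rw [← not_or]
    intro h
    obtain ⟨z, hz, hza⟩ := hrep a ha h
    refine htZ (cat (N ^ n) e z) (Finset.mem_union_right _ (Finset.mem_image.2 ⟨(e, z), ?_, rfl⟩))
      ((linked_kadj_cat he hza).trans (hl.symm ks))
    simp [hE, he, hz]
  rcases across_or hN hD hne hM hr hc hcut ht hnc with hAt | ⟨⟨p, hp, hp0⟩, -⟩
  swap
  · obtain ⟨e, -, a, ha, rfl⟩ := mem_level_add.1 (hp.mem ht)
    have := hbox a ha
    exact (hinner e a ha hp).1 (first_digit this.2.2.1 this.2.2.2 hp0).2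
  obtain ⟨⟨p, hp, hp0⟩, q, hq, hq1⟩ := hAt
  obtain ⟨e₀, he₀, a₀, ha₀, rfl⟩ := mem_level_add.1 (hp.mem ht)
  have row : ∀ w, Linked kadj (level N D (2 + n)) (cat (N ^ n) e₀ a₀) w →
      ∃ e ∈ level N D 2, ∃ a ∈ level N D n, w = cat (N ^ n) e a ∧ e.2 = e₀.2 ∧
        Linked kadj (level N D (2 + n)) t w := by
    intro w hw
    refine hw.mem_of_closed (F := {w | ∃ e ∈ level N D 2, ∃ a ∈ level N D n,
      w = cat (N ^ n) e a ∧ e.2 = e₀.2 ∧ Linked kadj (level N D (2 + n)) t w}) ?_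
      ⟨e₀, he₀, a₀, ha₀, rfl, rfl, hp⟩
    rintro _ ⟨e, he, a, ha, rfl, h2, hl⟩ w hw hm hk
    obtain ⟨e', he', a', ha', rfl⟩ := mem_level_add.1 hw
    obtain ⟨-, c2⟩ := kadj_cat_cases hbox ha ha' hk
    have hin := hinner e a ha hl
    refine ⟨e', he', a', ha', rfl, ?_, hl.trans (Linked.single hm hw hk)⟩
    omega
  refine hcut (hasCut_of_row hN hD hr (y₀ := e₀.2) hinner fun X hX0 hX1 => ?_)
  suffices ∃ e ∈ level N D 2, ∃ a ∈ level N D n, e.2 = e₀.2 ∧ e.1 = X ∧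
      Linked kadj (level N D (2 + n)) t (cat (N ^ n) e a) by
    obtain ⟨e, he, a, ha, h2, h1, hl⟩ := this
    have : e = (X, e₀.2) := Prod.ext h1 h2
    exact ⟨this ▸ he, a, ha, this ▸ hl⟩
  by_contra! hno
  have hb₀ := hbox a₀ ha₀
  -- If column `X` of tiles were missed, the component would stay to its left and never reach the
  -- right side.
  have hlt : q ∈ {w | ∃ e ∈ level N D 2, ∃ a ∈ level N D n, w = cat (N ^ n) e a ∧ e.1 < X} := by
    have hl : Linked kadj (level N D (2 + n)) (cat (N ^ n) e₀ a₀) q := (hp.symm ks).trans hq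
    have : q ∈ {w | Linked kadj (level N D (2 + n)) (cat (N ^ n) e₀ a₀) w ∧
        ∃ e ∈ level N D 2, ∃ a ∈ level N D n, w = cat (N ^ n) e a ∧ e.1 < X} := by
      refine hl.mem_of_closed ?_ ⟨Linked.refl _, e₀, he₀, a₀, ha₀, rfl, ?_⟩
      · rintro _ ⟨hlw, e, he, a, ha, rfl, hlt⟩ w hw hm hk
        have hlw' := hlw.trans (Linked.single hm hw hk)
        obtain ⟨e', he', a', ha', rfl, h2, hl'⟩ := row _ hlw'
        refine ⟨hlw', e', he', a', ha', rfl, ?_⟩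
        have := (kadj_of_kadj_cat hbox ha ha' hk).2.1
        exact lt_of_le_of_ne (by omega) fun h => hno e' he' a' ha' h2 h hl'
      · have := (first_digit hb₀.1 hb₀.2.1 hp0).1
        exact lt_of_le_of_ne (by omega) fun h => hno e₀ he₀ a₀ ha₀ rfl h hp
    exact this.2
  obtain ⟨e, he, a, ha, rfl, h⟩ := hlt
  have hb := hbox a ha
  rw [hpe] at hq1
  have := (last_digit hb.1 hb.2.1 hq1).1
  omega

theorem ManyComponents.swap (hM : ManyComponents N D) : ManyComponents N (Prod.swap ⁻¹' D) := by
  classical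
  intro M
  obtain ⟨n₀, h⟩ := hM M
  refine ⟨n₀, fun n hn Z hZ => ?_⟩
  obtain ⟨s, hs, hh⟩ := h n hn (Z.image Prod.swap) (Finset.card_image_le.trans_lt hZ)
  refine ⟨s.swap, by rw [level_swap]; simpa using hs, fun z hz hl => ?_⟩
  exact hh z.swap (Finset.mem_image_of_mem _ hz) (by simpa using linked_kadj_swap.1 hl)

/-- If the number of components grows and `D` is a union neither of rows nor of columns, then
some word cuts out bounded components. -/
theorem ManyComponents.hasCut (hN : 2 ≤ N) (hD : InBox N D) (hne : D.Nonempty)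
    (hM : ManyComponents N D) (hr : PartialRow N D) (hc : PartialRow N (Prod.swap ⁻¹' D)) :
    HasCut N D := by
  by_contra hcut
  set K := 4 + (level N D 2).ncard * 6 with hK
  have hncard : (level N (Prod.swap ⁻¹' D) 2).ncard = (level N D 2).ncard := by
    rw [level_swap, ← Set.image_swap_eq_preimage_swap]
    exact Set.ncard_image_of_injective _ Prod.swap_injective
  obtain ⟨n₀, hn₀⟩ := hM (K + 1)
  set n := n₀ + 1
  obtain ⟨s, hs, hsz⟩ := hn₀ n (by omega) (corners (N ^ n)) (by
    have := card_corners_le (N ^ n)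
    omega)
  have hbig : ∀ Z : Finset (ℤ × ℤ), Z.card ≤ K →
      ∃ t ∈ level N D (2 + n), ∀ z ∈ Z, ¬ Linked kadj (level N D (2 + n)) z t := fun Z hZ =>
    hn₀ (2 + n) (by omega) Z (by omega)
  rcases across_or hN hD hne hM hr hc hcut hs (nonCorner_of_corners hsz) with hA | ⟨h0, h1⟩
  · exact hcut (hasCut_of_across hN hD hne hM hr hc (by omega) hs hA hbig)
  · refine hcut (HasCut.swap (hasCut_of_across (n := n) (s := s.swap) hN hD.swap
      (hne.preimage Prod.swap_surjective) hM.swap hc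
      (by rwa [← Set.preimage_comp, Prod.swap_swap_eq, Set.preimage_id])
      (by omega) (by rw [level_swap]; simpa using hs) ?_ ?_))
    · obtain ⟨p, hp, hp0⟩ := h0
      obtain ⟨q, hq, hq1⟩ := h1
      exact ⟨⟨p.swap, linked_kadj_swap.2 (by simpa using hp), hp0⟩,
        q.swap, linked_kadj_swap.2 (by simpa using hq), hq1⟩
    · intro Z hZ
      rw [hncard] at hZ
      classical
      obtain ⟨t, ht, hh⟩ := hbig (Z.image Prod.swap) (Finset.card_image_le.trans hZ)
      refine ⟨t.swap, by rw [level_swap]; simpa using ht, fun z hz hl => ?_⟩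
      exact hh z.swap (Finset.mem_image_of_mem _ hz) (by simpa using linked_kadj_swap.1 hl)

end CutExists

end FractalSquare

namespace FractalSquare

/-! ### Components and grid squares in the plane. -/

section Topology

/-- A space that is split into finitely many closed connected sets has these as components. -/
theorem numComponents_eq_card {Y : Type*} [Finite Y] {X : Set (ℝ × ℝ)} (F : Y → Set (ℝ × ℝ))
    (hX : X = ⋃ y, F y) (hdisj : ∀ y y', (F y ∩ F y').Nonempty → y = y')
    (hclosed : ∀ y, IsClosed (F y)) (hconn : ∀ y, IsConnected (F y)) :
    numComponents X = ENat.card Y := by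
  classical
  have hex : ∀ x : X, ∃ y, (x : ℝ × ℝ) ∈ F y := fun x => by
    have : (x : ℝ × ℝ) ∈ ⋃ y, F y := hX ▸ x.2
    simpa using this
  choose f hf using hex
  let _ : TopologicalSpace Y := ⊥
  have : DiscreteTopology Y := ⟨rfl⟩
  have hpre : ∀ y, f ⁻¹' {y} = Subtype.val ⁻¹' F y := by
    intro y
    ext x
    constructor
    · rintro rfl
      exact hf x
    · exact fun h => hdisj _ _ ⟨x, hf x, h⟩
  have hcont : Continuous f := by
    rw [continuous_iff_isClosed]
    intro s _
    have : f ⁻¹' s = ⋃ y ∈ s, f ⁻¹' {y} := by ext; simp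
    rw [this]
    refine (Set.toFinite s).isClosed_biUnion fun y _ => ?_
    rw [hpre]
    exact (hclosed y).preimage continuous_subtype_val
  have hsub : ∀ y, F y ⊆ X := fun y => hX ▸ Set.subset_iUnion F y
  refine ENat.card_congr (Equiv.ofBijective hcont.connectedComponentsLift ⟨?_, ?_⟩)
  · intro a b hab
    obtain ⟨x, rfl⟩ := ConnectedComponents.surjective_coe a
    obtain ⟨x', rfl⟩ := ConnectedComponents.surjective_coe b
    simp only [Continuous.connectedComponentsLift_apply_coe] at hab
    rw [ConnectedComponents.coe_eq_coe']
    have hpc : IsPreconnected (Subtype.val ⁻¹' F (f x') : Set X) := by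
      rw [← Topology.IsInducing.subtypeVal.isPreconnected_image, Subtype.image_preimage_coe,
        Set.inter_eq_right.2 (hsub _)]
      exact (hconn _).isPreconnected
    exact hpc.subset_connectedComponent (hf x') (show (x : ℝ × ℝ) ∈ F (f x') from hab ▸ hf x)
  · intro y
    obtain ⟨z, hz⟩ := (hconn y).nonempty
    refine ⟨((⟨z, hsub y hz⟩ : X) : ConnectedComponents X), ?_⟩
    rw [Continuous.connectedComponentsLift_apply_coe]
    exact hdisj _ _ ⟨z, hf _, hz⟩

/-- A decreasing intersection of compact connected sets is preconnected. -/
theorem isPreconnected_iInter_of_antitone {G : ℕ → Set (ℝ × ℝ)} (hG : Antitone G)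
    (hcomp : ∀ k, IsCompact (G k)) (hconn : ∀ k, IsPreconnected (G k)) :
    IsPreconnected (⋂ k, G k) := by
  have hclosed : IsClosed (⋂ k, G k) := isClosed_iInter fun k => (hcomp k).isClosed
  rw [isPreconnected_iff_subset_of_fully_disjoint_closed hclosed]
  intro u v hu hv huv hd
  obtain ⟨U, V, hU, hV, huU, hvV, hUV⟩ := NormalSpace.normal u v hu hv hd
  -- A separation of the intersection extends to disjoint open sets, and by compactness some `G k`
  -- is already covered by them.
  obtain ⟨k, hk⟩ := exists_subset_nhds_of_isCompact (hG.directed_ge) hcomp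
    (U := U ∪ V) fun x hx => (hU.union hV).mem_nhds
      ((huv hx).imp (fun h => huU h) fun h => hvV h)
  have hsub : (⋂ k, G k) ⊆ G k := Set.iInter_subset G k
  by_cases hne : (G k ∩ U).Nonempty
  · left
    have := (hconn k).subset_left_of_subset_union hU hV hUV hk hne
    intro x hx
    rcases huv hx with h | h
    · exact h
    · exact absurd (hvV h) fun h' => Set.disjoint_left.1 hUV (this (hsub hx)) h'
  · right
    intro x hx
    rcases huv hx with h | h
    · exact absurd ⟨x, hsub hx, huU h⟩ hne
    · exact h

/-- The closed square of the grid of mesh `1 / B` that belongs to the cell `p`. -/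
def square (B : ℤ) (p : ℤ × ℤ) : Set (ℝ × ℝ) :=
  {x | (p.1 : ℝ) ≤ B * x.1 ∧ B * x.1 ≤ p.1 + 1 ∧ (p.2 : ℝ) ≤ B * x.2 ∧ B * x.2 ≤ p.2 + 1}

variable {B : ℤ} {p q : ℤ × ℤ}

theorem square_eq_Icc (hB : 0 < B) (p : ℤ × ℤ) :
    square B p = Set.Icc ((p.1 : ℝ) / B) ((p.1 + 1) / B) ×ˢ Set.Icc ((p.2 : ℝ) / B) ((p.2 + 1) / B) := by
  have hB' : (0 : ℝ) < B := by exact_mod_cast hB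
  ext x
  simp only [square, Set.mem_ofPred_eq, Set.mem_prod, Set.mem_Icc, div_le_iff₀ hB', le_div_iff₀ hB',
    mul_comm (B : ℝ)]
  tauto

theorem isCompact_square (hB : 0 < B) (p : ℤ × ℤ) : IsCompact (square B p) := by
  rw [square_eq_Icc hB]
  exact isCompact_Icc.prod isCompact_Icc

theorem isConnected_square (hB : 0 < B) (p : ℤ × ℤ) : IsConnected (square B p) := by
  have hB' : (0 : ℝ) < B := by exact_mod_cast hB
  rw [square_eq_Icc hB]
  have : ∀ a : ℝ, a / B ≤ (a + 1) / B := fun a => div_le_div_of_nonneg_right (by linarith) hB'.le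
  exact (isConnected_Icc (this _)).prod (isConnected_Icc (this _))

theorem kadj_of_mem_square {x : ℝ × ℝ} (hp : x ∈ square B p) (hq : x ∈ square B q) : kadj p q := by
  obtain ⟨a1, a2, a3, a4⟩ := hp
  obtain ⟨b1, b2, b3, b4⟩ := hq
  exact ⟨by exact_mod_cast a1.trans b2, by exact_mod_cast b1.trans a2,
    by exact_mod_cast a3.trans b4, by exact_mod_cast b3.trans a4⟩

theorem square_inter_nonempty (hB : 0 < B) (h : kadj p q) :
    (square B p ∩ square B q).Nonempty := by
  have hB' : (B : ℝ) ≠ 0 := by exact_mod_cast hB.ne'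
  obtain ⟨h1, h2, h3, h4⟩ := h
  refine ⟨(((max p.1 q.1 : ℤ) : ℝ) / B, ((max p.2 q.2 : ℤ) : ℝ) / B), ?_, ?_⟩ <;>
  · simp only [square, Set.mem_ofPred_eq, mul_div_cancel₀ _ hB']
    refine ⟨by exact_mod_cast (by omega), by exact_mod_cast (by omega),
      by exact_mod_cast (by omega), by exact_mod_cast (by omega)⟩

theorem square_cat_subset {A : ℤ} (hB : 0 < B) {X : Set (ℤ × ℤ)} (hX : InBox B X) {w u : ℤ × ℤ}
    (hu : u ∈ X) : square (A * B) (cat B w u) ⊆ square A w := by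
  have hB' : (0 : ℝ) < B := by exact_mod_cast hB
  obtain ⟨h1, h2, h3, h4⟩ := hX u hu
  have g1 : (0 : ℝ) ≤ u.1 := by exact_mod_cast h1
  have g2 : (u.1 : ℝ) + 1 ≤ B := by exact_mod_cast h2
  have g3 : (0 : ℝ) ≤ u.2 := by exact_mod_cast h3
  have g4 : (u.2 : ℝ) + 1 ≤ B := by exact_mod_cast h4
  rintro x ⟨a1, a2, a3, a4⟩
  simp only [cat] at a1 a2 a3 a4
  push_cast at a1 a2 a3 a4
  refine ⟨?_, ?_, ?_, ?_⟩ <;> refine le_of_mul_le_mul_left ?_ hB' <;> nlinarith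

theorem abs_sub_le_of_mem_square (hB : 0 < B) {x y : ℝ × ℝ} (hx : x ∈ square B p)
    (hy : y ∈ square B q) {C : ℤ} (h1 : |p.1 - q.1| ≤ C) (h2 : |p.2 - q.2| ≤ C) :
    |x.1 - y.1| ≤ (C + 1) / B ∧ |x.2 - y.2| ≤ (C + 1) / B := by
  have hB' : (0 : ℝ) < B := by exact_mod_cast hB
  obtain ⟨a1, a2, a3, a4⟩ := hx
  obtain ⟨b1, b2, b3, b4⟩ := hy
  rw [abs_le] at h1 h2
  have c1 : -(C : ℝ) ≤ p.1 - q.1 := by exact_mod_cast h1.1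
  have c2 : (p.1 : ℝ) - q.1 ≤ C := by exact_mod_cast h1.2
  have c3 : -(C : ℝ) ≤ p.2 - q.2 := by exact_mod_cast h2.1
  have c4 : (p.2 : ℝ) - q.2 ≤ C := by exact_mod_cast h2.2
  constructor <;> rw [le_div_iff₀ hB', ← abs_of_pos hB', ← abs_mul, abs_le] <;>
    constructor <;> nlinarith

end Topology

end FractalSquare

namespace FractalSquare

/-! ### The fractal square and its approximations. -/

section Attractor

/-- `K` is the compact set generated by the digits `D` in base `N`. -/
structure Attractor (N : ℤ) (D : Set (ℤ × ℤ)) (K : Set (ℝ × ℝ)) : Prop where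
  nonempty : K.Nonempty
  isCompact : IsCompact K
  mem_iff : ∀ x, x ∈ K ↔ ∃ d ∈ D, ∃ y ∈ K, (N : ℝ) * x.1 = y.1 + d.1 ∧ (N : ℝ) * x.2 = y.2 + d.2

variable {N : ℤ} {D : Set (ℤ × ℤ)} {K : Set (ℝ × ℝ)}

theorem Attractor.mem_iff_level (hN : 2 ≤ N) (hK : Attractor N D K) (n : ℕ) (x : ℝ × ℝ) :
    x ∈ K ↔ ∃ p ∈ level N D n, ∃ y ∈ K, ((N ^ n : ℤ) : ℝ) * x.1 = y.1 + p.1 ∧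
      ((N ^ n : ℤ) : ℝ) * x.2 = y.2 + p.2 := by
  have hN' : (N : ℝ) ≠ 0 := by exact_mod_cast (by omega : N ≠ 0)
  induction n generalizing x with
  | zero =>
    constructor
    · exact fun h => ⟨0, rfl, x, h, by simp, by simp⟩
    · rintro ⟨p, hp, y, hy, h1, h2⟩
      obtain rfl := Set.mem_singleton_iff.1 hp
      have : x = y := Prod.ext (by simpa using h1) (by simpa using h2)
      exact this ▸ hy
  | succ n ih =>
    refine (ih x).trans ?_
    push_cast
    constructor
    · rintro ⟨p, hp, y, hy, h1, h2⟩
      obtain ⟨d, hd, z, hz, e1, e2⟩ := (hK.mem_iff y).1 hy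
      refine ⟨cat N p d, cat_mem_level_succ hp hd, z, hz, ?_, ?_⟩ <;> simp only [cat] <;> push_cast
      · linear_combination (N : ℝ) * h1 + e1
      · linear_combination (N : ℝ) * h2 + e2
    · rintro ⟨_, ⟨p, hp, d, hd, rfl⟩, z, hz, e1, e2⟩
      simp only [cat] at e1 e2
      push_cast at e1 e2
      refine ⟨p, hp, ((z.1 + d.1) / N, (z.2 + d.2) / N), (hK.mem_iff _).2
        ⟨d, hd, z, hz, by field_simp, by field_simp⟩, ?_, ?_⟩
      · field_simp
        linear_combination e1
      · field_simp
        linear_combination e2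

/-- An extremum argument for each coordinate: at a maximum $M$ self-similarity gives $NM\le M+N-1$,
and at a minimum $m$ it gives $Nm\ge m$. -/
theorem Attractor.bounds (hN : 2 ≤ N) (hD : InBox N D) (hK : Attractor N D K) {x : ℝ × ℝ}
    (hx : x ∈ K) : 0 ≤ x.1 ∧ x.1 ≤ 1 ∧ 0 ≤ x.2 ∧ x.2 ≤ 1 := by
  have hN' : (2 : ℝ) ≤ N := by exact_mod_cast hN
  have main : ∀ f : ℝ × ℝ → ℝ, Continuous f → (∀ x ∈ K, ∃ y ∈ K, ∃ c : ℝ, 0 ≤ c ∧ c + 1 ≤ N ∧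
      N * f x = f y + c) → ∀ x ∈ K, 0 ≤ f x ∧ f x ≤ 1 := by
    intro f hf hex x hx
    obtain ⟨a, ha, hmax⟩ := hK.isCompact.exists_isMaxOn hK.nonempty hf.continuousOn
    obtain ⟨b, hb, hmin⟩ := hK.isCompact.exists_isMinOn hK.nonempty hf.continuousOn
    obtain ⟨a', ha', c, hc, hc', e⟩ := hex a ha
    obtain ⟨b', hb', c', hc1, hc1', e'⟩ := hex b hb
    have h1 : f a' ≤ f a := hmax ha'
    have h2 : f b ≤ f b' := hmin hb'
    have h3 : f x ≤ f a := hmax hx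
    have h4 : f b ≤ f x := hmin hx
    constructor <;> nlinarith
  have cst : ∀ d ∈ D, (0 : ℝ) ≤ d.1 ∧ (d.1 : ℝ) + 1 ≤ N ∧ (0 : ℝ) ≤ d.2 ∧ (d.2 : ℝ) + 1 ≤ N := by
    intro d hd
    obtain ⟨h1, h2, h3, h4⟩ := hD d hd
    exact ⟨by exact_mod_cast h1, by exact_mod_cast h2, by exact_mod_cast h3, by exact_mod_cast h4⟩
  have b1 := main Prod.fst continuous_fst (fun x hx => by
    obtain ⟨d, hd, y, hy, e, -⟩ := (hK.mem_iff x).1 hx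
    exact ⟨y, hy, d.1, (cst d hd).1, (cst d hd).2.1, e⟩) x hx
  have b2 := main Prod.snd continuous_snd (fun x hx => by
    obtain ⟨d, hd, y, hy, -, e⟩ := (hK.mem_iff x).1 hx
    exact ⟨y, hy, d.2, (cst d hd).2.2.1, (cst d hd).2.2.2, e⟩) x hx
  exact ⟨b1.1, b1.2, b2.1, b2.2⟩

theorem Attractor.exists_square (hN : 2 ≤ N) (hD : InBox N D) (hK : Attractor N D K) (n : ℕ)
    {x : ℝ × ℝ} (hx : x ∈ K) : ∃ p ∈ level N D n, x ∈ square (N ^ n) p := by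
  obtain ⟨p, hp, y, hy, e1, e2⟩ := (hK.mem_iff_level hN n x).1 hx
  have := hK.bounds hN hD hy
  exact ⟨p, hp, by rw [e1]; linarith, by rw [e1]; linarith, by rw [e2]; linarith,
    by rw [e2]; linarith⟩

theorem Attractor.inter_square_nonempty (hN : 2 ≤ N) (hD : InBox N D) (hK : Attractor N D K)
    {n : ℕ} {p : ℤ × ℤ} (hp : p ∈ level N D n) : (K ∩ square (N ^ n) p).Nonempty := by
  obtain ⟨y, hy⟩ := hK.nonempty
  have hN' : (N : ℝ) ≠ 0 := by exact_mod_cast (by omega : N ≠ 0)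
  have hB : ((N ^ n : ℤ) : ℝ) ≠ 0 := by push_cast; exact pow_ne_zero _ hN'
  have := hK.bounds hN hD hy
  refine ⟨((y.1 + p.1) / (N ^ n : ℤ), (y.2 + p.2) / (N ^ n : ℤ)), (hK.mem_iff_level hN n _).2
    ⟨p, hp, y, hy, mul_div_cancel₀ _ hB, mul_div_cancel₀ _ hB⟩, ?_⟩
  simp only [square, Set.mem_ofPred_eq, mul_div_cancel₀ _ hB]
  refine ⟨by linarith, by linarith, by linarith, by linarith⟩

theorem exists_pow_gt (hN : 2 ≤ N) {ε : ℝ} (hε : 0 < ε) (C : ℝ) :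
    ∃ n₀ : ℕ, ∀ n ≥ n₀, C / (N ^ n : ℤ) < ε := by
  have hN' : (2 : ℝ) ≤ N := by exact_mod_cast hN
  obtain ⟨n, hn⟩ := pow_unbounded_of_one_lt (C / ε) (by linarith : (1 : ℝ) < N)
  refine ⟨n, fun m hm => ?_⟩
  have h1 : (N : ℝ) ^ n ≤ (N : ℝ) ^ m := pow_le_pow_right₀ (by linarith) hm
  push_cast
  rw [div_lt_iff₀ (by positivity)]
  rw [div_lt_iff₀ hε] at hn
  nlinarith

/-- Each square of an approximation contains a point of $K$, and the squares shrink; closedness of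
$K$ does the rest. -/
theorem Attractor.mem_of_squares (hN : 2 ≤ N) (hD : InBox N D) (hK : Attractor N D K)
    {x : ℝ × ℝ} (h : ∀ n₀ : ℕ, ∃ n ≥ n₀, ∃ p ∈ level N D n, x ∈ square (N ^ n) p) : x ∈ K := by
  rw [← hK.isCompact.isClosed.closure_eq, Metric.mem_closure_iff]
  intro ε hε
  obtain ⟨n₀, hn₀⟩ := exists_pow_gt hN hε 1
  obtain ⟨n, hn, p, hp, hxp⟩ := h n₀
  obtain ⟨y, hyK, hyp⟩ := hK.inter_square_nonempty hN hD hp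
  have := abs_sub_le_of_mem_square (C := 0) (by positivity) hxp hyp (by simp) (by simp)
  have h1 := hn₀ n hn
  refine ⟨y, hyK, ?_⟩
  rw [Prod.dist_eq, Real.dist_eq, Real.dist_eq]
  norm_num at this h1 ⊢
  exact ⟨this.1.trans_lt h1, this.2.trans_lt h1⟩

/-- The approximation of level `n`. -/
def approx (N : ℤ) (D : Set (ℤ × ℤ)) (n : ℕ) : Set (ℝ × ℝ) := ⋃ p ∈ level N D n, square (N ^ n) p

/-- The part of the approximation of level `n + k` whose cells of level `n` belong to the
component of `c`. -/
def region (N : ℤ) (D : Set (ℤ × ℤ)) (n : ℕ) (c : ℤ × ℤ) (k : ℕ) : Set (ℝ × ℝ) :=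
  ⋃ p ∈ {p | p ∈ level N D (n + k) ∧ Linked kadj (level N D n) c ((parent N)^[k] p)},
    square (N ^ (n + k)) p

theorem parent_mem (hD : InBox N D) {n : ℕ} {p : ℤ × ℤ} (h : p ∈ level N D (n + 1)) :
    parent N p ∈ level N D n := (letter_mem hD h).2

theorem iterate_parent_mem (hD : InBox N D) {n k : ℕ} {p : ℤ × ℤ} (h : p ∈ level N D (n + k)) :
    (parent N)^[k] p ∈ level N D n := by
  induction k generalizing p with
  | zero => exact h
  | succ k ih => exact ih (parent_mem hD h)

theorem square_subset_parent (hN : 2 ≤ N) (hD : InBox N D) {n : ℕ} {p : ℤ × ℤ}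
    (h : p ∈ level N D (n + 1)) : square (N ^ (n + 1)) p ⊆ square (N ^ n) (parent N p) := by
  obtain ⟨w, hw, d, hd, rfl⟩ := h
  rw [parent_cat hD hd, pow_succ]
  exact square_cat_subset (by omega) hD hd

theorem square_subset_iterate_parent (hN : 2 ≤ N) (hD : InBox N D) {n k : ℕ} {p : ℤ × ℤ}
    (h : p ∈ level N D (n + k)) :
    square (N ^ (n + k)) p ⊆ square (N ^ n) ((parent N)^[k] p) := by
  induction k generalizing p with
  | zero => exact subset_rfl
  | succ k ih => exact (square_subset_parent hN hD h).trans (ih (parent_mem hD h))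

theorem isCompact_region (hN : 2 ≤ N) (hD : InBox N D) (n : ℕ) (c : ℤ × ℤ) (k : ℕ) :
    IsCompact (region N D n c k) :=
  ((inBox_level hD (n + k)).finite.subset fun _ h => h.1).isCompact_biUnion fun p _ =>
    isCompact_square (by positivity) p

theorem antitone_region (hN : 2 ≤ N) (hD : InBox N D) (n : ℕ) (c : ℤ × ℤ) :
    Antitone (region N D n c) := by
  refine antitone_nat_of_succ_le fun k => ?_
  refine Set.iUnion₂_subset fun p hp => ?_
  refine (square_subset_parent hN hD hp.1).trans ?_
  exact Set.subset_biUnion_of_mem (u := fun p => square (N ^ (n + k)) p)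
    (show parent N p ∈ _ from ⟨parent_mem hD hp.1, hp.2⟩)

/-- Under `Rigid`, cells with linked ancestors are linked. -/
theorem linked_of_iterate_parent (hD : InBox N D) {n : ℕ}
    (H : ∀ m ≥ n, Rigid N D m) {k : ℕ} {p q : ℤ × ℤ} (hp : p ∈ level N D (n + k))
    (hq : q ∈ level N D (n + k))
    (h : Linked kadj (level N D n) ((parent N)^[k] p) ((parent N)^[k] q)) :
    Linked kadj (level N D (n + k)) p q := by
  induction k generalizing p q with
  | zero => exact h
  | succ k ih =>
    obtain ⟨w, hw, a, ha, rfl⟩ := hp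
    obtain ⟨w', hw', b, hb, rfl⟩ := hq
    simp only [Function.iterate_succ, Function.comp, parent_cat hD ha, parent_cat hD hb] at h
    exact H (n + k) (by omega) w hw w' (ih hw hw' h) a ha b hb

/-- For `k = 0` the region is one component of the approximation and rigidity is not needed; for
larger `k` rigidity keeps the descendants of that component linked. -/
theorem isConnected_region (hN : 2 ≤ N) (hD : InBox N D) (hne : D.Nonempty) {n : ℕ} {c : ℤ × ℤ}
    (hc : c ∈ level N D n) {k : ℕ} (H : k = 0 ∨ ∀ m ≥ n, Rigid N D m) :
    IsConnected (region N D n c k) := by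
  have hB : 0 < N ^ (n + k) := by positivity
  have ks : ∀ p q : ℤ × ℤ, kadj p q → kadj q p := fun _ _ => kadj_symm
  refine IsConnected.biUnion_of_reflTransGen ?_ (fun p _ => isConnected_square hB p) ?_
  · obtain ⟨u, hu⟩ := level_nonempty (N := N) hne k
    have key : ∀ k, ∃ p ∈ level N D (n + k), (parent N)^[k] p = c := by
      intro k
      induction k with
      | zero => exact ⟨c, hc, rfl⟩
      | succ k ih =>
        obtain ⟨p, hp, e⟩ := ih
        obtain ⟨a, ha⟩ := hne
        exact ⟨cat N p a, cat_mem_level_succ hp ha, by simp [parent_cat hD ha, e]⟩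
    obtain ⟨p, hp, e⟩ := key k
    exact ⟨p, hp, e ▸ Linked.refl _⟩
  · rintro p ⟨hp, hcp⟩ q ⟨hq, hcq⟩
    have hpq : Linked kadj (level N D (n + k)) p q := by
      rcases H with rfl | H
      · exact (hcp.symm ks).trans hcq
      · exact linked_of_iterate_parent hD H hp hq ((hcp.symm ks).trans hcq)
    -- parents of linked cells are linked
    have par : ∀ r, Linked kadj (level N D (n + k)) p r →
        Linked kadj (level N D n) ((parent N)^[k] p) ((parent N)^[k] r) := by
      have gen : ∀ k, ∀ p r, Linked kadj (level N D (n + k)) p r →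
          Linked kadj (level N D n) ((parent N)^[k] p) ((parent N)^[k] r) := by
        intro k
        induction k with
        | zero => exact fun p r h => h
        | succ k ih => exact fun p r h => ih _ _ (linked_kadj_parent hD h)
      exact gen k p
    clear hcq hq
    induction hpq with
    | refl => exact Relation.ReflTransGen.refl
    | @tail u v hu hs ih =>
      exact Relation.ReflTransGen.tail ih ⟨square_inter_nonempty hB hs.2.2, hs.1,
        hcp.trans (par u hu)⟩

end Attractor

end FractalSquare

namespace FractalSquare

/-! ### Counting components and passing to the limit. -/

section Counting

variable {N : ℤ} {D : Set (ℤ × ℤ)} {K : Set (ℝ × ℝ)}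

/-- Cells of level `n` that are linked to each other. -/
def linkedSetoid (N : ℤ) (D : Set (ℤ × ℤ)) (n : ℕ) : Setoid (level N D n) where
  r a b := Linked kadj (level N D n) a b
  iseqv := ⟨fun _ => Linked.refl _, fun h => h.symm fun _ _ => kadj_symm, fun h h' => h.trans h'⟩

/-- The components of level `n`. -/
abbrev Comp (N : ℤ) (D : Set (ℤ × ℤ)) (n : ℕ) := Quotient (linkedSetoid N D n)

theorem finite_comp (hD : InBox N D) (n : ℕ) : Finite (Comp N D n) := by
  have := (inBox_level hD n).finite.to_subtype
  infer_instance

theorem comp_eq_iff {n : ℕ} {a b : level N D n} :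
    (Quotient.mk (linkedSetoid N D n) a = Quotient.mk _ b) ↔ Linked kadj (level N D n) a b :=
  Quotient.eq (r := linkedSetoid N D n)

theorem linked_out {n : ℕ} {p : ℤ × ℤ} (hp : p ∈ level N D n) :
    Linked kadj (level N D n) (Quotient.mk (linkedSetoid N D n) ⟨p, hp⟩ : Comp N D n).out p :=
  Quotient.mk_out (s := linkedSetoid N D n) ⟨p, hp⟩

theorem eq_of_linked_out {n : ℕ} {c c' : Comp N D n}
    (h : Linked kadj (level N D n) c.out c'.out) : c = c' := by
  rw [← Quotient.out_eq c, ← Quotient.out_eq c', comp_eq_iff]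
  exact h

theorem numComponents_approx (hN : 2 ≤ N) (hD : InBox N D) (hne : D.Nonempty) (n : ℕ) :
    numComponents (approx N D n) = ENat.card (Comp N D n) := by
  have := finite_comp hD n
  refine numComponents_eq_card (fun c : Comp N D n => region N D n c.out 0) ?_ ?_ ?_ ?_
  · ext x
    simp only [approx, region, Set.mem_iUnion]
    constructor
    · rintro ⟨p, hp, hx⟩
      exact ⟨Quotient.mk _ ⟨p, hp⟩, p, ⟨hp, linked_out hp⟩, hx⟩
    · rintro ⟨c, p, hp, hx⟩
      exact ⟨p, hp.1, hx⟩
  · rintro c c' ⟨x, hx, hx'⟩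
    simp only [region, Set.mem_iUnion] at hx hx'
    obtain ⟨p, hp, hxp⟩ := hx
    obtain ⟨q, hq, hxq⟩ := hx'
    exact eq_of_linked_out (hp.2.trans ((Linked.single hp.1 hq.1 (kadj_of_mem_square hxp hxq)).trans
      (hq.2.symm fun _ _ => kadj_symm)))
  · exact fun c => (isCompact_region hN hD n _ 0).isClosed
  · exact fun c => isConnected_region hN hD hne c.out.2 (Or.inl rfl)

theorem Attractor.inter_region (hN : 2 ≤ N) (hD : InBox N D) (hK : Attractor N D K) {n : ℕ}
    (c : ℤ × ℤ) : K ∩ region N D n c 0 = ⋂ k, region N D n c k := by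
  ext x
  simp only [Set.mem_inter_iff, Set.mem_iInter]
  constructor
  · rintro ⟨hxK, hx⟩ k
    simp only [region, Set.mem_iUnion] at hx ⊢
    obtain ⟨q, ⟨hq, hcq⟩, hxq⟩ := hx
    obtain ⟨p, hp, hxp⟩ := hK.exists_square hN hD (n + k) hxK
    have := square_subset_iterate_parent hN hD hp hxp
    exact ⟨p, ⟨hp, hcq.trans (Linked.single hq (iterate_parent_mem hD hp)
      (kadj_of_mem_square hxq this))⟩, hxp⟩
  · intro h
    refine ⟨hK.mem_of_squares hN hD fun n₀ => ?_, h 0⟩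
    have := h n₀
    simp only [region, Set.mem_iUnion] at this
    obtain ⟨p, hp, hx⟩ := this
    exact ⟨n + n₀, by omega, p, hp.1, hx⟩

/-- Rigidity keeps every region connected, so its trace on $K$ is a decreasing intersection of
compact connected sets. These finitely many traces are disjoint and closed, hence are the
components. -/
theorem Attractor.numComponents_eq (hN : 2 ≤ N) (hD : InBox N D) (hne : D.Nonempty)
    (hK : Attractor N D K) {n : ℕ} (H : ∀ m ≥ n, Rigid N D m) :
    numComponents K = ENat.card (Comp N D n) := by
  have := finite_comp hD n
  refine numComponents_eq_card (fun c : Comp N D n => K ∩ region N D n c.out 0) ?_ ?_ ?_ ?_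
  · ext x
    simp only [region, Set.mem_iUnion, Set.mem_inter_iff]
    constructor
    · intro hx
      obtain ⟨p, hp, hxp⟩ := hK.exists_square hN hD n hx
      exact ⟨Quotient.mk _ ⟨p, hp⟩, hx, p, ⟨hp, linked_out hp⟩, hxp⟩
    · rintro ⟨c, hx, -⟩
      exact hx
  · rintro c c' ⟨x, ⟨-, hx⟩, -, hx'⟩
    simp only [region, Set.mem_iUnion] at hx hx'
    obtain ⟨p, hp, hxp⟩ := hx
    obtain ⟨q, hq, hxq⟩ := hx'
    exact eq_of_linked_out (hp.2.trans ((Linked.single hp.1 hq.1 (kadj_of_mem_square hxp hxq)).trans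
      (hq.2.symm fun _ _ => kadj_symm)))
  · exact fun c => hK.isCompact.isClosed.inter (isCompact_region hN hD n _ 0).isClosed
  · intro c
    constructor
    · obtain ⟨x, hx, hxp⟩ := hK.inter_square_nonempty hN hD c.out.2
      refine ⟨x, hx, ?_⟩
      simp only [region, Set.mem_iUnion]
      exact ⟨c.out, ⟨c.out.2, Linked.refl _⟩, hxp⟩
    · rw [hK.inter_region hN hD]
      exact isPreconnected_iInter_of_antitone (antitone_region hN hD n _)
        (isCompact_region hN hD n _)
        fun k => (isConnected_region hN hD hne c.out.2 (Or.inr H)).isPreconnected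

/-- The component that contains a given component of the next level. -/
def compParent (hD : InBox N D) (n : ℕ) : Comp N D (n + 1) → Comp N D n :=
  Quotient.map' (s₁ := linkedSetoid N D (n + 1)) (s₂ := linkedSetoid N D n)
    (fun p => ⟨parent N p, parent_mem hD p.2⟩) fun _ _ h => linked_kadj_parent hD h

theorem surjective_compParent (hD : InBox N D) (hne : D.Nonempty) (n : ℕ) :
    Function.Surjective (compParent hD n) := by
  intro c
  induction c using Quotient.inductionOn with
  | _ w =>
    obtain ⟨a, ha⟩ := hne
    refine ⟨Quotient.mk _ ⟨cat N w a, cat_mem_level_succ w.2 ha⟩, ?_⟩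
    refine comp_eq_iff.2 ?_
    simpa [parent_cat hD ha] using Linked.refl _

theorem card_comp_le (hD : InBox N D) (hne : D.Nonempty) (n : ℕ) :
    Nat.card (Comp N D n) ≤ Nat.card (Comp N D (n + 1)) := by
  have := finite_comp hD (n + 1)
  exact Nat.card_le_card_of_surjective _ (surjective_compParent hD hne n)

/-- The parent map between finite sets of components is onto, so equal cardinality means
injectivity, which is `Rigid`. -/
theorem card_comp_eq_iff (hD : InBox N D) (hne : D.Nonempty) (n : ℕ) :
    Nat.card (Comp N D n) = Nat.card (Comp N D (n + 1)) ↔ Rigid N D n := by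
  have := finite_comp hD n
  have := finite_comp hD (n + 1)
  constructor
  · intro h p hp q hl a ha b hb
    have hinj := ((surjective_compParent hD hne n).bijective_of_nat_card_le h.ge).1
    have hq := hl.mem hp
    refine comp_eq_iff.1 (@hinj (Quotient.mk _ ⟨cat N p a, cat_mem_level_succ hp ha⟩)
      (Quotient.mk _ ⟨cat N q b, cat_mem_level_succ hq hb⟩) (comp_eq_iff.2 ?_))
    simpa [parent_cat hD ha, parent_cat hD hb] using hl
  · intro H
    refine Nat.card_congr (Equiv.ofBijective _ ⟨?_, surjective_compParent hD hne n⟩).symm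
    intro x y
    induction x, y using Quotient.inductionOn₂ with
    | _ x y =>
      obtain ⟨_, w, hw, a, ha, rfl⟩ := x
      obtain ⟨_, w', hw', b, hb, rfl⟩ := y
      intro h
      have := comp_eq_iff.1 h
      simp only [parent_cat hD ha, parent_cat hD hb] at this
      exact comp_eq_iff.2 (H w hw w' this a ha b hb)

theorem rigid_of_le (hN : 2 ≤ N) (hD : InBox N D) {n : ℕ} (hn : 2 ≤ n) (H : Rigid N D n) :
    ∀ m ≥ n, Rigid N D m := by
  intro m hm
  induction m, hm using Nat.le_induction with
  | base => exact H
  | succ m hm ih =>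
    obtain ⟨k, rfl⟩ : ∃ k, m = k + 2 := ⟨m - 2, by omega⟩
    exact ih.succ hN hD

theorem manyComponents_of_lt (hD : InBox N D)
    (h : ∀ n ≥ 2, Nat.card (Comp N D n) < Nat.card (Comp N D (n + 1))) : ManyComponents N D := by
  have grow : ∀ n, n ≤ Nat.card (Comp N D (n + 2)) := by
    intro n
    induction n with
    | zero => omega
    | succ n ih => have := h (n + 2) (by omega); rw [show n + 1 + 2 = n + 2 + 1 by ring]; omega
  classical
  intro M
  refine ⟨M + 2, fun n hn Z hZ => ?_⟩
  obtain ⟨k, rfl⟩ : ∃ k, n = k + 2 := ⟨n - 2, by omega⟩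
  by_contra! hno
  have := finite_comp hD (k + 2)
  have hex : ∀ c : Comp N D (k + 2), ∃ z : Z, Linked kadj (level N D (k + 2)) z c.out := fun c => by
    obtain ⟨z, hz, hl⟩ := hno _ c.out.2
    exact ⟨⟨z, hz⟩, hl⟩
  choose f hf using hex
  have hinj : Function.Injective f := fun c c' e =>
    eq_of_linked_out (((hf c).symm fun _ _ => kadj_symm).trans (e ▸ hf c'))
  have := Nat.card_le_card_of_injective f hinj
  have h2 := grow k
  simp only [Nat.card_eq_fintype_card, Fintype.card_coe] at this
  omega

end Counting

end FractalSquare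

namespace FractalSquare

/-! ### Uncountably many point components. -/

section PointComponents

variable {N : ℤ} {D : Set (ℤ × ℤ)} {K : Set (ℝ × ℝ)}

/-- The squares linked to `p` and the remaining squares form two disjoint closed sets covering $K$,
and a connected set meets only one of them. -/
theorem Attractor.abs_sub_le_of_mem_component (hN : 2 ≤ N) (hD : InBox N D) (hK : Attractor N D K)
    {n : ℕ} {p : ℤ × ℤ} {C : ℤ} (hp : p ∈ level N D n)
    (hC : ∀ w, Linked kadj (level N D n) p w → |w.1 - p.1| ≤ C ∧ |w.2 - p.2| ≤ C) {x y : ℝ × ℝ}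
    (hx : x ∈ K) (hxp : x ∈ square (N ^ n) p) (hy : y ∈ connectedComponentIn K x) :
    |y.1 - x.1| ≤ (C + 1) / (N ^ n : ℤ) ∧ |y.2 - x.2| ≤ (C + 1) / (N ^ n : ℤ) := by
  have hB : 0 < N ^ n := by positivity
  have hfin := (inBox_level hD n).finite
  have hclosed : ∀ P : ℤ × ℤ → Prop, IsClosed (⋃ w ∈ {w | w ∈ level N D n ∧ P w}, square (N ^ n) w) :=
    fun P => (hfin.subset fun _ h => h.1).isClosed_biUnion fun w _ => (isCompact_square hB w).isClosed
  have hxS : x ∈ connectedComponentIn K x := mem_connectedComponentIn hx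
  have hmem : ∀ {P : ℤ × ℤ → Prop} {z : ℝ × ℝ},
      z ∈ (⋃ w ∈ {w | w ∈ level N D n ∧ P w}, square (N ^ n) w) ↔
        ∃ w, (w ∈ level N D n ∧ P w) ∧ z ∈ square (N ^ n) w := by
    intro P z
    simp only [Set.mem_iUnion, Set.mem_ofPred_eq, exists_prop]
  have hcover : connectedComponentIn K x ⊆
      (⋃ w ∈ {w | w ∈ level N D n ∧ Linked kadj (level N D n) p w}, square (N ^ n) w) ∪
        ⋃ w ∈ {w | w ∈ level N D n ∧ ¬ Linked kadj (level N D n) p w}, square (N ^ n) w := by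
    intro z hz
    obtain ⟨w, hw, hzw⟩ := hK.exists_square hN hD n (connectedComponentIn_subset K x hz)
    by_cases h : Linked kadj (level N D n) p w
    · exact Or.inl (hmem.2 ⟨w, ⟨hw, h⟩, hzw⟩)
    · exact Or.inr (hmem.2 ⟨w, ⟨hw, h⟩, hzw⟩)
  rcases isPreconnected_iff_subset_of_disjoint_closed.1
    (isPreconnected_connectedComponentIn (F := K) (x := x)) _ _ (hclosed _) (hclosed _) hcover (by
      rw [Set.eq_empty_iff_forall_notMem]
      rintro z ⟨-, h1, h2⟩
      obtain ⟨w, ⟨hw, hl⟩, hzw⟩ := hmem.1 h1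
      obtain ⟨w', ⟨hw', hl'⟩, hzw'⟩ := hmem.1 h2
      exact hl' (hl.trans (Linked.single hw hw' (kadj_of_mem_square hzw hzw')))) with h | h
  · obtain ⟨w, ⟨-, hw⟩, hyw⟩ := hmem.1 (h hy)
    exact abs_sub_le_of_mem_square hB hyw hxp (hC w hw).1 (hC w hw).2
  · obtain ⟨w, ⟨hwL, hw⟩, hxw⟩ := hmem.1 (h hxS)
    exact absurd (Linked.single hp hwL (kadj_of_mem_square hxp hxw)) hw

/-- The words that alternate a choice between `α` and `β` with the word `u`. -/
def codeWord (N : ℤ) (n : ℕ) (u α β : ℤ × ℤ) (σ : ℕ → Bool) : ℕ → ℤ × ℤ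
  | 0 => 0
  | k + 1 => cat (N ^ n) (cat (N ^ 2) (codeWord N n u α β σ k) (if σ k then α else β)) u

theorem codeWord_mem {n : ℕ} {u α β : ℤ × ℤ} (hu : u ∈ level N D n) (hα : α ∈ level N D 2)
    (hβ : β ∈ level N D 2) (σ : ℕ → Bool) (k : ℕ) :
    codeWord N n u α β σ k ∈ level N D (k * (2 + n)) := by
  induction k with
  | zero => simp [codeWord, level]
  | succ k ih =>
    rw [Nat.succ_mul, ← add_assoc]
    exact cat_mem_level_add (cat_mem_level_add ih (by split_ifs <;> assumption)) hu

theorem codeWord_congr {n : ℕ} {u α β : ℤ × ℤ} {σ τ : ℕ → Bool} {k : ℕ}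
    (h : ∀ j < k, σ j = τ j) : codeWord N n u α β σ k = codeWord N n u α β τ k := by
  induction k with
  | zero => rfl
  | succ k ih =>
    simp only [codeWord, ih fun j hj => h j (by omega), h k (by omega)]

/-- Each binary sequence selects an address containing the cut word at infinitely many positions.
The component of its point then has size at most a constant over arbitrarily large powers of `N`,
and is a point. -/
theorem Attractor.not_countable_pointComponents (hN : 2 ≤ N) (hD : InBox N D)
    (hK : Attractor N D K) (hcut : HasCut N D) {d₁ d₂ : ℤ × ℤ} (h₁ : d₁ ∈ D) (h₂ : d₂ ∈ D)
    (hne : d₁ ≠ d₂) : ¬ (pointComponents K).Countable := by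
  obtain ⟨n, C, u, hu, hC⟩ := hcut
  set α := cat N d₁ d₁ with hα
  set β := cat N d₂ d₂ with hβ
  have mem2 : ∀ {d}, d ∈ D → cat N d d ∈ level N D 2 := fun hd =>
    cat_mem_level_succ (n := 1) (by simpa using hd) hd
  have hαβ : ¬ kadj α β := by
    intro h
    apply hne
    -- Repeating a digit multiplies differences by `N + 1`, so different digits give cells that are
    -- not adjacent. The corresponding squares are disjoint, which makes the coding injective.
    have key : ∀ a b : ℤ, N * a + a ≤ N * b + b + 1 → a ≤ b := by
      intro a b h
      by_contra! hlt
      nlinarith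
    obtain ⟨k1, k2, k3, k4⟩ := h
    exact Prod.ext (le_antisymm (key _ _ k1) (key _ _ k2)) (le_antisymm (key _ _ k3) (key _ _ k4))
  set W := fun σ => codeWord N n u α β σ with hW
  have hWm : ∀ σ k, W σ k ∈ level N D (k * (2 + n)) := fun σ k =>
    codeWord_mem hu (mem2 h₁) (mem2 h₂) σ k
  have hchoice : ∀ b : Bool, (if b then α else β) ∈ level N D 2 := fun b => by
    cases b
    · exact mem2 h₂
    · exact mem2 h₁
  have hlen : ∀ k, (k + 1) * (2 + n) = k * (2 + n) + 2 + n := fun k => by ring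
  have hsub : ∀ σ k, square (N ^ ((k + 1) * (2 + n))) (W σ (k + 1)) ⊆
      square (N ^ (k * (2 + n) + 2)) (cat (N ^ 2) (W σ k) (if σ k then α else β)) := by
    intro σ k
    rw [hlen, pow_add _ _ n]
    exact square_cat_subset (by positivity) (inBox_level hD n) hu
  have hsub' : ∀ σ k, square (N ^ ((k + 1) * (2 + n))) (W σ (k + 1)) ⊆
      square (N ^ (k * (2 + n))) (W σ k) := by
    intro σ k
    refine (hsub σ k).trans ?_
    rw [pow_add]
    exact square_cat_subset (by positivity) (inBox_level hD 2) (hchoice _)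
  have hex : ∀ σ, ∃ x, x ∈ K ∧ ∀ k, x ∈ square (N ^ (k * (2 + n))) (W σ k) := by
    intro σ
    obtain ⟨x, hx⟩ := IsCompact.nonempty_iInter_of_sequence_nonempty_isCompact_isClosed
      (fun k => K ∩ square (N ^ (k * (2 + n))) (W σ k))
      (fun k => Set.inter_subset_inter_right _ (hsub' σ k))
      (fun k => hK.inter_square_nonempty hN hD (hWm σ k))
      (hK.isCompact.inter_right (isCompact_square (by positivity) _).isClosed)
      (fun k => hK.isCompact.isClosed.inter (isCompact_square (by positivity) _).isClosed)
    rw [Set.mem_iInter] at hx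
    exact ⟨x, (hx 0).1, fun k => (hx k).2⟩
  choose g hgK hg using hex
  have hpt : ∀ σ, g σ ∈ pointComponents K := by
    intro σ
    refine ⟨hgK σ, Set.Subset.antisymm (fun y hy => ?_)
      (Set.singleton_subset_iff.2 (mem_connectedComponentIn (hgK σ)))⟩
    have near : ∀ ε > 0, |y.1 - (g σ).1| < ε ∧ |y.2 - (g σ).2| < ε := by
      intro ε hε
      obtain ⟨n₀, hn₀⟩ := exists_pow_gt hN hε (C + 1)
      have hk := hg σ (n₀ + 1)
      rw [hlen] at hk
      have hm := cat_mem_level_add (hWm σ n₀) (hchoice (σ n₀))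
      have := hK.abs_sub_le_of_mem_component hN hD (cat_mem_level_add hm hu) (hC _ _ hm) (hgK σ) hk hy
      have hlt := hn₀ (n₀ * (2 + n) + 2 + n) (by nlinarith [Nat.zero_le (n₀ * n)])
      exact ⟨this.1.trans_lt hlt, this.2.trans_lt hlt⟩
    have zero : ∀ a : ℝ, (∀ ε > 0, |a| < ε) → a = 0 := fun a h => by
      by_contra ha
      exact lt_irrefl _ (h |a| (abs_pos.2 ha))
    exact Prod.ext (sub_eq_zero.1 (zero _ fun ε hε => (near ε hε).1))
      (sub_eq_zero.1 (zero _ fun ε hε => (near ε hε).2))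
  have hinj : Function.Injective g := by
    intro σ τ hστ
    by_contra hne
    have hex : ∃ k, σ k ≠ τ k := by
      by_contra! h
      exact hne (funext h)
    classical
    set k := Nat.find hex with hk
    have hlt : ∀ j < k, σ j = τ j := fun j hj => not_not.1 (Nat.find_min hex hj)
    have hkn : σ k ≠ τ k := Nat.find_spec hex
    have e : W σ k = W τ k := codeWord_congr hlt
    have m1 := hsub σ k (hg σ (k + 1))
    have m2 := hsub τ k (hg τ (k + 1))
    rw [hστ, e] at m1
    have := kadj_cat.1 (kadj_of_mem_square m1 m2)
    cases h1 : σ k <;> cases h2 : τ k <;> simp [h1, h2] at hkn this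
    · exact hαβ (kadj_symm this)
    · exact hαβ this
  intro hcount
  have := hcount.to_subtype
  have : Countable (ℕ → Bool) := Function.Injective.countable (f := fun σ =>
    (⟨g σ, hpt σ⟩ : pointComponents K)) fun σ τ h => hinj (congrArg Subtype.val h)
  obtain ⟨f, hf⟩ := exists_surjective_nat (ℕ → Bool)
  obtain ⟨m, hm⟩ := hf fun k => !(f k k)
  have := congrFun hm m
  simp at this

end PointComponents

end FractalSquare

namespace FractalSquare

/-! ### Unions of full rows: the product case. -/

section Product

variable {N : ℤ} {D : Set (ℤ × ℤ)} {K : Set (ℝ × ℝ)}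

theorem level_row_complete (hN : 2 ≤ N) (hrow : ¬ PartialRow N D) {n : ℕ}
    {p : ℤ × ℤ} (hp : p ∈ level N D n) {x : ℤ} (h0 : 0 ≤ x) (h1 : x < N ^ n) :
    (x, p.2) ∈ level N D n := by
  induction n generalizing p x with
  | zero =>
    obtain rfl := Set.mem_singleton_iff.1 hp
    obtain rfl : x = 0 := by simp at h1; omega
    exact rfl
  | succ n ih =>
    obtain ⟨w, hw, d, hd, rfl⟩ := hp
    have hdiv : x / N < N ^ n := Int.ediv_lt_of_lt_mul (by omega) (by rwa [← pow_succ])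
    have hw' := ih hw (Int.ediv_nonneg h0 (by omega)) hdiv
    have hd' : (x % N, d.2) ∈ D := by
      by_contra h
      exact hrow ⟨d.1, x % N, d.2, hd, h, Int.emod_nonneg _ (by omega),
        Int.emod_lt_of_pos _ (by omega)⟩
    refine ⟨_, hw', _, hd', Prod.ext ?_ rfl⟩
    simp only [cat]
    exact (Int.mul_ediv_add_emod x N).symm

theorem linked_row (hN : 2 ≤ N) (hD : InBox N D) (hrow : ¬ PartialRow N D) {n : ℕ}
    {p q : ℤ × ℤ} (hp : p ∈ level N D n) (hq : q ∈ level N D n) (h : p.2 = q.2) :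
    Linked kadj (level N D n) p q := by
  have main : ∀ j : ℕ, ∀ p ∈ level N D n, p.1 + j < N ^ n →
      Linked kadj (level N D n) p (p.1 + j, p.2) := by
    intro j p hp
    have hb := inBox_level hD n p hp
    induction j with
    | zero => intro _; simpa using Linked.refl p
    | succ j ih =>
      intro hj
      push_cast at hj
      refine (ih (by omega)).trans (Linked.single
        (level_row_complete hN hrow hp (by omega) (by omega))
        (level_row_complete hN hrow hp (by omega) (by push_cast; omega)) ?_)
      simp only [kadj]
      push_cast
      omega
  have aux : ∀ p ∈ level N D n, ∀ q ∈ level N D n, p.2 = q.2 → p.1 ≤ q.1 →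
      Linked kadj (level N D n) p q := by
    intro p hp q hq h hle
    have hq' := inBox_level hD n q hq
    have e : q = (p.1 + ((q.1 - p.1).toNat : ℤ), p.2) :=
      Prod.ext (by simp only; omega) h.symm
    rw [e]
    exact main _ p hp (by omega)
  rcases le_total p.1 q.1 with hle | hle
  · exact aux p hp q hq h hle
  · exact (aux q hq p hp h.symm hle).symm fun _ _ => kadj_symm

theorem ManyComponents.exists_not_linked (hM : ManyComponents N D) (hne : D.Nonempty) :
    ∃ n, ∃ p ∈ level N D n, ∃ q ∈ level N D n, ¬ Linked kadj (level N D n) p q := by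
  obtain ⟨n, hn⟩ := hM 2
  obtain ⟨p, hp⟩ := level_nonempty (N := N) hne n
  obtain ⟨q, hq, h⟩ := hn n le_rfl {p} (by simp)
  exact ⟨n, p, hp, q, hq, h p (by simp)⟩

theorem ManyComponents.exists_row_ne (hN : 2 ≤ N) (hD : InBox N D) (hne : D.Nonempty)
    (hM : ManyComponents N D) (hrow : ¬ PartialRow N D) : ∃ d₁ ∈ D, ∃ d₂ ∈ D, d₁.2 ≠ d₂.2 := by
  by_contra! hall
  obtain ⟨n, p, hp, q, hq, h⟩ := hM.exists_not_linked hne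
  refine h (linked_row hN hD hrow hp hq ?_)
  clear h
  induction n generalizing p q with
  | zero => rw [Set.mem_singleton_iff.1 hp, Set.mem_singleton_iff.1 hq]
  | succ n ih =>
    obtain ⟨w, hw, d, hd, rfl⟩ := hp
    obtain ⟨w', hw', d', hd', rfl⟩ := hq
    simp only [cat, ih w hw w' hw', hall d hd d' hd']

/-- If all occupied rows and columns were full, any two cells would be joined by a row followed by a
column. -/
theorem ManyComponents.partialRow_swap (hN : 2 ≤ N) (hD : InBox N D) (hne : D.Nonempty)
    (hM : ManyComponents N D) (hrow : ¬ PartialRow N D) : PartialRow N (Prod.swap ⁻¹' D) := by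
  by_contra hcol
  obtain ⟨n, p, hp, q, hq, h⟩ := hM.exists_not_linked hne
  have hb := inBox_level hD n q hq
  have hr : (q.1, p.2) ∈ level N D n := level_row_complete hN hrow hp hb.1 hb.2.1
  refine h ((linked_row hN hD hrow hp hr rfl).trans ?_)
  have := linked_row hN hD.swap hcol (n := n) (p := (p.2, q.1)) (q := q.swap)
    (by rw [level_swap]; exact hr) (by rw [level_swap]; simpa using hq) rfl
  simpa using linked_kadj_swap.1 this

theorem Attractor.isCantorTimesInterval (hN : 2 ≤ N) (hD : InBox N D) (hK : Attractor N D K)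
    (hne : D.Nonempty) (hM : ManyComponents N D) (hrow : ¬ PartialRow N D) :
    IsCantorTimesInterval K := by
  have hprod : ∀ x ∈ K, ∀ t : ℝ, 0 ≤ t → t ≤ 1 → (t, x.2) ∈ K := by
    intro x hx t ht0 ht1
    refine hK.mem_of_squares hN hD fun n => ⟨n, le_rfl, ?_⟩
    obtain ⟨p, hp, hxp⟩ := hK.exists_square hN hD n hx
    have hB : 0 < N ^ n := by positivity
    obtain ⟨c, hc0, hc1, hc2, hc3⟩ : ∃ c : ℤ, 0 ≤ c ∧ c < N ^ n ∧ (c : ℝ) ≤ (N ^ n : ℤ) * t ∧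
        ((N ^ n : ℤ) : ℝ) * t ≤ c + 1 := by
      have hB' : (0 : ℝ) < (N ^ n : ℤ) := by exact_mod_cast hB
      rcases ht1.lt_or_eq with h | rfl
      · refine ⟨⌊((N ^ n : ℤ) : ℝ) * t⌋, Int.floor_nonneg.2 (by positivity), ?_, Int.floor_le _,
          (Int.lt_floor_add_one _).le⟩
        rw [Int.floor_lt]
        nlinarith
      · exact ⟨N ^ n - 1, by omega, by omega, by push_cast; linarith, by push_cast; linarith⟩
    exact ⟨_, level_row_complete hN hrow hp hc0 hc1, hc2, hc3, hxp.2.2.1, hxp.2.2.2⟩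
  obtain ⟨d₁, hd₁, d₂, hd₂, hdd⟩ := hM.exists_row_ne hN hD hne hrow
  obtain ⟨a, ha, b, hb, hab⟩ : ∃ a ∈ K, ∃ b ∈ K, a.2 ≠ b.2 := by
    by_contra! hall
    have hN' : (N : ℝ) ≠ 0 := by exact_mod_cast (by omega : N ≠ 0)
    obtain ⟨y, hy⟩ := hK.nonempty
    have mem : ∀ d ∈ D, ((y.1 + d.1) / N, (y.2 + d.2) / N) ∈ K := fun d hd =>
      (hK.mem_iff _).2 ⟨d, hd, y, hy, mul_div_cancel₀ _ hN', mul_div_cancel₀ _ hN'⟩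
    have := hall _ (mem d₁ hd₁) _ (mem d₂ hd₂)
    simp only [div_left_inj' hN', add_right_inj, Int.cast_inj] at this
    exact hdd this
  refine ⟨Prod.snd '' K, ⟨hK.nonempty.image _, hK.isCompact.image continuous_snd, ?_, ?_⟩, Or.inr ?_⟩
  · rintro _ ⟨x, hx, rfl⟩
    rw [accPt_iff_nhds]
    intro U hU
    obtain ⟨ε, hε, hUε⟩ := Metric.mem_nhds_iff.1 hU
    obtain ⟨n, hn⟩ := exists_pow_gt hN hε 1
    have hn := hn n le_rfl
    obtain ⟨p, hp, y, hy, -, e⟩ := (hK.mem_iff_level hN n x).1 hx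
    have hB' : (0 : ℝ) < (N ^ n : ℤ) := by exact_mod_cast (by positivity : 0 < N ^ n)
    -- Small copies of `a` and `b` near the given point have different heights, so at least one of
    -- them differs from it.
    have mem : ∀ z ∈ K, (z.2 + p.2) / ((N ^ n : ℤ) : ℝ) ∈ U ∩ Prod.snd '' K := by
      intro z hz
      refine ⟨hUε ?_, ((z.1 + p.1) / ((N ^ n : ℤ) : ℝ), (z.2 + p.2) / ((N ^ n : ℤ) : ℝ)),
        (hK.mem_iff_level hN n _).2 ⟨p, hp, z, hz, mul_div_cancel₀ _ hB'.ne',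
          mul_div_cancel₀ _ hB'.ne'⟩, rfl⟩
      have hzb := hK.bounds hN hD hz
      have hyb := hK.bounds hN hD hy
      rw [div_lt_iff₀ hB'] at hn
      rw [Metric.mem_ball, Real.dist_eq, abs_lt]
      constructor
      · rw [lt_sub_iff_add_lt, lt_div_iff₀ hB']; nlinarith
      · rw [sub_lt_iff_lt_add, div_lt_iff₀ hB']; nlinarith
    by_contra! hno
    have e1 := hno _ (mem a ha)
    have e2 := hno _ (mem b hb)
    rw [← e2, div_left_inj' hB'.ne'] at e1
    exact hab (by linarith)
  · intro t ht hpre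
    obtain ⟨y₀, y', x₀, hy₀, hy', h0, h1⟩ := hM.partialRow_swap hN hD hne hrow
    -- Rows of `D` are full or empty, so a cell missing from a column means an entirely empty row
    -- `y'`.
    have hmiss : ∀ x, (x, y') ∉ D := by
      intro x hx
      have hb := hD _ hy₀
      simp only [Prod.fst_swap, Prod.snd_swap] at hb
      by_contra
      exact hrow ⟨x, x₀, y', hx, hy', hb.1, hb.2.1⟩
    have main : ∀ a ∈ t, ∀ b ∈ t, ¬ a < b := by
      intro a ha b hb hlt
      have hicc := hpre.Icc_subset ha hb
      obtain ⟨n, hn⟩ := exists_pow_gt hN (sub_pos.2 hlt) 2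
      have hn := hn n le_rfl
      have hB' : (0 : ℝ) < (N ^ n : ℤ) := by exact_mod_cast (by positivity : 0 < N ^ n)
      have hN' : (2 : ℝ) ≤ N := by exact_mod_cast hN
      rw [div_lt_iff₀ hB'] at hn
      set j := ⌈((N ^ n : ℤ) : ℝ) * a⌉ with hj
      have hj1 : ((N ^ n : ℤ) : ℝ) * a ≤ j := Int.le_ceil _
      have hj2 : (j : ℝ) < ((N ^ n : ℤ) : ℝ) * a + 1 := Int.ceil_lt_add_one _
      have g0 : (0 : ℝ) ≤ y' := by exact_mod_cast h0
      have g1 : (y' : ℝ) + 1 ≤ N := by exact_mod_cast h1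
      -- An interval longer than $2/N^n$ contains a whole grid interval of mesh $1/N^n$. The point
      -- `c` is the centre of its missing subinterval `y'`; at a centre the row of the square is
      -- uniquely determined.
      set c : ℝ := (j + (y' + 1 / 2) / N) / (N ^ n : ℤ) with hc
      have f0 : 0 ≤ ((y' : ℝ) + 1 / 2) / N := by positivity
      have f1 : ((y' : ℝ) + 1 / 2) / N ≤ 1 := by rw [div_le_one (by linarith)]; linarith
      have hcm : c ∈ Set.Icc a b := by
        rw [hc, Set.mem_Icc, le_div_iff₀ hB', div_le_iff₀ hB']
        constructor <;> nlinarith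
      obtain ⟨x, hx, hxc⟩ := ht (hicc hcm)
      obtain ⟨p, hp, hxp⟩ := hK.exists_square hN hD (n + 1) hx
      have e : ((N ^ (n + 1) : ℤ) : ℝ) * x.2 = N * j + y' + 1 / 2 := by
        rw [hxc, hc, pow_succ]
        push_cast at hB' ⊢
        field_simp
        ring
      obtain ⟨-, -, k1, k2⟩ := hxp
      rw [e] at k1 k2
      have hp2 : p.2 = N * j + y' := by
        have l1 : (p.2 : ℝ) < ((N * j + y' + 1 : ℤ) : ℝ) := by push_cast; linarith
        have l2 : ((N * j + y' : ℤ) : ℝ) < ((p.2 + 1 : ℤ) : ℝ) := by push_cast; linarith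
        have l1 := Int.cast_lt.1 l1
        have l2 := Int.cast_lt.1 l2
        omega
      have := (letter_mem hD hp).1
      rw [hp2, Int.mul_add_emod_self_left, Int.emod_eq_of_lt h0 h1] at this
      exact hmiss _ this
    intro a ha b hb
    exact le_antisymm (not_lt.1 (main b hb a ha)) (not_lt.1 (main a ha b hb))
  · ext x
    constructor
    · intro hx
      have := hK.bounds hN hD hx
      exact ⟨⟨this.1, this.2.1⟩, x, hx, rfl⟩
    · rintro ⟨⟨h0, h1⟩, z, hz, e⟩
      have := hprod z hz x.1 h0 h1
      rwa [e] at this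

theorem Attractor.swap (hK : Attractor N D K) :
    Attractor N (Prod.swap ⁻¹' D) (Prod.swap ⁻¹' K) where
  nonempty := hK.nonempty.preimage Prod.swap_surjective
  isCompact := by
    rw [← Set.image_swap_eq_preimage_swap]
    exact hK.isCompact.image continuous_swap
  mem_iff x := by
    rw [Set.mem_preimage, hK.mem_iff]
    constructor
    · rintro ⟨d, hd, y, hy, h1, h2⟩
      exact ⟨d.swap, by simpa using hd, y.swap, by simpa using hy, h2, h1⟩
    · rintro ⟨d, hd, y, hy, h1, h2⟩
      exact ⟨d.swap, hd, y.swap, hy, h2, h1⟩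

theorem IsCantorTimesInterval.of_swap (h : IsCantorTimesInterval (Prod.swap ⁻¹' K)) :
    IsCantorTimesInterval K := by
  obtain ⟨C, hC, h⟩ := h
  have e : K = Prod.swap ⁻¹' (Prod.swap ⁻¹' K) := by
    rw [← Set.preimage_comp, Prod.swap_swap_eq, Set.preimage_id]
  refine ⟨C, hC, ?_⟩
  rcases h with h | h
  · right; rw [e, h, Set.preimage_swap_prod]
  · left; rw [e, h, Set.preimage_swap_prod]

/-- Growing numbers of components leave uncountably many point components, or a product. -/
theorem Attractor.not_countable_or_product (hN : 2 ≤ N) (hD : InBox N D) (hK : Attractor N D K)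
    (hne : D.Nonempty) (hM : ManyComponents N D) :
    ¬ (pointComponents K).Countable ∨ IsCantorTimesInterval K := by
  by_cases hr : PartialRow N D
  · by_cases hc : PartialRow N (Prod.swap ⁻¹' D)
    · left
      obtain ⟨d₁, h₁⟩ := hne
      obtain ⟨d₂, h₂, h⟩ : ∃ d₂ ∈ D, d₁ ≠ d₂ := by
        by_contra! hall
        obtain ⟨n, p, hp, q, hq, hpq⟩ := hM.exists_not_linked ⟨d₁, h₁⟩
        have : ∀ n, ∀ p ∈ level N D n, ∀ q ∈ level N D n, p = q := by
          intro n
          induction n with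
          | zero =>
            intro p hp q hq
            rw [Set.mem_singleton_iff.1 hp, Set.mem_singleton_iff.1 hq]
          | succ n ih =>
            rintro _ ⟨w, hw, d, hd, rfl⟩ _ ⟨w', hw', d', hd', rfl⟩
            rw [ih w hw w' hw', ← hall d hd, ← hall d' hd']
        exact hpq (this n p hp q hq ▸ Linked.refl _)
      exact hK.not_countable_pointComponents hN hD (hM.hasCut hN hD ⟨d₁, h₁⟩ hr hc) h₁ h₂ h
    · exact Or.inr (IsCantorTimesInterval.of_swap (hK.swap.isCantorTimesInterval hN hD.swap
        (hne.preimage Prod.swap_surjective) hM.swap hc))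
  · exact Or.inr (hK.isCantorTimesInterval hN hD hne hM hr)

end Product

end FractalSquare

namespace FractalSquare

/-! ### Translation between natural-number digits and integer cells. -/

section Bridge

variable {N : ℕ} {D : Finset (ℕ × ℕ)}

/-- A digit as a cell. -/
def toCell (d : ℕ × ℕ) : ℤ × ℤ := ((d.1 : ℤ), (d.2 : ℤ))

theorem level_toCell (N : ℕ) (D : Finset (ℕ × ℕ)) (n : ℕ) :
    level (N : ℤ) (toCell '' (D : Set (ℕ × ℕ))) n = toCell '' (iterDigits N D n : Set (ℕ × ℕ)) := by
  induction n with
  | zero => simp [level, iterDigits, toCell]; rfl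
  | succ n ih =>
    ext p
    rw [mem_level_succ, ih]
    simp only [iterDigits, Finset.coe_image, Finset.coe_product, Set.mem_image, Set.mem_prod,
      Finset.mem_coe]
    constructor
    · rintro ⟨_, ⟨w, hw, rfl⟩, _, ⟨d, hd, rfl⟩, rfl⟩
      exact ⟨_, ⟨(w, d), ⟨hw, hd⟩, rfl⟩, by simp [toCell, cat]⟩
    · rintro ⟨_, ⟨⟨w, d⟩, ⟨hw, hd⟩, rfl⟩, rfl⟩
      exact ⟨_, ⟨w, hw, rfl⟩, _, ⟨d, hd, rfl⟩, by simp [toCell, cat]⟩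

theorem inBox_toCell (h : D ⊆ Finset.range N ×ˢ Finset.range N) :
    InBox N (toCell '' (D : Set (ℕ × ℕ))) := by
  rintro _ ⟨d, hd, rfl⟩
  have := h hd
  simp only [Finset.mem_product, Finset.mem_range] at this
  simp only [toCell]
  omega

theorem digitMap_image_Icc {B : ℕ} (hB : 0 < B) (d : ℕ × ℕ) :
    digitMap B d '' (Set.Icc 0 1 ×ˢ Set.Icc 0 1) = square B (toCell d) := by
  have hB' : (B : ℝ) ≠ 0 := by exact_mod_cast hB.ne'
  ext x
  simp only [Set.mem_image, square, Set.mem_ofPred_eq, toCell, Set.mem_prod, Set.mem_Icc,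
    Int.cast_natCast]
  constructor
  · rintro ⟨y, ⟨⟨h1, h2⟩, h3, h4⟩, rfl⟩
    simp only [digitMap, mul_div_cancel₀ _ hB']
    refine ⟨by linarith, by linarith, by linarith, by linarith⟩
  · rintro ⟨h1, h2, h3, h4⟩
    refine ⟨(B * x.1 - d.1, B * x.2 - d.2), ⟨⟨by simp only; linarith, by simp only; linarith⟩,
      by simp only; linarith, by simp only; linarith⟩, ?_⟩
    simp only [digitMap, sub_add_cancel, mul_div_cancel_left₀ _ hB']

theorem approximation_eq (hN : 0 < N) (D : Finset (ℕ × ℕ)) (n : ℕ) :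
    approximation N D n = approx N (toCell '' (D : Set (ℕ × ℕ))) n := by
  simp only [approximation, approx, level_toCell, Set.biUnion_image, Finset.mem_coe,
    digitMap_image_Icc (pow_pos hN n)]
  push_cast
  rfl

theorem attractor_of_isFractalSquare (hN : 0 < N) {K : Set (ℝ × ℝ)} (hK : IsFractalSquare N D K) :
    Attractor N (toCell '' (D : Set (ℕ × ℕ))) K where
  nonempty := hK.nonempty
  isCompact := hK.isCompact
  mem_iff x := by
    have hN' : (N : ℝ) ≠ 0 := by exact_mod_cast hN.ne'
    have h : x ∈ K ↔ x ∈ ⋃ d ∈ D, digitMap N d '' K := by rw [← hK.eq_iUnion]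
    rw [h]
    simp only [Set.mem_iUnion, Set.mem_image, Finset.mem_coe, exists_prop, toCell]
    constructor
    · rintro ⟨d, hd, y, hy, rfl⟩
      exact ⟨_, ⟨d, hd, rfl⟩, y, hy, by simp [digitMap, mul_div_cancel₀ _ hN'],
        by simp [digitMap, mul_div_cancel₀ _ hN']⟩
    · rintro ⟨_, ⟨d, hd, rfl⟩, y, hy, h1, h2⟩
      simp only [Int.cast_natCast] at h1 h2
      refine ⟨d, hd, y, hy, ?_⟩
      simp only [digitMap, ← h1, ← h2, mul_div_cancel_left₀ _ hN']

end Bridge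

end FractalSquare

open FractalSquare in
theorem mainTheorem1 (N : ℕ) (hN : 2 ≤ N) (D : Finset (ℕ × ℕ)) (hD : D.Nonempty)
    (hDN : D ⊆ Finset.range N ×ˢ Finset.range N)
    (K : Set (ℝ × ℝ)) (hK : IsFractalSquare N D K) :
    ((∃ n : ℕ, 2 ≤ n ∧
          numComponents (approximation N D n) = numComponents (approximation N D (n + 1)) ∧
          numComponents (approximation N D (n + 1)) = numComponents K) ∨
        ∀ n : ℕ, 2 ≤ n →
          numComponents (approximation N D n) < numComponents (approximation N D (n + 1))) ∧
      ((∀ n : ℕ, 2 ≤ n →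
          numComponents (approximation N D n) < numComponents (approximation N D (n + 1))) →
        ¬ (pointComponents K).Countable ∨ IsCantorTimesInterval K) := by
  have hNZ : (2 : ℤ) ≤ N := by exact_mod_cast hN
  have hbox := inBox_toCell hDN
  have hK' := attractor_of_isFractalSquare (by omega) hK
  set E := toCell '' (D : Set (ℕ × ℕ))
  have hne : E.Nonempty := (Finset.coe_nonempty.2 hD).image _
  have hcard : ∀ n, ENat.card (Comp N E n) = (Nat.card (Comp N E n) : ℕ∞) := fun n => by
    have := finite_comp hbox n
    exact ENat.card_eq_coe_natCard _
  have hcomp : ∀ n, numComponents (approximation N D n) = (Nat.card (Comp N E n) : ℕ∞) := fun n => by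
    rw [approximation_eq (by omega), numComponents_approx hNZ hbox hne, hcard]
  simp only [hcomp, Nat.cast_inj, Nat.cast_lt]
  refine ⟨?_, fun h => hK'.not_countable_or_product hNZ hbox hne (manyComponents_of_lt hbox h)⟩
  by_cases hex : ∃ n, 2 ≤ n ∧ Nat.card (Comp N E n) = Nat.card (Comp N E (n + 1))
  · obtain ⟨n, hn, h⟩ := hex
    have H := rigid_of_le hNZ hbox hn ((card_comp_eq_iff hbox hne n).1 h)
    exact Or.inl ⟨n, hn, h, by rw [hK'.numComponents_eq hNZ hbox hne H, hcard, h]⟩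
  · push Not at hex
    exact Or.inr fun n hn => lt_of_le_of_ne (card_comp_le hbox hne n) (hex n hn)
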